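/- **Source.** A block consists of three pulses; each pulse is described on the Fock space of a set of optical modes. For a bit $b$ encoded on the $u$-th pulse ($u=1,2,3$) the pulse is in the state $\hat\rho^{b}_{S_u}$, and a block with bits $\boldsymbol b=b^{(1)}b^{(2)}b^{(3)}$ is in the state $\hat\rho^{\boldsymbol b}_{\boldsymbol S}=\bigotimes_u\hat\rho^{b^{(u)}}_{S_u}$. Assume that $\langle{\rm vac}|\hat\rho^{0}_{S_u}|{\rm vac}\rangle=\langle{\rm vac}|\hat\rho^{1}_{S_u}|{\rm vac}\rangle$ for all $u$, and that for every $\boldsymbol b$ and every $n\in\{1,2,3\}$ the probability that a block in the state $\hat\rho^{\boldsymbol b}_{\boldsymbol S}$ contains $n$ or more photons in total is at most $q_n$. For all $u,b$ let $|\psi_b\rangle_{S_uR_u}$ be a purification of $\hat\rho^{b}_{S_u}$, with $R_u$ held by Alice, such that $\langle{\rm vac}|_{S_u}|\psi_0\rangle=\langle{\rm vac}|_{S_u}|\psi_1\rangle$. (Such purifications exist; this is part of the claim.) **Protocol.** Alice prepares $N_{\rm em}$ independent blocks, each with three auxiliary qubits $A_1A_2A_3$, in the state $2^{-3/2}\bigotimes_{u}\sum_{b=0,1}\hat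 H|b\rangle_{A_u}|\psi_b\rangle_{S_uR_u}$ ($\hat H$ the Hadamard matrix) and sends all pulses $S$. An arbitrary joint quantum operation acts on the pulses of all blocks (the channel, Eve's attack, and Bob's one-bit-delay interferometer with photon counting up to the decision whether exactly one photon arrives in time slots 1 and 2 of a block). It yields, for each round, either "not detected" or a three-level system $B$ with basis $|1\rangle,|2\rangle,|3\rangle$. Put $w_1=w_3=1$, $w_2=\frac12$, $|\Pi_{j,d}\rangle=\frac{1}{\sqrt2}\big(\sqrt{w_j}|j\rangle+(-1)^d\sqrt{w_{j+1}}|j+1\rangle\big)$, $\hat\Pi_{j,d}=|\Pi_{j,d}\rangle\langle\Pi_{j,d}|$ ($j=1,2$, $d=0,1$), and, with $\hat P[|x\rangle]=|x\rangle\langle x|$, $$\hat e_{\rm ph}=\sum_{j=1}^2\sum_{\boldsymbol z\in\{0,1\}^3}\hat P[|\boldsymbol z\rangle_{A}]\otimes\big(w_j\delta_{z_{j+1},1}\hat P[|j\rangle]+w_{j+1}\delta_{z_j,1}\hat P[|j+1\rangle]\big),$$ $$\hat e_{\rm bit}=\sum_{j=1}^2\Big[\big(\hat P[|{+}{+}\rangle]+\hat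 P[|{-}{-}\rangle]\big)_{A_jA_{j+1}}\otimes\hat\Pi_{j,1}+\big(\hat P[|{+}{-}\rangle]+\hat P[|{-}{+}\rangle]\big)_{A_jA_{j+1}}\otimes\hat\Pi_{j,0}\Big].$$ Each detected round is independently a code round with probability $t$ and a sample round with probability $1-t$, $0<t<1$. In a code round the weight $a$ of $\boldsymbol z$ is measured in the $Z$ basis of $A_1A_2A_3$, together with $\{\hat e_{\rm ph},1-\hat e_{\rm ph}\}$ (phase error or not); in a sample round $\{\hat e_{\rm bit},1-\hat e_{\rm bit}\}$ is measured (bit error or not). Let $N_{\det}$ be the number of detected rounds, $N_{\rm samp}$ the number of sample rounds, $e_{\rm bit}$ the fraction of sample rounds with a bit error, and $N_{\rm ph}$ the number of code rounds with a phase error. **Theorem.** For all $0<\epsilon_1,\epsilon_2\le1$, all $N_{\rm em}$ and every such joint operation, $\Pr[N_{\rm ph}>N^{\rm U}_{\rm ph}]\le3\epsilon_1+3\epsilon_2$, where $$N^{\rm U}_{\rm ph}=\frac{\lambda te_{\rm bit}N_{\rm samp}}{1-t}+(tq_2N_{\rm em}+\Gamma_2)+\lambda\sqrt{\big[tq_1N_{\rm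 em}+\Gamma_1+\Delta(1,\epsilon_1)\big]\Big\{(tq_3N_{\rm em}+\Gamma_3)\Big(1+\frac{2a^*}{\sqrt{N_{\det}}}\Big)+(b^*-a^*)\sqrt{N_{\det}}\Big\}}+t\Delta(D^2,\epsilon_1),$$ $\lambda=3+\sqrt5$, $\Delta(x,y)=\sqrt{2xN_{\det}\ln\frac1y}$, $\Gamma_n=\frac12\big[-\ln\epsilon_2+\sqrt{(\ln\epsilon_2)^2-8tq_nN_{\rm em}\ln\epsilon_2}\big]$, $D=\max\{\frac{\lambda}{1-t}+1,\frac1t+\lambda+1\}$, $N_3^*=\min\{tq_3N_{\rm em}+\Gamma_3,\lfloor(N_{\det}-1)/2\rfloor\}$, $a^*=a^*(N_{\det},N_3^*,\epsilon_1)$, $b^*=b^*(N_{\det},N_3^*,\epsilon_1)$, with $$a^*(n,m,\epsilon)=\max\Big\{-\frac{\sqrt n}2,\frac{216\sqrt n\,m(n-m)\ln\epsilon-48n^{3/2}(\ln\epsilon)^2+27\sqrt2(n-2m)\sqrt{-n^2(\ln\epsilon)[9m(n-m)-2n\ln\epsilon]}}{4(9n-8\ln\epsilon)[9m(n-m)-2n\ln\epsilon]}\Big\},$$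 $$b^*(n,m,\epsilon)=\frac{\sqrt{18a^*(n,m,\epsilon)^2n-[16a^*(n,m,\epsilon)^2+24a^*(n,m,\epsilon)\sqrt n+9n]\ln\epsilon}}{3\sqrt{2n}}.$$ A fraction with zero denominator, which can occur only if $N_{\det}=0$, $N_{\rm samp}=0$ or $\epsilon_1=1$, is read as $0$. -/

import Mathlib

open scoped lp Kronecker

noncomputable section

namespace DPS

/-! ### Hilbert-space preliminaries: `ℓ²` over an index set, with its standard basis -/

section Hilbert

variable {α β ι : Type*}

open Classical in
/-- Matrix element `⟨x| A |y⟩` of a bounded operator in the standard basis of `ℓ²(α)`. -/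
def matEl (A : ℓ²(α, ℂ) →L[ℂ] ℓ²(α, ℂ)) (x y : α) : ℂ :=
  A (lp.single 2 y (1 : ℂ)) x

/-- Density operators: positive operators of trace one. -/
def IsDensity (A : ℓ²(α, ℂ) →L[ℂ] ℓ²(α, ℂ)) : Prop :=
  A.IsPositive ∧ HasSum (fun x => matEl A x x) 1

theorem summable_norm_sq (f : ℓ²(α, ℂ)) : Summable fun x => ‖f x‖ ^ 2 := by
  have h := (memℓp_gen_iff (p := 2) (by norm_num)).1 (lp.memℓp f)
  simpa using h

theorem memℓp_two_of_summable {f : α → ℂ} (h : Summable fun x => ‖f x‖ ^ 2) :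
    Memℓp (E := fun _ : α => ℂ) f 2 :=
  memℓp_gen (by simpa using h)

/-- The vector `⟨r|_β v` of `ℓ²(α)`, for a vector `v` of `ℓ²(α × β)`. -/
def component (v : ℓ²(α × β, ℂ)) (r : β) : ℓ²(α, ℂ) :=
  ⟨fun x => v (x, r), memℓp_two_of_summable
    ((summable_norm_sq v).comp_injective (i := fun x : α => (x, r))
      (fun _ _ h => (Prod.mk.inj h).1))⟩

theorem summable_prod_norm_sq [Fintype ι] (f : ι → ℓ²(α, ℂ)) :
    Summable fun x : ι → α => ‖∏ i, f i (x i)‖ ^ 2 := by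
  classical
  refine summable_of_sum_le (c := ∏ i, ∑' a, ‖f i a‖ ^ 2) (fun _ => by positivity) fun s => ?_
  let T : ι → Finset α := fun i => s.image fun x => x i
  have hs : s ⊆ Fintype.piFinset T := fun x hx =>
    Fintype.mem_piFinset.2 fun i => Finset.mem_image_of_mem _ hx
  calc ∑ x ∈ s, ‖∏ i, f i (x i)‖ ^ 2
      ≤ ∑ x ∈ Fintype.piFinset T, ‖∏ i, f i (x i)‖ ^ 2 :=
        Finset.sum_le_sum_of_subset_of_nonneg hs fun _ _ _ => by positivity
    _ = ∏ i, ∑ a ∈ T i, ‖f i a‖ ^ 2 := by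
        rw [Finset.prod_univ_sum]
        simp [norm_prod, Finset.prod_pow]
    _ ≤ ∏ i, ∑' a, ‖f i a‖ ^ 2 :=
        Finset.prod_le_prod (fun _ _ => by positivity) fun i _ =>
          (summable_norm_sq (f i)).sum_le_tsum _ fun _ _ => by positivity

/-- The product vector `⨂ i, f i`, in `ℓ²(ι → α) = ⨂ i, ℓ²(α)`. -/
def tensorVec [Fintype ι] (f : ι → ℓ²(α, ℂ)) : ℓ²(ι → α, ℂ) :=
  ⟨fun x => ∏ i, f i (x i), memℓp_two_of_summable (summable_prod_norm_sq f)⟩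

end Hilbert

/-! ### The source

`K` is the set of optical modes of a pulse. The Hilbert space of one pulse is the bosonic Fock space
over these modes, with its occupation-number basis indexed by `K →₀ ℕ`: the vacuum is `0` and the
number of photons in all modes is `Finsupp.degree`. Pulses are numbered by `Fin 3`. -/

/-- The signal states: `ρ u b` is the state of the `u`-th pulse of a block if the bit `b` is encoded
on it. -/
structure Source (K : Type*) where
  ρ : Fin 3 → Fin 2 → (ℓ²(K →₀ ℕ, ℂ) →L[ℂ] ℓ²(K →₀ ℕ, ℂ))
  density : ∀ u b, IsDensity (ρ u b)

namespace Source

variable {K : Type*} (src : Source K)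

/-- The vacuum probability of each pulse does not depend on the encoded bit. -/
def VacuumIndependent : Prop :=
  ∀ u, matEl (src.ρ u 0) 0 0 = matEl (src.ρ u 1) 0 0

/-- Probability that a block, prepared in the state `⨂ u, ρ u (b u)`, contains `n` or more photons
in total. -/
def photonTail (b : Fin 3 → Fin 2) (n : ℕ) : ℝ :=
  ∑' s : Fin 3 → (K →₀ ℕ),
    if n ≤ ∑ u, (s u).degree then ∏ u, (matEl (src.ρ u (b u)) (s u) (s u)).re else 0

/-- `q n` bounds the probability that a block contains `n` or more photons, `n = 1, 2, 3`. -/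
def PhotonBound (q : ℕ → ℝ) : Prop :=
  ∀ b, ∀ n ∈ ({1, 2, 3} : Set ℕ), src.photonTail b n ≤ q n

end Source

/-- Purifications `ψ u b` of the signal states, with purifying system `ℓ²(R)` in Alice's hands. The
purifications for the two bit values are chosen with the same (unnormalised) vacuum component
`⟨vac| ψ u b⟩`, so that no photon is emitted only if Alice's qubit is in the state `|0⟩`. -/
structure Purification {K : Type*} (src : Source K) (R : Type*) where
  ψ : Fin 3 → Fin 2 → ℓ²((K →₀ ℕ) × R, ℂ)
  purifies : ∀ u b s s',
    HasSum (fun r => ψ u b (s, r) * star (ψ u b (s', r))) (matEl (src.ρ u b) s s')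
  vacuum : ∀ u r, ψ u 0 (0, r) = ψ u 1 (0, r)

/-- The Hadamard matrix; its columns are the states `|+⟩` and `|-⟩`. -/
def hadamard : Matrix (Fin 2) (Fin 2) ℂ :=
  Matrix.of fun x y => (-1) ^ ((x : ℕ) * (y : ℕ)) / (Real.sqrt 2 : ℂ)

namespace Purification

variable {K R : Type*} {src : Source K} (P : Purification src R)

/-- The component `⟨z|_A ⟨r|_R` of the state `2^{-1/2} ∑ b, H |b⟩_A |ψ_b⟩_{SR}` of the `u`-th pulse
and its auxiliary systems. -/
def pulse (u : Fin 3) (z : Fin 2) (r : R) : ℓ²(K →₀ ℕ, ℂ) :=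
  ((Real.sqrt 2 : ℂ))⁻¹ • ∑ b, hadamard z b • component (P.ψ u b) r

/-- The component `⟨z|_A ⟨r|_R` of the state of all `N` blocks, where `z i u` is the `Z`-basis value
of Alice's `u`-th qubit of the `i`-th block. -/
def emitted {N : ℕ} (z : Fin N → Fin 3 → Fin 2) (r : Fin N → Fin 3 → R) :
    ℓ²(Fin N → Fin 3 → (K →₀ ℕ), ℂ) :=
  tensorVec fun i => tensorVec fun u => P.pulse u (z i u) (r i u)

end Purification

/-! ### Measurements on Alice's three qubits and Bob's three-level system

Bob's basis states `|1⟩, |2⟩, |3⟩` are indexed by `0, 1, 2 : Fin 3`; the time slots `j = 1, 2` by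
`0, 1 : Fin 2`, so that `j.castSucc` and `j.succ` are the `j`-th and the `(j+1)`-th pulse. -/

/-- `|v⟩⟨v|`. -/
def proj {n : Type*} (v : n → ℂ) : Matrix n n ℂ := Matrix.vecMulVec v (star v)

/-- The weights `w₁ = 1`, `w₂ = 1/2`, `w₃ = 1`. -/
def w : Fin 3 → ℝ := ![1, 1 / 2, 1]

/-- The vector `(√w_j |j⟩ + (-1)^d √w_{j+1} |j+1⟩) / √2`. -/
def bobKet (j d : Fin 2) : Fin 3 → ℂ :=
  ((Real.sqrt 2 : ℂ))⁻¹ • (Pi.single j.castSucc ((Real.sqrt (w j.castSucc) : ℝ) : ℂ)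
    + ((-1 : ℂ) ^ (d : ℕ)) • Pi.single j.succ ((Real.sqrt (w j.succ) : ℝ) : ℂ))

/-- Bob's POVM for the time slot `j` and the raw key bit `d` of a detected round. -/
def bobPOVM (j d : Fin 2) : Matrix (Fin 3) (Fin 3) ℂ := proj (bobKet j d)

/-- Tensor product of three one-qubit operators. -/
def qubitTensor (M : Fin 3 → Matrix (Fin 2) (Fin 2) ℂ) :
    Matrix (Fin 3 → Fin 2) (Fin 3 → Fin 2) ℂ :=
  Matrix.of fun z z' => ∏ u, M u (z u) (z' u)

/-- Projector on the one-qubit `X`-basis state `|+⟩` (`x = 0`) or `|-⟩` (`x = 1`). -/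
def xProj (x : Fin 2) : Matrix (Fin 2) (Fin 2) ℂ := proj fun y => hadamard y x

/-- Projector on the `X`-basis states `x` of `A_j` and `y` of `A_{j+1}`. -/
def xxProj (j x y : Fin 2) : Matrix (Fin 3 → Fin 2) (Fin 3 → Fin 2) ℂ :=
  qubitTensor (Function.update (Function.update (fun _ => 1) j.castSucc (xProj x)) j.succ (xProj y))

/-- The weight of a bit string. -/
def wt (z : Fin 3 → Fin 2) : ℕ := ∑ u, (z u : ℕ)

/-- The POVM element of a phase error. -/
def phaseError : Matrix ((Fin 3 → Fin 2) × Fin 3) ((Fin 3 → Fin 2) × Fin 3) ℂ :=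
  ∑ j : Fin 2, ∑ z : Fin 3 → Fin 2, proj (Pi.single z 1) ⊗ₖ
    ((if z j.succ = 1 then (w j.castSucc : ℂ) else 0) • proj (Pi.single j.castSucc 1)
      + (if z j.castSucc = 1 then (w j.succ : ℂ) else 0) • proj (Pi.single j.succ 1))

/-- The POVM element of a bit error. -/
def bitError : Matrix ((Fin 3 → Fin 2) × Fin 3) ((Fin 3 → Fin 2) × Fin 3) ℂ :=
  ∑ j : Fin 2, ((xxProj j 0 0 + xxProj j 1 1) ⊗ₖ bobPOVM j 1
    + (xxProj j 0 1 + xxProj j 1 0) ⊗ₖ bobPOVM j 0)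

/-- The projector on weight `a` of Alice's three qubits in the `Z` basis. -/
def weightProj (a : ℕ) : Matrix ((Fin 3 → Fin 2) × Fin 3) ((Fin 3 → Fin 2) × Fin 3) ℂ :=
  (∑ z : Fin 3 → Fin 2, if wt z = a then proj (Pi.single z 1) else 0) ⊗ₖ 1

/-! ### The outcomes of the rounds and their joint law -/

/-- Outcome of one round: not detected; a code round, with the phase-error flag and the weight; or a
sample round, with the bit-error flag. -/
inductive Outcome
  | undetected
  | code (ph : Bool) (a : Fin 4)
  | sample (bit : Bool)
  deriving DecidableEq, Fintype

/-- POVM elements of the outcomes of a detected round, in which a code round is chosen with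
probability `t`. -/
def detectedOp (t : ℝ) : Outcome → Matrix ((Fin 3 → Fin 2) × Fin 3) ((Fin 3 → Fin 2) × Fin 3) ℂ
  | .undetected => 0
  | .code true a => (t : ℂ) • (weightProj a * phaseError)
  | .code false a => (t : ℂ) • (weightProj a * (1 - phaseError))
  | .sample true => ((1 - t : ℝ) : ℂ) • bitError
  | .sample false => ((1 - t : ℝ) : ℂ) • (1 - bitError)

/-- POVM elements of one round. The state `none` of Bob's system means that the round is not detected;
on its orthogonal complement Bob holds the three-level system of a detected round. -/
def roundOp (t : ℝ) (o : Outcome) :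
    Matrix ((Fin 3 → Fin 2) × Option (Fin 3)) ((Fin 3 → Fin 2) × Option (Fin 3)) ℂ :=
  Matrix.of fun x y =>
    match x.2, y.2 with
    | none, none => if o = .undetected ∧ x.1 = y.1 then 1 else 0
    | some k, some l => detectedOp t o (x.1, k) (y.1, l)
    | _, _ => 0

/-- The product POVM element of the outcomes `o` of all rounds, on Alice's and Bob's systems. -/
def jointOp {N : ℕ} (t : ℝ) (o : Fin N → Outcome) :
    Matrix ((Fin N → Fin 3 → Fin 2) × (Fin N → Option (Fin 3)))
      ((Fin N → Fin 3 → Fin 2) × (Fin N → Option (Fin 3))) ℂ :=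
  Matrix.of fun x y => ∏ i, roundOp t (o i) (x.1 i, x.2 i) (y.1 i, y.2 i)

/-- An attack: an arbitrary joint isometry from the pulses of all blocks to Bob's systems and a system
`ℓ²(E)` of Eve and the environment. It comprises the quantum channel, Eve's action, and Bob's
interferometer and photon counting up to the decision which rounds are detected. -/
abbrev Attack (K : Type*) (N : ℕ) (E : Type*) :=
  ℓ²(Fin N → Fin 3 → (K →₀ ℕ), ℂ) →ₗᵢ[ℂ] ℓ²((Fin N → Option (Fin 3)) × E, ℂ)

section Law

variable {K R E : Type*} {src : Source K} {N : ℕ}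

/-- The component of the state after the attack at the basis states `r` of Alice's purifying systems
and `e` of Eve's system: an unnormalised vector of Alice's qubits and Bob's systems. -/
def attackedVec (P : Purification src R) (V : Attack K N E) (r : Fin N → Fin 3 → R) (e : E) :
    (Fin N → Fin 3 → Fin 2) × (Fin N → Option (Fin 3)) → ℂ :=
  fun x => V (P.emitted x.1 r) (x.2, e)

/-- Born's rule: the probability of the outcomes `o` in the `N` rounds. -/
def prob (t : ℝ) (P : Purification src R) (V : Attack K N E) (o : Fin N → Outcome) : ℝ :=
  ∑' re : (Fin N → Fin 3 → R) × E,
    (star (attackedVec P V re.1 re.2) ⬝ᵥ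
      (jointOp t o).mulVec (attackedVec P V re.1 re.2)).re

open Classical in
/-- The probability of an event of the outcomes of the `N` rounds. -/
def Pr (t : ℝ) (P : Purification src R) (V : Attack K N E) (A : (Fin N → Outcome) → Prop) : ℝ :=
  ∑ o with A o, prob t P V o

end Law

/-! ### Observed numbers -/

section Counts

variable {N : ℕ} (o : Fin N → Outcome)

/-- Number of detected rounds. -/
def Ndet : ℕ := (Finset.univ.filter fun i => o i ≠ .undetected).card

/-- Number of sample rounds. -/
def Nsamp : ℕ := (Finset.univ.filter fun i => ∃ c, o i = .sample c).card

/-- Number of bit errors in the sample rounds. -/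
def Nbit : ℕ := (Finset.univ.filter fun i => o i = .sample true).card

/-- Bit error rate in the sample rounds. -/
def ebit : ℝ := (Nbit o : ℝ) / Nsamp o

/-- Number of phase errors in the code rounds. -/
def Nph : ℕ := (Finset.univ.filter fun i => ∃ a, o i = .code true a).card

end Counts

/-! ### The bound -/

def lam : ℝ := 3 + Real.sqrt 5

/-- `Δ(x, y)` for `n` detected rounds. -/
def Delta (n x y : ℝ) : ℝ := Real.sqrt (2 * x * n * Real.log (1 / y))

/-- `Γ` for the mean `μ = t q N_em` and the failure probability `ε`. -/
def Gam (μ ε : ℝ) : ℝ :=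
  1 / 2 * (-Real.log ε + Real.sqrt (Real.log ε ^ 2 - 8 * μ * Real.log ε))

def Dmax (t : ℝ) : ℝ := max (lam / (1 - t) + 1) (1 / t + lam + 1)

def aStar (n m ε : ℝ) : ℝ :=
  max (-(Real.sqrt n / 2))
    ((216 * Real.sqrt n * m * (n - m) * Real.log ε - 48 * n ^ (3 / 2 : ℝ) * Real.log ε ^ 2
        + 27 * Real.sqrt 2 * (n - 2 * m) *
          Real.sqrt (-(n ^ 2 * Real.log ε * (9 * m * (n - m) - 2 * n * Real.log ε))))
      / (4 * (9 * n - 8 * Real.log ε) * (9 * m * (n - m) - 2 * n * Real.log ε)))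

def bStar (n m ε : ℝ) : ℝ :=
  Real.sqrt (18 * aStar n m ε ^ 2 * n
      - (16 * aStar n m ε ^ 2 + 24 * aStar n m ε * Real.sqrt n + 9 * n) * Real.log ε)
    / (3 * Real.sqrt (2 * n))

/-- The prediction `N₃*`, for `n` detected rounds and the Chernoff bound `M₃ = t q₃ N_em + Γ₃`. -/
def N3Star (n M₃ : ℝ) : ℝ := min M₃ ((⌊(n - 1) / 2⌋ : ℤ) : ℝ)

/-- The upper bound on the number of phase errors, as a function of the parameters and of the observed
numbers (`Nem` emitted blocks, `n` detected rounds, `ns` sample rounds, bit error rate `e`). -/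
def NphU (t : ℝ) (q : ℕ → ℝ) (ε₁ ε₂ Nem n ns e : ℝ) : ℝ :=
  let M : ℕ → ℝ := fun k => t * q k * Nem + Gam (t * q k * Nem) ε₂
  let a := aStar n (N3Star n (M 3)) ε₁
  let b := bStar n (N3Star n (M 3)) ε₁
  lam * t * e * ns / (1 - t) + M 2
    + lam * Real.sqrt ((M 1 + Delta n 1 ε₁) *
        (M 3 * (1 + 2 * a / Real.sqrt n) + (b - a) * Real.sqrt n))
    + t * Delta n (Dmax t ^ 2) ε₁

end DPS

end

/-! Alice's qubits never leave her, so the outcomes come from measuring one fixed state round by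
round. Three estimates are combined.

One-round operator inequality. With `P_a` the projector on weight `a`, `phaseError ≤ lam • bitError
+ P₂ + lam/2 (s P₁ + P₃/s)` for every `s > 0` (`phaseError_le`). Optimising `s` gives, for every
positive functional, a bound with the term `lam √(P₁ P₃)` (`phaseError_le_sqrt`). Fixing the
outcomes of earlier rounds and summing over later ones leaves a positive functional of the operator
of the current round (`allSteps_tensorOp`). The inequality therefore holds for all conditional laws,
however the attack correlates the rounds (`isStepLaw_stepOp`).

Concentration. The conditional inequalities are added over the rounds, and Cauchy-Schwarz moves the
sum under the root (`acc_sqrt_le`). Sums of conditional expectations are then replaced by counts: by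
Azuma's inequality for the combination `excess` of errors and for weight one, and by Kato's
inequality for weight three, where the count is expected to be small (`kato_tail`). All this is done
for a fixed pattern of detected rounds, so that `Ndet` is a constant and `aStar`, `bStar` may depend
on it; laws are left unnormalised and the patterns are summed at the end. The failure probability is
`3 * ε₁`.

Source. A qubit with value 1 has no vacuum component, so weight `k` needs at least `k` photons
(`sum_wt_zProb_le`). The `Z` values are unaffected by the attack, so the number `W` of code rounds
of weight `k` satisfies `𝔼 (1 + c)^W ≤ (1 + t c q_k)^N` (`sum_prob_mul_prod_codeWt_le`), and
Chernoff's bound costs `ε₂` for each of `k = 1, 2, 3`.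

Kato's inequality rests on a sharp estimate of the moment-generating function of a two-valued
variable (`cosh_add_sinh_le`). The purifications are obtained from square roots of the density
operators by rotating the purifying system. -/

noncomputable section

namespace DPS

/-! ### The moment-generating function of a two-valued variable -/

section Kato

/-- Parametrisation of the optimal skewness parameter. -/
def katoW (τ Z : ℝ) : ℝ := (9 - Z ^ 2) / (3 * (3 + τ * Z))

/-- For `w > 0`, `katoExponent τ y` is stationary at `w` exactly when `3 w (3 + τ Z) = 9 - Z²` with
`Z = y w²`. Solving for `w` gives `katoW`, and `y = Z / w²` is this function. -/
def katoY (τ Z : ℝ) : ℝ := 9 * Z * (3 + τ * Z) ^ 2 / (9 - Z ^ 2) ^ 2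

/-- Kato's exponent with skewness `α` corresponds to `w = (1 + 2α/3) / (1 + α)`. The value `w = 1`
gives Hoeffding's exponent `τ y + y² / 2`. -/
def katoExponent (τ y w : ℝ) : ℝ :=
  y ^ 2 * w ^ 2 / 2 + 3 * τ * y * w - 2 * τ * y + 9 / 2 * (1 / w - 1) ^ 2

def katoM (τ Z : ℝ) : ℝ :=
  9 * Z ^ 2 * (3 + τ * Z) ^ 2 / (2 * (9 - Z ^ 2) ^ 2) + 9 * τ * Z * (3 + τ * Z) / (9 - Z ^ 2)
    - 18 * τ * Z * (3 + τ * Z) ^ 2 / (9 - Z ^ 2) ^ 2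
    + 9 / 2 * (3 * (3 + τ * Z) / (9 - Z ^ 2) - 1) ^ 2

/-- The derivative of the optimal exponent `katoM` along the curve with respect to `y = katoY`, not
with respect to `Z`. -/
def katoSlope (τ Z : ℝ) : ℝ := (3 * Z + 3 * τ - 2 * τ ^ 2 * Z) / (3 + τ * Z)

def katoYDeriv (τ Z : ℝ) : ℝ :=
  9 * (3 + τ * Z) * (27 + 27 * τ * Z + 9 * Z ^ 2 + τ * Z ^ 3) / (9 - Z ^ 2) ^ 3

theorem katoM_eq {τ Z : ℝ} (h1 : 0 < 9 - Z ^ 2) :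
    katoExponent τ (katoY τ Z) (katoW τ Z) = katoM τ Z := by
  unfold katoExponent katoY katoW katoM
  field_simp
  ring

theorem hasDerivAt_katoY {τ Z : ℝ} (h1 : 0 < 9 - Z ^ 2) :
    HasDerivAt (katoY τ) (katoYDeriv τ Z) Z := by
  have hn : HasDerivAt (fun Z : ℝ => 9 * Z * (3 + τ * Z) ^ 2)
      (9 * (3 + τ * Z) ^ 2 + 9 * Z * (2 * (3 + τ * Z) * τ)) Z := by
    have := (((hasDerivAt_id Z).const_mul 9).mul
      ((((hasDerivAt_id Z).const_mul τ).const_add 3).pow 2))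
    refine this.congr_deriv ?_
    simp
  have hd : HasDerivAt (fun Z : ℝ => (9 - Z ^ 2) ^ 2) (2 * (9 - Z ^ 2) * (-(2 * Z))) Z := by
    have := (((hasDerivAt_id Z).pow 2).const_sub 9).pow 2
    refine this.congr_deriv ?_
    simp
  refine (hn.div hd (by positivity)).congr_deriv ?_
  unfold katoYDeriv
  field_simp
  ring

theorem hasDerivAt_katoSlope {τ Z : ℝ} (h2 : 0 < 3 + τ * Z) :
    HasDerivAt (katoSlope τ) (9 * (1 - τ ^ 2) / (3 + τ * Z) ^ 2) Z := by
  have hn : HasDerivAt (fun Z : ℝ => 3 * Z + 3 * τ - 2 * τ ^ 2 * Z) (3 - 2 * τ ^ 2) Z := by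
    have := (((hasDerivAt_id Z).const_mul 3).add_const (3 * τ)).sub
      ((hasDerivAt_id Z).const_mul (2 * τ ^ 2))
    refine this.congr_deriv ?_
    simp
  have hd : HasDerivAt (fun Z : ℝ => 3 + τ * Z) τ Z := by
    have := ((hasDerivAt_id Z).const_mul τ).const_add 3
    refine this.congr_deriv ?_
    simp
  refine (hn.div hd h2.ne').congr_deriv ?_
  field_simp
  ring

theorem hasDerivAt_katoM {τ Z : ℝ} (h1 : 0 < 9 - Z ^ 2) (h2 : 0 < 3 + τ * Z) :
    HasDerivAt (katoM τ) (katoSlope τ Z * katoYDeriv τ Z) Z := by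
  have hid := hasDerivAt_id Z
  have ha : HasDerivAt (fun Z : ℝ => 3 + τ * Z) τ Z :=
    ((hid.const_mul τ).const_add 3).congr_deriv (by simp)
  have hd : HasDerivAt (fun Z : ℝ => 9 - Z ^ 2) (-(2 * Z)) Z :=
    ((hid.pow 2).const_sub 9).congr_deriv (by simp)
  have hu : HasDerivAt (fun Z : ℝ => (3 + τ * Z) / (9 - Z ^ 2))
      ((τ * (9 - Z ^ 2) + (3 + τ * Z) * (2 * Z)) / (9 - Z ^ 2) ^ 2) Z :=
    (ha.div hd h1.ne').congr_deriv (by ring)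
  have h := (((((hid.mul hu).pow 2).const_mul (9 / 2)).add ((hid.mul hu).const_mul (9 * τ))).sub
    ((hid.mul (hu.pow 2)).const_mul (18 * τ))).add
      (((((hu.const_mul 3).sub_const 1).pow 2).const_mul (9 / 2)))
  have he : katoM τ = fun Z : ℝ => 9 / 2 * (Z * ((3 + τ * Z) / (9 - Z ^ 2))) ^ 2
      + 9 * τ * (Z * ((3 + τ * Z) / (9 - Z ^ 2))) - 18 * τ * (Z * ((3 + τ * Z) / (9 - Z ^ 2)) ^ 2)
      + 9 / 2 * (3 * ((3 + τ * Z) / (9 - Z ^ 2)) - 1) ^ 2 := by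
    funext X
    unfold katoM
    by_cases hX : 9 - X ^ 2 = 0
    · simp [hX]
    · field_simp
  rw [he]
  refine HasDerivAt.congr_deriv (f' := _) h ?_
  have hs : katoSlope τ Z * katoYDeriv τ Z = 9 * (3 * Z + 3 * τ - 2 * τ ^ 2 * Z) *
      (27 + 27 * τ * Z + 9 * Z ^ 2 + τ * Z ^ 3) / (9 - Z ^ 2) ^ 3 := by
    have := h2.ne'
    rw [katoSlope, katoYDeriv, div_mul_div_comm, div_eq_div_iff (by positivity) (by positivity)]
    ring
  rw [hs]
  simp only [id, Pi.mul_apply, Pi.pow_apply, Nat.cast_ofNat, Nat.add_one_sub_one, pow_one]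
  field_simp
  ring

/-- In the variables `x` and `p` the difference of the two sides is a positive factor times a
quadratic in `p ≥ 0`. For `x ≤ 6/5` all its coefficients are nonnegative; for `6/5 ≤ x ≤ 2` its
discriminant is nonpositive. -/
theorem kato_poly {T z : ℝ} (hz : 0 ≤ z) (hz1 : z < 1) (h1 : -z ≤ T) (h2 : T ≤ z) :
    (1 + T) * (1 + 3 * T + 3 * z ^ 2 + T * z ^ 2) * ((1 - 2 * T) ^ 2 - 9 * z ^ 2)
      ≤ (1 - z ^ 2) ^ 3 := by
  have hT : 0 < 1 + T := by linarith
  have hz2 : 0 < 1 - z ^ 2 := by nlinarith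
  obtain ⟨x, hx⟩ : ∃ x, x = (1 - z ^ 2) / (1 + T) := ⟨_, rfl⟩
  obtain ⟨p, hp⟩ : ∃ p, p = (z ^ 2 - T ^ 2) * (1 - z ^ 2) / (1 + T) ^ 2 := ⟨_, rfl⟩
  have hx0 : 0 < x := by rw [hx]; positivity
  have hx2 : x ≤ 2 := by rw [hx, div_le_iff₀ hT]; nlinarith
  have hp0 : 0 ≤ p := by
    have : 0 ≤ z ^ 2 - T ^ 2 := by nlinarith
    rw [hp]; positivity
  have hf : 0 ≤ 4 * p ^ 2 + p * (16 - 12 * x - x ^ 2) + 4 * x * (1 - x) ^ 2 * (4 - x) := by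
    have h4 : 0 ≤ 4 - x := by linarith
    rcases le_total x (6 / 5) with h | h
    · have : 0 ≤ 16 - 12 * x - x ^ 2 := by nlinarith
      positivity
    · have : 0 ≤ 64 * x * (1 - x) ^ 2 * (4 - x) - (16 - 12 * x - x ^ 2) ^ 2 := by
        obtain ⟨v, rfl⟩ : ∃ v, x = 6 / 5 + v := ⟨x - 6 / 5, by ring⟩
        have hv : 0 ≤ v := by linarith
        have hv' : v ≤ 4 / 5 := by linarith
        nlinarith [mul_nonneg hv (sub_nonneg.2 hv'), mul_nonneg (mul_nonneg hv hv) (sub_nonneg.2 hv'),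
          mul_nonneg (mul_nonneg (mul_nonneg hv hv) hv) (sub_nonneg.2 hv')]
      nlinarith [sq_nonneg (8 * p + (16 - 12 * x - x ^ 2))]
  have key : (1 - z ^ 2) ^ 3 -
      (1 + T) * (1 + 3 * T + 3 * z ^ 2 + T * z ^ 2) * ((1 - 2 * T) ^ 2 - 9 * z ^ 2)
      = (1 + T) ^ 4 / (1 - z ^ 2) *
        (4 * p ^ 2 + p * (16 - 12 * x - x ^ 2) + 4 * x * (1 - x) ^ 2 * (4 - x)) := by
    rw [hp, hx]
    field_simp
    ring
  have : 0 ≤ (1 + T) ^ 4 / (1 - z ^ 2) *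
        (4 * p ^ 2 + p * (16 - 12 * x - x ^ 2) + 4 * x * (1 - x) ^ 2 * (4 - x)) := by positivity
  linarith

theorem katoYDeriv_nonneg {τ Z : ℝ} (hτ : -1 ≤ τ) (h0 : 0 ≤ Z) (h3 : Z < 3) :
    0 ≤ katoYDeriv τ Z := by
  unfold katoYDeriv
  have h2 : 0 ≤ 3 + τ * Z := by nlinarith
  have h1 : 0 ≤ 9 - Z ^ 2 := by nlinarith
  have h4 : 0 ≤ 27 + 27 * τ * Z + 9 * Z ^ 2 + τ * Z ^ 3 := by
    have : 27 + 27 * τ * Z + 9 * Z ^ 2 + τ * Z ^ 3 = (3 - Z) ^ 3 + (1 + τ) * (27 * Z + Z ^ 3) := by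
      ring
    rw [this]
    have := sub_nonneg.2 h3.le
    have : 0 ≤ 1 + τ := by linarith
    positivity
  positivity

/-- For the slope `m = dM/dy` this is `dm/dy + m² ≥ 1` multiplied by `dy/dZ`. Equivalently, `exp M`
as a function of `y` has second derivative at least itself. -/
theorem kato_riccati {τ Z : ℝ} (hτ : -1 ≤ τ) (hτ' : τ ≤ 1) (h0 : 0 ≤ Z) (h3 : Z < 3) :
    katoYDeriv τ Z ≤ 9 * (1 - τ ^ 2) / (3 + τ * Z) ^ 2 + katoYDeriv τ Z * katoSlope τ Z ^ 2 := by
  have h2 : 0 < 3 + τ * Z := by nlinarith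
  have h1 : 0 < 9 - Z ^ 2 := by nlinarith
  have hp := kato_poly (T := τ * Z / 3) (z := Z / 3) (by linarith) (by linarith) (by nlinarith)
    (by nlinarith)
  have key : 9 * (1 - τ ^ 2) / (3 + τ * Z) ^ 2 + katoYDeriv τ Z * katoSlope τ Z ^ 2
      - katoYDeriv τ Z = 6561 * (1 - τ ^ 2) / ((3 + τ * Z) ^ 2 * (9 - Z ^ 2) ^ 3) *
        ((1 - (Z / 3) ^ 2) ^ 3 - (1 + τ * Z / 3) * (1 + 3 * (τ * Z / 3) + 3 * (Z / 3) ^ 2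
          + (τ * Z / 3) * (Z / 3) ^ 2) * ((1 - 2 * (τ * Z / 3)) ^ 2 - 9 * (Z / 3) ^ 2)) := by
    unfold katoYDeriv katoSlope
    field_simp
    ring
  have h4 : 0 ≤ 1 - τ ^ 2 := by nlinarith
  have h5 : 0 ≤ 6561 * (1 - τ ^ 2) / ((3 + τ * Z) ^ 2 * (9 - Z ^ 2) ^ 3) := by positivity
  have := mul_nonneg h5 (sub_nonneg.2 hp)
  linarith

/-- In the variable `y`, the left side solves `f'' = f` and `exp M` satisfies `f'' ≥ f`, with the
same value 1 and slope `τ` at 0. So the difference `D` has `D'' ≥ D`. Factoring `D'' - D` into two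
first-order operators, `(D + D') e^{-y}` increases from 0, hence `D + D' ≥ 0`, and then `D e^y`
increases from 0. Here `D0` is `D` and `D1` is `D'`. -/
theorem kato_on_curve {τ Z : ℝ} (hτ : -1 ≤ τ) (hτ' : τ ≤ 1) (h0 : 0 ≤ Z) (h3 : Z < 3) :
    Real.cosh (katoY τ Z) + τ * Real.sinh (katoY τ Z) ≤ Real.exp (katoM τ Z) := by
  have hpos : ∀ X ∈ Set.Ico (0 : ℝ) 3, 0 < 9 - X ^ 2 ∧ 0 < 3 + τ * X := fun X hX =>
    ⟨by nlinarith [hX.1, hX.2], by nlinarith [hX.1, hX.2]⟩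
  let D0 : ℝ → ℝ := fun X => Real.exp (katoM τ X) - Real.cosh (katoY τ X) - τ * Real.sinh (katoY τ X)
  let D1 : ℝ → ℝ := fun X => katoSlope τ X * Real.exp (katoM τ X) - Real.sinh (katoY τ X)
    - τ * Real.cosh (katoY τ X)
  have hD0 : ∀ X ∈ Set.Ico (0 : ℝ) 3, HasDerivAt D0 (katoYDeriv τ X * D1 X) X := fun X hX => by
    obtain ⟨h1, h2⟩ := hpos X hX
    refine (((hasDerivAt_katoM h1 h2).exp.sub (hasDerivAt_katoY (τ := τ) h1).cosh).sub
      ((hasDerivAt_katoY (τ := τ) h1).sinh.const_mul τ)).congr_deriv ?_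
    simp only [D1]
    ring
  have hD1 : ∀ X ∈ Set.Ico (0 : ℝ) 3, HasDerivAt D1 ((9 * (1 - τ ^ 2) / (3 + τ * X) ^ 2
      + katoYDeriv τ X * katoSlope τ X ^ 2) * Real.exp (katoM τ X)
      - katoYDeriv τ X * (Real.cosh (katoY τ X) + τ * Real.sinh (katoY τ X))) X := fun X hX => by
    obtain ⟨h1, h2⟩ := hpos X hX
    refine ((((hasDerivAt_katoSlope h2).mul (hasDerivAt_katoM h1 h2).exp).sub
      (hasDerivAt_katoY (τ := τ) h1).sinh).sub
      ((hasDerivAt_katoY (τ := τ) h1).cosh.const_mul τ)).congr_deriv ?_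
    ring
  have hM0 : katoM τ 0 = 0 := by norm_num [katoM]
  have hY0 : katoY τ 0 = 0 := by simp [katoY]
  have hS : MonotoneOn (fun X => (D0 X + D1 X) * Real.exp (-katoY τ X)) (Set.Ico 0 3) := by
    have hder : ∀ X ∈ Set.Ico (0 : ℝ) 3, HasDerivAt (fun X => (D0 X + D1 X) * Real.exp (-katoY τ X))
        (((9 * (1 - τ ^ 2) / (3 + τ * X) ^ 2 + katoYDeriv τ X * katoSlope τ X ^ 2
          - katoYDeriv τ X) * Real.exp (katoM τ X)) * Real.exp (-katoY τ X)) X := fun X hX => by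
      refine (((hD0 X hX).add (hD1 X hX)).mul
        (hasDerivAt_katoY (τ := τ) (hpos X hX).1).neg.exp).congr_deriv ?_
      simp only [D0, D1, Pi.add_apply, Pi.neg_apply]
      ring
    refine monotoneOn_of_deriv_nonneg (convex_Ico 0 3)
      (fun X hX => (hder X hX).continuousAt.continuousWithinAt)
      (fun X hX => (hder X (interior_subset hX)).differentiableAt.differentiableWithinAt)
      fun X hX => ?_
    have hX' := interior_subset hX
    rw [(hder X hX').deriv]
    have := sub_nonneg.2 (kato_riccati hτ hτ' hX'.1 hX'.2)
    positivity
  have hSnn : ∀ X ∈ Set.Ico (0 : ℝ) 3, 0 ≤ D0 X + D1 X := fun X hX => by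
    have h := hS (Set.left_mem_Ico.2 (by norm_num)) hX hX.1
    have e0 : D0 0 + D1 0 = 0 := by simp [D0, D1, hM0, hY0, katoSlope]
    simp only [e0, zero_mul] at h
    exact nonneg_of_mul_nonneg_left h (Real.exp_pos _)
  have hD : MonotoneOn (fun X => D0 X * Real.exp (katoY τ X)) (Set.Ico 0 3) := by
    have hder : ∀ X ∈ Set.Ico (0 : ℝ) 3, HasDerivAt (fun X => D0 X * Real.exp (katoY τ X))
        (katoYDeriv τ X * (D0 X + D1 X) * Real.exp (katoY τ X)) X := fun X hX => by
      refine ((hD0 X hX).mul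
        (hasDerivAt_katoY (τ := τ) (hpos X hX).1).exp).congr_deriv ?_
      ring
    refine monotoneOn_of_deriv_nonneg (convex_Ico 0 3)
      (fun X hX => (hder X hX).continuousAt.continuousWithinAt)
      (fun X hX => (hder X (interior_subset hX)).differentiableAt.differentiableWithinAt)
      fun X hX => ?_
    have hX' := interior_subset hX
    rw [(hder X hX').deriv]
    have h1 := katoYDeriv_nonneg hτ hX'.1 hX'.2
    have h2 := hSnn X hX'
    positivity
  have h := hD (Set.left_mem_Ico.2 (by norm_num)) ⟨h0, h3⟩ h0
  have e0 : D0 0 = 0 := by simp [D0, hM0, hY0]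
  simp only [e0, zero_mul] at h
  have := nonneg_of_mul_nonneg_left h (Real.exp_pos _)
  simp only [D0] at this
  linarith

/-- The curve covers all `y ≥ 0` because `katoY` blows up at `Z = 3`. At `τ = -1` this fails, since
there `katoY` is `9 Z / (3 + Z)²`, which stays below `3/4`. -/
theorem exists_katoY_eq {τ y : ℝ} (hτ : -1 < τ) (hy : 0 ≤ y) :
    ∃ Z, 0 ≤ Z ∧ Z < 3 ∧ katoY τ Z = y := by
  have hc : ContinuousOn (fun Z : ℝ => 9 * Z * (3 + τ * Z) ^ 2 - y * (9 - Z ^ 2) ^ 2)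
      (Set.Icc 0 3) := by fun_prop
  have h := intermediate_value_Icc (by norm_num : (0 : ℝ) ≤ 3) hc
  have h27 : (0 : ℝ) < 9 * 3 * (3 + τ * 3) ^ 2 := by
    have : 0 < 3 + τ * 3 := by linarith
    positivity
  obtain ⟨Z, ⟨hZ0, hZ3⟩, hZ⟩ := h (a := 0) ⟨by norm_num; exact hy, by norm_num at h27 ⊢; exact h27.le⟩
  have hZ3' : Z < 3 := lt_of_le_of_ne hZ3 fun hh => by
    simp only [hh] at hZ
    norm_num at hZ h27
    linarith
  refine ⟨Z, hZ0, hZ3', ?_⟩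
  have h1 : 0 < 9 - Z ^ 2 := by nlinarith
  simp only at hZ
  unfold katoY
  rw [div_eq_iff (by positivity)]
  linarith

/-- The difference of exponents has the double root `w = c`, with `c = katoW τ Z`. The cofactor is
nonnegative because `3 c ≤ 3 + Z`, which follows from `3 c (3 + τ Z) = (3 - Z)(3 + Z)` and `3 + τ Z
≥ 3 - Z`. -/
theorem katoExponent_min {τ Z w : ℝ} (hτ : -1 ≤ τ) (h0 : 0 ≤ Z) (h3 : Z < 3) (hw : 0 < w) :
    katoExponent τ (katoY τ Z) (katoW τ Z) ≤ katoExponent τ (katoY τ Z) w := by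
  have h2 : 0 < 3 + τ * Z := by nlinarith
  have h1 : 0 < 9 - Z ^ 2 := by nlinarith
  obtain ⟨c, hc⟩ : ∃ c, c = katoW τ Z := ⟨_, rfl⟩
  have hc0 : 0 < c := by rw [hc]; unfold katoW; positivity
  have hceq : 3 * c * (3 + τ * Z) = 9 - Z ^ 2 := by
    rw [hc, katoW, mul_comm 3, mul_assoc, div_mul_cancel₀ _ (by positivity)]
  have hyc : katoY τ Z = Z / c ^ 2 := by
    rw [hc]; unfold katoY katoW; field_simp; ring
  have hc3 : 3 * c ≤ 3 + Z := by
    by_contra! hlt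
    nlinarith [mul_nonneg h0 (by linarith : 0 ≤ 1 + τ)]
  rw [← hc, hyc]
  have key : katoExponent τ (Z / c ^ 2) w - katoExponent τ (Z / c ^ 2) c
      = (w - c) ^ 2 / 2 * ((Z * w - 3 * c) ^ 2 + 2 * c * w * Z * (3 - 3 * c + Z)
        + 6 * c ^ 2 * w * Z * (1 + τ)) / (w ^ 2 * c ^ 4) := by
    unfold katoExponent
    have hT : τ * Z = (9 - Z ^ 2) / (3 * c) - 3 := by field_simp; linarith
    have e : 6 * c ^ 2 * w * Z * (1 + τ) = 6 * c ^ 2 * w * (Z + τ * Z) := by ring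
    rw [e, mul_assoc 3 τ, mul_assoc 2 τ, mul_div_assoc' τ, hT]
    field_simp
    ring
  have hpos : 0 ≤ (w - c) ^ 2 / 2 * ((Z * w - 3 * c) ^ 2 + 2 * c * w * Z * (3 - 3 * c + Z)
        + 6 * c ^ 2 * w * Z * (1 + τ)) / (w ^ 2 * c ^ 4) := by
    have : 0 ≤ 3 - 3 * c + Z := by linarith
    have : 0 ≤ 1 + τ := by linarith
    positivity
  linarith

/-- Kato's bound on the moment-generating function of a `±1`-valued random variable of mean `τ`. -/
theorem cosh_add_sinh_le {τ y w : ℝ} (hτ : -1 ≤ τ) (hτ' : τ ≤ 1) (hy : 0 ≤ y) (hw : 0 < w) :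
    Real.cosh y + τ * Real.sinh y ≤ Real.exp (katoExponent τ y w) := by
  rcases hτ.eq_or_lt with rfl | hlt
  -- The degenerate mean, which the curve does not cover: the variable is constant, and the exponent
  -- exceeds `-y` by half a square.
  · rw [show Real.cosh y + -1 * Real.sinh y = Real.exp (-y) by rw [← Real.cosh_sub_sinh]; ring]
    apply Real.exp_le_exp.2
    have : katoExponent (-1) y w + y = (y * w + 3 / w - 3) ^ 2 / 2 := by
      unfold katoExponent
      field_simp
      ring
    nlinarith [sq_nonneg (y * w + 3 / w - 3)]
  · obtain ⟨Z, h0, h3, rfl⟩ := exists_katoY_eq hlt hy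
    refine (kato_on_curve hτ hτ' h0 h3).trans (Real.exp_le_exp.2 ?_)
    rw [← katoM_eq (by nlinarith)]
    exact katoExponent_min hτ h0 h3 hw

end Kato

/-! ### Sequential laws on finite outcome sets -/

section Sequential

variable {Ω : Type*} [Fintype Ω]

/-- The average of `f` under a finite, not necessarily normalised, mass function. -/
def avg (m f : Ω → ℝ) : ℝ := (∑ ω, m ω * f ω) / ∑ ω, m ω

theorem avg_mul_sum {m : Ω → ℝ} (f : Ω → ℝ) (hm : ∀ ω, 0 ≤ m ω) :
    avg m f * ∑ ω, m ω = ∑ ω, m ω * f ω := by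
  unfold avg
  by_cases h : ∑ ω, m ω = 0
  · have h0 := (Finset.sum_eq_zero_iff_of_nonneg fun ω _ => hm ω).1 h
    rw [h, mul_zero]
    exact (Finset.sum_eq_zero fun ω hω => by rw [h0 ω hω, zero_mul]).symm
  · rw [div_mul_cancel₀ _ h]

theorem avg_nonneg {m f : Ω → ℝ} (hm : ∀ ω, 0 ≤ m ω) (hf : ∀ ω, 0 ≤ f ω) : 0 ≤ avg m f :=
  div_nonneg (Finset.sum_nonneg fun ω _ => mul_nonneg (hm ω) (hf ω))
    (Finset.sum_nonneg fun ω _ => hm ω)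

theorem avg_le_one {m f : Ω → ℝ} (hm : ∀ ω, 0 ≤ m ω) (hf : ∀ ω, f ω ≤ 1) : avg m f ≤ 1 :=
  div_le_one_of_le₀ (Finset.sum_le_sum fun ω _ => mul_le_of_le_one_right (hm ω) (hf ω))
    (Finset.sum_nonneg fun ω _ => hm ω)

/-- One step of Kato's inequality: for `α = 0` this is Hoeffding's lemma. -/
theorem sum_mul_exp_le {m f : Ω → ℝ} (hm : ∀ ω, 0 ≤ m ω) (hf0 : ∀ ω, 0 ≤ f ω) (hf1 : ∀ ω, f ω ≤ 1)
    {s α : ℝ} (hs : 0 ≤ s) (hα : -1 < α) :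
    ∑ ω, m ω * Real.exp (s * (avg m f - (1 + α) * f ω + α / 2)) ≤
      (∑ ω, m ω) * Real.exp ((1 + 2 * α / 3) ^ 2 * s ^ 2 / 8 + α ^ 2 / (2 * (1 + 2 * α / 3) ^ 2)) := by
  obtain ⟨r, rfl⟩ : ∃ r, α = r - 1 := ⟨α + 1, by ring⟩
  have hr : 0 < r := by linarith
  obtain ⟨E, hE⟩ : ∃ E, E = avg m f := ⟨_, rfl⟩
  have hE0 : 0 ≤ E := hE ▸ avg_nonneg hm hf0
  have hE1 : E ≤ 1 := hE ▸ avg_le_one hm hf1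
  obtain ⟨y, hy⟩ : ∃ y, y = s * r / 2 := ⟨_, rfl⟩
  have hy0 : 0 ≤ y := by rw [hy]; positivity
  -- By convexity of `exp`, `f` may be replaced by a variable with values 0 and 1 of the same mean
  -- `E`; in terms of `±1` its mean is `1 - 2 * E`.
  have hconv : ∀ ω, Real.exp (s * (E - r * f ω + (r - 1) / 2)) ≤
      Real.exp (s * (E + (r - 1) / 2)) * ((1 - f ω) + f ω * Real.exp (-(2 * y))) := fun ω => by
    have h := convexOn_exp.2 (Set.mem_univ 0) (Set.mem_univ (-(2 * y)))
      (sub_nonneg.2 (hf1 ω)) (hf0 ω) (by ring)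
    simp only [smul_eq_mul, mul_zero, zero_add, Real.exp_zero, mul_one] at h
    rw [show s * (E - r * f ω + (r - 1) / 2) = s * (E + (r - 1) / 2) + f ω * -(2 * y) by
      rw [hy]; ring, Real.exp_add]
    gcongr
  have hk := cosh_add_sinh_le (τ := 1 - 2 * E) (y := y) (w := (2 + 1 / r) / 3)
    (by linarith) (by linarith) hy0 (by positivity)
  have hcs : (1 - E) + E * Real.exp (-(2 * y))
      = Real.exp (-y) * (Real.cosh y + (1 - 2 * E) * Real.sinh y) := by
    rw [Real.cosh_eq, Real.sinh_eq, show -(2 * y) = -y + -y by ring, Real.exp_add]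
    have : Real.exp (-y) * Real.exp y = 1 := by rw [← Real.exp_add]; simp
    linear_combination (-(1 - E)) * this
  have hsum : ∑ ω, m ω * ((1 - f ω) + f ω * Real.exp (-(2 * y)))
      = (∑ ω, m ω) * ((1 - E) + E * Real.exp (-(2 * y))) := by
    have h := avg_mul_sum f hm
    rw [← hE] at h
    have : ∑ ω, m ω * ((1 - f ω) + f ω * Real.exp (-(2 * y)))
        = ∑ ω, m ω - ∑ ω, m ω * f ω + (∑ ω, m ω * f ω) * Real.exp (-(2 * y)) := by
      rw [Finset.sum_mul, ← Finset.sum_sub_distrib, ← Finset.sum_add_distrib]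
      exact Finset.sum_congr rfl fun ω _ => by ring
    rw [this, ← h]
    ring
  have hM : 0 ≤ ∑ ω, m ω := Finset.sum_nonneg fun ω _ => hm ω
  rw [← hE, show (1 + (r - 1) : ℝ) = r by ring]
  calc ∑ ω, m ω * Real.exp (s * (E - r * f ω + (r - 1) / 2))
      ≤ ∑ ω, m ω * (Real.exp (s * (E + (r - 1) / 2)) *
          ((1 - f ω) + f ω * Real.exp (-(2 * y)))) :=
        Finset.sum_le_sum fun ω _ => mul_le_mul_of_nonneg_left (hconv ω) (hm ω)
    _ = (∑ ω, m ω) * (Real.exp (s * (E + (r - 1) / 2)) *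
          (Real.exp (-y) * (Real.cosh y + (1 - 2 * E) * Real.sinh y))) := by
        rw [← hcs, mul_left_comm, ← hsum, Finset.mul_sum]
        exact Finset.sum_congr rfl fun ω _ => by ring
    _ ≤ (∑ ω, m ω) * (Real.exp (s * (E + (r - 1) / 2)) *
          (Real.exp (-y) * Real.exp (katoExponent (1 - 2 * E) y ((2 + 1 / r) / 3)))) := by
        gcongr
    _ = _ := by
        rw [← Real.exp_add, ← Real.exp_add]
        congr 2
        unfold katoExponent
        rw [hy, show (1 + 2 * (r - 1) / 3 : ℝ) = (1 + 2 * r) / 3 by ring,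
          show (2 + 1 / r) / 3 = (1 + 2 * r) / (3 * r) by field_simp; ring]
        have : (1 + 2 * r : ℝ) ≠ 0 := by positivity
        field_simp
        ring

variable {N : ℕ}

/-- The law of the first outcome. -/
def lawHead (P : (Fin (N + 1) → Ω) → ℝ) (ω : Ω) : ℝ := ∑ o : Fin N → Ω, P (Fin.cons ω o)

/-- The law of the outcomes after the first one, restricted to the first outcome being `ω`. -/
def lawTail (P : (Fin (N + 1) → Ω) → ℝ) (ω : Ω) (o : Fin N → Ω) : ℝ := P (Fin.cons ω o)

/-- The sum over the steps of `g m ω`, where `m` is the law of the step conditional on the outcomes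
of the previous steps, up to normalisation, and `ω` is its outcome. -/
def acc (g : (Ω → ℝ) → Ω → ℝ) : (N : ℕ) → ((Fin N → Ω) → ℝ) → (Fin N → Ω) → ℝ
  | 0, _, _ => 0
  | N + 1, P, o => g (lawHead P) (o 0) + acc g N (lawTail P (o 0)) (Fin.tail o)

/-- All conditional laws of a step satisfy `C`. -/
def AllSteps (C : (Ω → ℝ) → Prop) : (N : ℕ) → ((Fin N → Ω) → ℝ) → Prop
  | 0, P => ∀ o, 0 ≤ P o
  | N + 1, P => C (lawHead P) ∧ ∀ ω, AllSteps C N (lawTail P ω)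

theorem sum_cons (F : (Fin (N + 1) → Ω) → ℝ) :
    ∑ o, F o = ∑ ω, ∑ o : Fin N → Ω, F (Fin.cons ω o) := by
  rw [← Fintype.sum_prod_type' (f := fun ω (o : Fin N → Ω) => F (Fin.cons ω o))]
  exact (Fintype.sum_equiv (Fin.consEquiv fun _ => Ω) _ _ fun _ => rfl).symm

theorem AllSteps.nonneg {C : (Ω → ℝ) → Prop} :
    ∀ {N : ℕ} {P : (Fin N → Ω) → ℝ}, AllSteps C N P → ∀ o, 0 ≤ P o
  | 0, _, h, o => h o
  | N + 1, P, h, o => by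
    have := (h.2 (o 0)).nonneg (Fin.tail o)
    rwa [lawTail, Fin.cons_self_tail] at this

theorem lawHead_pos {C : (Ω → ℝ) → Prop} {P : (Fin (N + 1) → Ω) → ℝ} (h : AllSteps C (N + 1) P)
    {o : Fin (N + 1) → Ω} (ho : P o ≠ 0) : 0 < lawHead P (o 0) := by
  refine Finset.sum_pos' (fun o' _ => h.nonneg _) ⟨Fin.tail o, Finset.mem_univ _, ?_⟩
  rw [Fin.cons_self_tail]
  exact lt_of_le_of_ne (h.nonneg o) (Ne.symm ho)

/-- The comparison is asked only at outcomes of positive mass, since `IsStepLaw.avg_codeWt_le_det`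
can fail at null outcomes. -/
theorem acc_le_acc {C : (Ω → ℝ) → Prop} {g g' : (Ω → ℝ) → Ω → ℝ}
    (hg : ∀ m ω, C m → 0 < m ω → g m ω ≤ g' m ω) :
    ∀ {N : ℕ} {P : (Fin N → Ω) → ℝ}, AllSteps C N P → ∀ o, P o ≠ 0 → acc g N P o ≤ acc g' N P o
  | 0, _, _, _, _ => le_rfl
  | N + 1, P, h, o, ho => add_le_add (hg _ _ h.1 (lawHead_pos h ho))
      (acc_le_acc hg (h.2 (o 0)) (Fin.tail o) (by rwa [lawTail, Fin.cons_self_tail]))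

theorem acc_add (g g' : (Ω → ℝ) → Ω → ℝ) :
    ∀ {N : ℕ} (P : (Fin N → Ω) → ℝ) (o : Fin N → Ω),
      acc (fun m ω => g m ω + g' m ω) N P o = acc g N P o + acc g' N P o
  | 0, _, _ => by simp [acc]
  | N + 1, P, o => by simp only [acc, acc_add g g']; ring

theorem acc_const_mul (c : ℝ) (g : (Ω → ℝ) → Ω → ℝ) :
    ∀ {N : ℕ} (P : (Fin N → Ω) → ℝ) (o : Fin N → Ω),
      acc (fun m ω => c * g m ω) N P o = c * acc g N P o
  | 0, _, _ => by simp [acc]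
  | N + 1, P, o => by simp only [acc, acc_const_mul c g]; ring

theorem acc_outcome (f : Ω → ℝ) :
    ∀ {N : ℕ} (P : (Fin N → Ω) → ℝ) (o : Fin N → Ω), acc (fun _ ω => f ω) N P o = ∑ i, f (o i)
  | 0, _, _ => by simp [acc]
  | N + 1, P, o => by
    simp only [acc, acc_outcome f, Fin.sum_univ_succ]
    rfl

theorem acc_nonneg {C : (Ω → ℝ) → Prop} {g : (Ω → ℝ) → Ω → ℝ} (hg : ∀ m ω, C m → 0 ≤ g m ω) :
    ∀ {N : ℕ} {P : (Fin N → Ω) → ℝ}, AllSteps C N P → ∀ o, 0 ≤ acc g N P o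
  | 0, _, _, _ => le_rfl
  | _ + 1, _, h, o => add_nonneg (hg _ _ h.1) (acc_nonneg hg (h.2 (o 0)) (Fin.tail o))

/-- Cauchy-Schwarz along the path of outcomes, in the form `√(ab) + √(AB) ≤ √((a + A)(b + B))` at
each step. -/
theorem acc_sqrt_le {C : (Ω → ℝ) → Prop} {g g' : (Ω → ℝ) → Ω → ℝ} (hg : ∀ m ω, C m → 0 ≤ g m ω)
    (hg' : ∀ m ω, C m → 0 ≤ g' m ω) :
    ∀ {N : ℕ} {P : (Fin N → Ω) → ℝ}, AllSteps C N P → ∀ o,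
      acc (fun m ω => √(g m ω * g' m ω)) N P o ≤ √(acc g N P o * acc g' N P o)
  | 0, _, _, _ => by simp [acc]
  | N + 1, P, h, o => by
    have ih := acc_sqrt_le hg hg' (h.2 (o 0)) (Fin.tail o)
    have h1 := hg _ (o 0) h.1
    have h2 := hg' _ (o 0) h.1
    have h3 := acc_nonneg hg (h.2 (o 0)) (Fin.tail o)
    have h4 := acc_nonneg hg' (h.2 (o 0)) (Fin.tail o)
    simp only [acc]
    refine (add_le_add_right ih _).trans (Real.le_sqrt_of_sq_le ?_)
    rw [Real.sqrt_mul h1, Real.sqrt_mul h3]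
    generalize acc g N (lawTail P (o 0)) (Fin.tail o) = A at *
    generalize acc g' N (lawTail P (o 0)) (Fin.tail o) = B at *
    generalize g (lawHead P) (o 0) = a at *
    generalize g' (lawHead P) (o 0) = b at *
    have e1 := Real.sq_sqrt h1
    have e2 := Real.sq_sqrt h2
    have e3 := Real.sq_sqrt h3
    have e4 := Real.sq_sqrt h4
    rw [← e1, ← e2, ← e3, ← e4]
    simp only [Real.sqrt_sq (Real.sqrt_nonneg _)]
    nlinarith [sq_nonneg (√a * √B - √A * √b)]

/-- The supermartingale argument: summing out the later steps first costs nothing by induction, and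
the first step is the hypothesis. -/
theorem sum_mul_exp_acc_le {C : (Ω → ℝ) → Prop} {g : (Ω → ℝ) → Ω → ℝ}
    (hg : ∀ m, C m → ∑ ω, m ω * Real.exp (g m ω) ≤ ∑ ω, m ω) :
    ∀ {N : ℕ} {P : (Fin N → Ω) → ℝ}, AllSteps C N P →
      ∑ o, P o * Real.exp (acc g N P o) ≤ ∑ o, P o
  | 0, _, _ => by simp [acc]
  | N + 1, P, h => by
    rw [sum_cons, sum_cons]
    refine le_trans (Finset.sum_le_sum fun ω _ => ?_) (hg (lawHead P) h.1)
    have ih := sum_mul_exp_acc_le hg (h.2 ω)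
    calc ∑ o : Fin N → Ω, P (Fin.cons ω o) * Real.exp (acc g (N + 1) P (Fin.cons ω o))
        = Real.exp (g (lawHead P) ω) *
            ∑ o, lawTail P ω o * Real.exp (acc g N (lawTail P ω) o) := by
          rw [Finset.mul_sum]
          refine Finset.sum_congr rfl fun o _ => ?_
          simp only [acc, Fin.cons_zero, Fin.tail_cons, Real.exp_add, lawTail]
          ring
      _ ≤ Real.exp (g (lawHead P) ω) * ∑ o, lawTail P ω o :=
          mul_le_mul_of_nonneg_left ih (Real.exp_pos _).le
      _ = lawHead P ω * Real.exp (g (lawHead P) ω) := mul_comm _ _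

/-- Chernoff's bound for a predictable sum, where the number of steps that count is fixed. -/
theorem sum_filter_acc_le {C : (Ω → ℝ) → Prop} {P : (Fin N → Ω) → ℝ} (hP : AllSteps C N P)
    {d : Ω → ℝ} {n : ℝ} (hn : ∀ o, P o ≠ 0 → ∑ i, d (o i) = n) {X : (Ω → ℝ) → Ω → ℝ} {s c : ℝ}
    (hs : 0 ≤ s) (hX : ∀ m, C m → ∑ ω, m ω * Real.exp (s * X m ω - c * d ω) ≤ ∑ ω, m ω)
    (v : ℝ) (p : (Fin N → Ω) → Prop) [DecidablePred p]
    (hp : ∀ o, P o ≠ 0 → p o → v ≤ acc X N P o) :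
    ∑ o with p o, P o ≤ Real.exp (c * n - s * v) * ∑ o, P o := by
  -- On the support of `P` the compensators `c * d ω` add up to the constant `c * n`, so Markov's
  -- inequality applies to the accumulated `X` alone.
  have h := sum_mul_exp_acc_le (g := fun m ω => s * X m ω + -c * d ω)
    (fun m hm => by simpa [sub_eq_add_neg] using hX m hm) hP
  have hacc : ∀ o, acc (fun m ω => s * X m ω + -c * d ω) N P o
      = s * acc X N P o + -c * ∑ i, d (o i) := fun o => by
    rw [acc_add, acc_const_mul s X, acc_const_mul (-c) (fun _ ω => d ω), acc_outcome]
  simp only [hacc] at h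
  have hP0 := hP.nonneg
  have hpt : ∀ o, p o → P o ≤ Real.exp (c * n - s * v) *
      (P o * Real.exp (s * acc X N P o + -c * ∑ i, d (o i))) := fun o ho => by
    by_cases h0 : P o = 0
    · simp [h0]
    · rw [mul_left_comm, ← Real.exp_add, hn o h0]
      refine le_mul_of_one_le_right (hP0 o) (Real.one_le_exp ?_)
      have := mul_le_mul_of_nonneg_left (hp o h0 ho) hs
      linarith
  calc ∑ o with p o, P o
      ≤ ∑ o with p o, Real.exp (c * n - s * v) *
          (P o * Real.exp (s * acc X N P o + -c * ∑ i, d (o i))) :=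
        Finset.sum_le_sum fun o ho => hpt o (Finset.mem_filter.1 ho).2
    _ ≤ ∑ o, Real.exp (c * n - s * v) *
          (P o * Real.exp (s * acc X N P o + -c * ∑ i, d (o i))) :=
        Finset.sum_le_sum_of_subset_of_nonneg (Finset.filter_subset _ _) fun o _ _ =>
          mul_nonneg (Real.exp_pos _).le (mul_nonneg (hP0 o) (Real.exp_pos _).le)
    _ ≤ Real.exp (c * n - s * v) * ∑ o, P o := by
        rw [← Finset.mul_sum]
        exact mul_le_mul_of_nonneg_left h (Real.exp_pos _).le

end Sequential

/-! ### The number of phase errors for a fixed set of detected rounds -/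

section Concentration

/-- The indicator of a detected round. -/
def det : Outcome → ℝ
  | .undetected => 0
  | _ => 1

/-- The indicator of a code round of weight `k`. -/
def codeWt (k : Fin 4) : Outcome → ℝ
  | .code _ a => if a = k then 1 else 0
  | _ => 0

/-- The phase errors not accounted for by bit errors and by weight two. -/
def excess (t : ℝ) : Outcome → ℝ
  | .undetected => 0
  | .code ph a => ((if ph then 1 else 0) - (if a = 2 then 1 else 0)) / t
  | .sample bit => -(if bit then lam / (1 - t) else 0)

/-- The laws of the outcome of a single round, up to normalisation, if it is known whether the round
is detected. -/
def IsStepLaw (t : ℝ) (m : Outcome → ℝ) : Prop :=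
  (∀ ω, 0 ≤ m ω) ∧ ((∀ ω, ω ≠ .undetected → m ω = 0) ∨ m .undetected = 0) ∧
    ∑ ω, m ω * excess t ω ≤ lam / t * √((∑ ω, m ω * codeWt 1 ω) * ∑ ω, m ω * codeWt 3 ω)

variable {t : ℝ}

theorem codeWt_nonneg (k : Fin 4) (ω : Outcome) : 0 ≤ codeWt k ω := by
  unfold codeWt; split <;> [split_ifs <;> norm_num; norm_num]

theorem codeWt_le_one (k : Fin 4) (ω : Outcome) : codeWt k ω ≤ 1 := by
  unfold codeWt; split <;> [split_ifs <;> norm_num; norm_num]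

theorem lam_pos : 0 < lam := by unfold lam; positivity

theorem det_of_ne {ω : Outcome} (h : ω ≠ .undetected) : det ω = 1 := by
  cases ω <;> simp_all [det]

/-- If the round is undetected, the exponent vanishes on the support; otherwise `det` is 1 there and
`sum_mul_exp_le` applies. Thus only detected rounds are charged with the compensator. -/
theorem IsStepLaw.kato {m : Outcome → ℝ} (h : IsStepLaw t m) {f : Outcome → ℝ} (hf0 : ∀ ω, 0 ≤ f ω)
    (hf1 : ∀ ω, f ω ≤ 1) (hfu : f .undetected = 0) {s α : ℝ} (hs : 0 ≤ s) (hα : -1 < α) :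
    ∑ ω, m ω * Real.exp (s * (avg m f - (1 + α) * f ω + α / 2 * det ω)
      - ((1 + 2 * α / 3) ^ 2 * s ^ 2 / 8 + α ^ 2 / (2 * (1 + 2 * α / 3) ^ 2)) * det ω) ≤ ∑ ω, m ω := by
  rcases h.2.1 with h0 | h0
  · refine le_of_eq (Finset.sum_congr rfl fun ω _ => ?_)
    by_cases hω : ω = .undetected
    · subst hω
      have : avg m f = 0 := by
        unfold avg
        rw [Finset.sum_eq_zero, zero_div]
        intro ω _
        by_cases hω : ω = .undetected
        · rw [hω, hfu, mul_zero]
        · rw [h0 ω hω, zero_mul]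
      simp [this, hfu, det]
    · rw [h0 ω hω, zero_mul]
  · have hk := sum_mul_exp_le h.1 hf0 hf1 hs hα
    have e : ∀ ω, m ω * Real.exp (s * (avg m f - (1 + α) * f ω + α / 2 * det ω)
        - ((1 + 2 * α / 3) ^ 2 * s ^ 2 / 8 + α ^ 2 / (2 * (1 + 2 * α / 3) ^ 2)) * det ω)
        = m ω * Real.exp (s * (avg m f - (1 + α) * f ω + α / 2)) *
          Real.exp (-((1 + 2 * α / 3) ^ 2 * s ^ 2 / 8 + α ^ 2 / (2 * (1 + 2 * α / 3) ^ 2))) :=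
      fun ω => by
        by_cases hω : ω = .undetected
        · rw [hω, h0]; ring
        · rw [det_of_ne hω, mul_assoc, ← Real.exp_add]
          ring_nf
    simp only [e]
    rw [← Finset.sum_mul]
    refine (mul_le_mul_of_nonneg_right hk (Real.exp_pos _).le).trans (le_of_eq ?_)
    rw [mul_assoc, ← Real.exp_add, add_neg_cancel, Real.exp_zero, mul_one]

/-- The case `α = 0` of Kato's step for the rescaled variable `(c - f) / R`, which lies in `[0, 1]`;
the reflection turns the lower tail into the upper one. -/
theorem IsStepLaw.azuma {m : Outcome → ℝ} (h : IsStepLaw t m) {f : Outcome → ℝ} {c R : ℝ}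
    (hR : 0 < R) (hf0 : ∀ ω, c - R ≤ f ω) (hf1 : ∀ ω, f ω ≤ c) (hfu : f .undetected = 0) {s : ℝ}
    (hs : 0 ≤ s) :
    ∑ ω, m ω * Real.exp (s * (f ω - avg m f) - s ^ 2 * R ^ 2 / 8 * det ω) ≤ ∑ ω, m ω := by
  rcases h.2.1 with h0 | h0
  · refine le_of_eq (Finset.sum_congr rfl fun ω _ => ?_)
    by_cases hω : ω = .undetected
    · subst hω
      have : avg m f = 0 := by
        unfold avg
        rw [Finset.sum_eq_zero, zero_div]
        intro ω _
        by_cases hω : ω = .undetected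
        · rw [hω, hfu, mul_zero]
        · rw [h0 ω hω, zero_mul]
      simp [this, hfu, det]
    · rw [h0 ω hω, zero_mul]
  · by_cases hM : ∑ ω, m ω = 0
    · have h0 := (Finset.sum_eq_zero_iff_of_nonneg fun ω _ => h.1 ω).1 hM
      rw [hM]
      exact (Finset.sum_eq_zero fun ω hω => by rw [h0 ω hω, zero_mul]).le
    have hk := sum_mul_exp_le (f := fun ω => (c - f ω) / R) (s := s * R) (α := 0) h.1
      (fun ω => div_nonneg (by linarith [hf1 ω]) hR.le)
      (fun ω => (div_le_one hR).2 (by linarith [hf0 ω])) (by positivity) (by norm_num)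
    have ha : avg m (fun ω => (c - f ω) / R) = (c - avg m f) / R := by
      unfold avg
      rw [show ∑ ω, m ω * ((c - f ω) / R) = (c * ∑ ω, m ω - ∑ ω, m ω * f ω) / R by
        rw [Finset.mul_sum, ← Finset.sum_sub_distrib, Finset.sum_div]
        exact Finset.sum_congr rfl fun ω _ => by ring]
      field_simp
    have e : ∀ ω, m ω * Real.exp (s * (f ω - avg m f) - s ^ 2 * R ^ 2 / 8 * det ω)
        = m ω * Real.exp (s * R * (avg m (fun ω => (c - f ω) / R) - (1 + 0) * ((c - f ω) / R) + 0 / 2))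
          * Real.exp (-(s ^ 2 * R ^ 2 / 8)) :=
      fun ω => by
        by_cases hω : ω = .undetected
        · rw [hω, h0]; ring
        · rw [det_of_ne hω, mul_assoc, ← Real.exp_add, ha]
          congr 2
          field_simp
          ring
    simp only [e]
    rw [← Finset.sum_mul]
    refine (mul_le_mul_of_nonneg_right hk (Real.exp_pos _).le).trans (le_of_eq ?_)
    rw [mul_assoc, ← Real.exp_add]
    norm_num
    rw [mul_pow, add_neg_cancel, Real.exp_zero, mul_one]

theorem IsStepLaw.avg_excess_le {m : Outcome → ℝ} (h : IsStepLaw t m) :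
    avg m (excess t) ≤ lam / t * √(avg m (codeWt 1) * avg m (codeWt 3)) := by
  have hM : 0 ≤ ∑ ω, m ω := Finset.sum_nonneg fun ω _ => h.1 ω
  refine (div_le_div_of_nonneg_right h.2.2 hM).trans (le_of_eq ?_)
  unfold avg
  rw [div_mul_div_comm, Real.sqrt_div', Real.sqrt_mul_self hM, mul_div_assoc]
  positivity

theorem IsStepLaw.avg_codeWt_le_det {m : Outcome → ℝ} (h : IsStepLaw t m) (k : Fin 4) {ω : Outcome}
    (hω : 0 < m ω) : avg m (codeWt k) ≤ det ω := by
  by_cases hu : ω = .undetected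
  · rcases h.2.1 with h0 | h0
    · refine le_of_eq ?_
      rw [hu]
      unfold avg
      rw [Finset.sum_eq_zero, zero_div]
      · rfl
      intro ω _
      by_cases hω : ω = .undetected
      · rw [hω]; simp [codeWt]
      · rw [h0 ω hω, zero_mul]
    · rw [hu, h0] at hω
      exact absurd hω (lt_irrefl _)
  · rw [det_of_ne hu]
    exact avg_le_one h.1 (codeWt_le_one k)

variable {N : ℕ}

/-- The number of code rounds of weight `k`. -/
def Nwt (k : Fin 4) (o : Fin N → Outcome) : ℝ := ∑ i, codeWt k (o i)

theorem Nwt_nonneg (k : Fin 4) (o : Fin N → Outcome) : 0 ≤ Nwt k o :=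
  Finset.sum_nonneg fun i _ => codeWt_nonneg k (o i)

theorem sum_det (o : Fin N → Outcome) : ∑ i, det (o i) = Ndet o := by
  unfold Ndet
  rw [Finset.natCast_card_filter]
  refine Finset.sum_congr rfl fun i _ => ?_
  by_cases h : o i = .undetected
  · simp [h, det]
  · simp [h, det_of_ne h]

theorem sum_excess (t : ℝ) (o : Fin N → Outcome) :
    ∑ i, excess t (o i) = Nph o / t - lam / (1 - t) * Nbit o - Nwt 2 o / t := by
  unfold Nph Nbit Nwt
  rw [Finset.natCast_card_filter, Finset.natCast_card_filter, Finset.sum_div, Finset.mul_sum,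
    Finset.sum_div, ← Finset.sum_sub_distrib, ← Finset.sum_sub_distrib]
  refine Finset.sum_congr rfl fun i _ => ?_
  rcases o i with _ | ⟨ph, a⟩ | b
  · simp [excess, codeWt]
  · cases ph <;> simp [excess, codeWt] <;> ring
  · cases b <;> simp [excess, codeWt]

variable {P : (Fin N → Outcome) → ℝ} {n : ℕ} {ε : ℝ}

-- The chosen `s = 4v / (R² n)` minimises `s² R² n / 8 - s v`, with minimum `-2v² / (R² n)`.
open Classical in
theorem azuma_tail (hP : AllSteps (IsStepLaw t) N P) (hn : ∀ o, P o ≠ 0 → Ndet o = n) (hn1 : 1 ≤ n)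
    (hε : 0 < ε) {f : Outcome → ℝ} {c R : ℝ} (hR : 0 < R) (hf0 : ∀ ω, c - R ≤ f ω)
    (hf1 : ∀ ω, f ω ≤ c) (hfu : f .undetected = 0) {v : ℝ} (hv : 0 ≤ v)
    (hv2 : R ^ 2 * n * Real.log (1 / ε) ≤ 2 * v ^ 2) :
    ∑ o with v ≤ ∑ i, f (o i) - acc (fun m _ => avg m f) N P o, P o ≤ ε * ∑ o, P o := by
  have hn0 : (0 : ℝ) < n := by exact_mod_cast hn1
  have hsum : 0 ≤ ∑ o, P o := Finset.sum_nonneg fun o _ => hP.nonneg o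
  have h := sum_filter_acc_le (n := n) hP (d := det) (fun o ho => by rw [sum_det, hn o ho])
    (X := fun m ω => f ω - avg m f) (s := 4 * v / (R ^ 2 * n))
    (c := (4 * v / (R ^ 2 * n)) ^ 2 * R ^ 2 / 8) (by positivity)
    (fun m hm => hm.azuma hR hf0 hf1 hfu (by positivity)) v
    (fun o => v ≤ ∑ i, f (o i) - acc (fun m _ => avg m f) N P o) (fun o _ ho => by
      have : acc (fun m ω => f ω - avg m f) N P o
          = ∑ i, f (o i) - acc (fun m _ => avg m f) N P o := by
        have := acc_add (fun m ω => f ω - avg m f) (fun m _ => avg m f) P o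
        simp only [sub_add_cancel, acc_outcome] at this
        rw [this]; ring
      rwa [this])
  refine h.trans (mul_le_mul_of_nonneg_right ?_ hsum)
  rw [← Real.log_le_log_iff (Real.exp_pos _) hε, Real.log_exp]
  rw [one_div, Real.log_inv] at hv2
  have : (4 * v / (R ^ 2 * n)) ^ 2 * R ^ 2 / 8 * n - 4 * v / (R ^ 2 * n) * v
      = -(2 * v ^ 2 / (R ^ 2 * n)) := by
    field_simp; ring
  rw [this, neg_le, le_div_iff₀ (by positivity)]
  linarith

-- Kato's step with `α = 2a / √n` and deviation `b √n`. With `γ = 1 + 4a / (3√n)` the optimal `s`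
-- gives the exponent `2 (a² - b²) / γ²`, which `hab` makes equal to `log ε`. The strict bound on
-- `a` is the condition `α > -1`.
open Classical in
theorem kato_tail (hP : AllSteps (IsStepLaw t) N P) (hn : ∀ o, P o ≠ 0 → Ndet o = n) (hn1 : 1 ≤ n)
    (hε : 0 < ε) (k : Fin 4) {a b : ℝ} (ha : -(√n / 2) < a) (hb : 0 ≤ b)
    (hab : b ^ 2 = a ^ 2 - Real.log ε / 2 * (1 + 4 * a / (3 * √n)) ^ 2) :
    ∑ o with Nwt k o * (1 + 2 * a / √n) + (b - a) * √n ≤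
      acc (fun m _ => avg m (codeWt k)) N P o, P o ≤ ε * ∑ o, P o := by
  have hn0 : (0 : ℝ) < n := by exact_mod_cast hn1
  obtain ⟨r, hr⟩ : ∃ r, r = √(n : ℝ) := ⟨_, rfl⟩
  have hr0 : 0 < r := hr ▸ Real.sqrt_pos.2 hn0
  have hrn : (n : ℝ) = r ^ 2 := by rw [hr, Real.sq_sqrt hn0.le]
  rw [← hr] at ha hab ⊢
  have hα : -1 < 2 * a / r := by rw [lt_div_iff₀ hr0]; linarith
  have hγ : 0 < 1 + 2 * (2 * a / r) / 3 := by linarith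
  have hsum : 0 ≤ ∑ o, P o := Finset.sum_nonneg fun o _ => hP.nonneg o
  have h := sum_filter_acc_le (n := n) hP (d := det) (fun o ho => by rw [sum_det, hn o ho])
    (X := fun m ω => avg m (codeWt k) - (1 + 2 * a / r) * codeWt k ω + 2 * a / r / 2 * det ω)
    (s := 4 * (b / r) / (1 + 2 * (2 * a / r) / 3) ^ 2)
    (c := (1 + 2 * (2 * a / r) / 3) ^ 2 * (4 * (b / r) / (1 + 2 * (2 * a / r) / 3) ^ 2) ^ 2 / 8
      + (2 * a / r) ^ 2 / (2 * (1 + 2 * (2 * a / r) / 3) ^ 2)) (by positivity)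
    (fun m hm => hm.kato (codeWt_nonneg k) (codeWt_le_one k) rfl (by positivity) hα) (b * r)
    (fun o => Nwt k o * (1 + 2 * a / r) + (b - a) * r ≤
      acc (fun m _ => avg m (codeWt k)) N P o) (fun o ho hle => by
      have e : acc (fun m ω => avg m (codeWt k) - (1 + 2 * a / r) * codeWt k ω
          + 2 * a / r / 2 * det ω) N P o = acc (fun m _ => avg m (codeWt k)) N P o
            - (1 + 2 * a / r) * Nwt k o + a * r := by
        have h1 := acc_add (fun m _ => avg m (codeWt k))
          (fun _ ω => -(1 + 2 * a / r) * codeWt k ω + 2 * a / r / 2 * det ω) P o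
        rw [acc_outcome (fun ω => -(1 + 2 * a / r) * codeWt k ω + 2 * a / r / 2 * det ω),
          Finset.sum_add_distrib, ← Finset.mul_sum, ← Finset.mul_sum, sum_det, hn o ho, hrn] at h1
        have h2 : (fun (m : Outcome → ℝ) ω => avg m (codeWt k) - (1 + 2 * a / r) * codeWt k ω
          + 2 * a / r / 2 * det ω) = fun m ω => avg m (codeWt k) +
            (-(1 + 2 * a / r) * codeWt k ω + 2 * a / r / 2 * det ω) := by
          funext m ω; ring
        rw [h2, h1]
        unfold Nwt
        field_simp
        ring
      rw [e]
      linarith)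
  refine h.trans (mul_le_mul_of_nonneg_right ?_ hsum)
  rw [← Real.log_le_log_iff (Real.exp_pos _) hε, Real.log_exp]
  have e : 1 + 4 * a / (3 * r) = 1 + 2 * (2 * a / r) / 3 := by field_simp; ring
  rw [e] at hab
  generalize hg : 1 + 2 * (2 * a / r) / 3 = γ at *
  rw [hrn]
  have : (γ ^ 2 * (4 * (b / r) / γ ^ 2) ^ 2 / 8 + (2 * a / r) ^ 2 / (2 * γ ^ 2)) * r ^ 2
      - 4 * (b / r) / γ ^ 2 * (b * r) = 2 * (a ^ 2 - b ^ 2) / γ ^ 2 := by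
    field_simp
    ring
  rw [this, hab]
  apply le_of_eq
  field_simp
  ring

/-- The bound on the number of phase errors in terms of the numbers of code rounds of each weight. -/
def PhaseBound (t n ε a b : ℝ) (o : Fin N → Outcome) : Prop :=
  Nph o ≤ lam * t * Nbit o / (1 - t) + Nwt 2 o
    + lam * √((Nwt 1 o + Delta n 1 ε) * (Nwt 3 o * (1 + 2 * a / √n) + (b - a) * √n))
    + t * Delta n (Dmax t ^ 2) ε

/-- The deterministic part: on a path where the three deviations are small, the one-round
inequalities are summed, Cauchy-Schwarz is applied, and the result is multiplied by `t`, since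
`excess` counts phase errors with weight `1 / t`. -/
theorem phaseBound_of_lt (ht0 : 0 < t) (hP : AllSteps (IsStepLaw t) N P) {o : Fin N → Outcome}
    (ho : P o ≠ 0) {a b : ℝ}
    (h1 : ∑ i, excess t (o i) - acc (fun m _ => avg m (excess t)) N P o
      ≤ Delta n (Dmax t ^ 2) ε)
    (h2 : acc (fun m _ => avg m (codeWt 1)) N P o ≤ Nwt 1 o + Delta n 1 ε)
    (h3 : acc (fun m _ => avg m (codeWt 3)) N P o ≤
      Nwt 3 o * (1 + 2 * a / √n) + (b - a) * √n) :
    PhaseBound t n ε a b o := by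
  have hav : ∀ k (m : Outcome → ℝ) (_ : Outcome), IsStepLaw t m → 0 ≤ avg m (codeWt k) :=
    fun k m _ hm => avg_nonneg hm.1 (codeWt_nonneg k)
  have hE : acc (fun m _ => avg m (excess t)) N P o ≤ lam / t *
      √((Nwt 1 o + Delta n 1 ε) * (Nwt 3 o * (1 + 2 * a / √n) + (b - a) * √n)) := by
    calc acc (fun m _ => avg m (excess t)) N P o
        ≤ acc (fun m _ => lam / t * √(avg m (codeWt 1) * avg m (codeWt 3))) N P o :=
          acc_le_acc (fun m _ hm _ => hm.avg_excess_le) hP o ho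
      _ = lam / t * acc (fun m _ => √(avg m (codeWt 1) * avg m (codeWt 3))) N P o :=
          acc_const_mul (lam / t) (fun m _ => √(avg m (codeWt 1) * avg m (codeWt 3))) P o
      _ ≤ lam / t * √(acc (fun m _ => avg m (codeWt 1)) N P o
            * acc (fun m _ => avg m (codeWt 3)) N P o) :=
          mul_le_mul_of_nonneg_left (acc_sqrt_le (hav 1) (hav 3) hP o)
            (div_nonneg lam_pos.le ht0.le)
      _ ≤ _ := by
          have := lam_pos
          have h5 := acc_nonneg (hav 1) hP o
          have h6 := acc_nonneg (hav 3) hP o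
          gcongr
          exact h5.trans h2
  have h := sum_excess t o
  unfold PhaseBound
  generalize √((Nwt 1 o + Delta n 1 ε) * (Nwt 3 o * (1 + 2 * a / √n) + (b - a) * √n)) = S at *
  have h4 : ∑ i, excess t (o i) ≤ lam / t * S + Delta n (Dmax t ^ 2) ε := by linarith
  rw [h] at h4
  have h5 := mul_le_mul_of_nonneg_left h4 ht0.le
  have e1 : t * ((Nph o : ℝ) / t - lam / (1 - t) * Nbit o - Nwt 2 o / t)
      = Nph o - lam * t * Nbit o / (1 - t) - Nwt 2 o := by
    field_simp
  have e2 : t * (lam / t * S + Delta n (Dmax t ^ 2) ε) = lam * S + t * Delta n (Dmax t ^ 2) ε := by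
    field_simp
  rw [e1, e2] at h5
  linarith

/-- For Azuma's inequality only the length `2 * Dmax t` of the interval matters. -/
theorem excess_range (ht0 : 0 < t) (ht1 : t < 1) (ω : Outcome) :
    1 / t - 2 * Dmax t ≤ excess t ω ∧ excess t ω ≤ 1 / t := by
  have hl := lam_pos
  have ht1' : 0 < 1 - t := by linarith
  have h1 : lam / (1 - t) + 1 ≤ Dmax t := le_max_left _ _
  have h2 : 1 / t + lam + 1 ≤ Dmax t := le_max_right _ _
  have h3 : 0 < 1 / t := by positivity
  have h4 : 0 < lam / (1 - t) := by positivity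
  rcases ω with _ | ⟨ph, a⟩ | b
  · simp only [excess]; constructor <;> linarith
  · simp only [excess]
    split_ifs <;> simp only [sub_self, sub_zero, zero_sub, zero_div, neg_div] <;>
      constructor <;> linarith
  · simp only [excess]
    split_ifs <;> constructor <;> linarith

open Classical in
theorem sum_not_phaseBound_le (ht0 : 0 < t) (ht1 : t < 1) (hP : AllSteps (IsStepLaw t) N P)
    (hn : ∀ o, P o ≠ 0 → Ndet o = n) (hn1 : 1 ≤ n) (hε : 0 < ε) (hε1 : ε ≤ 1) {a b : ℝ}
    (ha : -(√n / 2) ≤ a) (hb : 0 ≤ b)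
    (hab : b ^ 2 = a ^ 2 - Real.log ε / 2 * (1 + 4 * a / (3 * √n)) ^ 2) :
    ∑ o with ¬ PhaseBound t n ε a b o, P o ≤ 3 * ε * ∑ o, P o := by
  have hn0 : (0 : ℝ) < n := by exact_mod_cast hn1
  have hlog : 0 ≤ Real.log (1 / ε) := Real.log_nonneg (by rw [le_div_iff₀ hε]; linarith)
  have hsum : 0 ≤ ∑ o, P o := Finset.sum_nonneg fun o _ => hP.nonneg o
  have hD : 0 < Dmax t := by
    have h2 : 1 / t + lam + 1 ≤ Dmax t := le_max_right _ _
    have := lam_pos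
    have h3 : 0 < 1 / t := by positivity
    linarith
  have T1 := azuma_tail hP hn hn1 hε (f := excess t) (c := 1 / t) (R := 2 * Dmax t) (by linarith)
    (fun ω => (excess_range ht0 ht1 ω).1) (fun ω => (excess_range ht0 ht1 ω).2) rfl
    (v := Delta n (Dmax t ^ 2) ε) (Real.sqrt_nonneg _) (by
      unfold Delta; rw [Real.sq_sqrt (by positivity)]; apply le_of_eq; ring)
  -- The sign is reversed because the conditional expectations have to be bounded by the count.
  -- Range 1 would already allow half this deviation.
  have T2 := azuma_tail hP hn hn1 hε (f := fun ω => -codeWt 1 ω) (c := 0) (R := 1) one_pos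
    (fun ω => by linarith [codeWt_le_one 1 ω]) (fun ω => by linarith [codeWt_nonneg 1 ω])
    (by simp [codeWt])
    (v := Delta n 1 ε) (Real.sqrt_nonneg _) (by
      unfold Delta; rw [Real.sq_sqrt (by positivity)]; nlinarith [mul_nonneg hn0.le hlog])
  obtain ⟨p3, T3, hp3⟩ : ∃ p3 : (Fin N → Outcome) → Prop, ∑ o with p3 o, P o ≤ ε * ∑ o, P o ∧
      ∀ o, P o ≠ 0 → ¬ p3 o → acc (fun m _ => avg m (codeWt 3)) N P o ≤
        Nwt 3 o * (1 + 2 * a / √n) + (b - a) * √n := by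
    rcases ha.eq_or_lt with ha | ha
    -- The boundary case is `α = -1`, where Kato's inequality is not available. The count then drops
    -- out of the bound, and `(b - a) √n ≥ n` makes the claim hold without exception.
    · refine ⟨fun _ => False, by simpa using mul_nonneg hε.le hsum, fun o ho _ => ?_⟩
      have hs0 : 0 < √(n : ℝ) := Real.sqrt_pos.2 hn0
      have h1 : acc (fun m _ => avg m (codeWt 3)) N P o ≤ n := by
        rw [← hn o ho, ← sum_det, ← acc_outcome det P o]
        exact acc_le_acc (fun m ω hm hω => hm.avg_codeWt_le_det 3 hω) hP o ho
      have hba : √(n : ℝ) / 2 ≤ b := by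
        refine le_of_sq_le_sq ?_ hb
        rw [hab, ← ha]
        have : 0 ≤ -Real.log ε := by rw [← Real.log_inv, ← one_div]; exact hlog
        nlinarith [mul_nonneg this (sq_nonneg (1 + 4 * -(√(n : ℝ) / 2) / (3 * √n)))]
      have h2 : 1 + 2 * a / √(n : ℝ) = 0 := by rw [← ha]; field_simp; ring
      rw [h2, mul_zero, zero_add]
      refine h1.trans ?_
      have : √(n : ℝ) * √n = n := Real.mul_self_sqrt hn0.le
      nlinarith
    · exact ⟨_, kato_tail hP hn hn1 hε 3 ha hb hab, fun o _ h => (not_le.1 h).le⟩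
  set p1 : (Fin N → Outcome) → Prop := fun o => Delta n (Dmax t ^ 2) ε ≤
    ∑ i, excess t (o i) - acc (fun m _ => avg m (excess t)) N P o with hp1
  set p2 : (Fin N → Outcome) → Prop := fun o => Delta n 1 ε ≤
    ∑ i, -codeWt 1 (o i) - acc (fun m _ => avg m fun ω => -codeWt 1 ω) N P o with hp2
  have hneg : ∀ o, acc (fun m _ => avg m fun ω => -codeWt 1 ω) N P o
      = -acc (fun m _ => avg m (codeWt 1)) N P o := fun o => by
    have := acc_const_mul (-1) (fun (m : Outcome → ℝ) _ => avg m (codeWt 1)) P o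
    rw [neg_one_mul] at this
    rw [← this]
    congr 1
    funext m ω
    simp [avg, neg_div]
  calc ∑ o with ¬ PhaseBound t n ε a b o, P o
      ≤ ∑ o, ((if p1 o then P o else 0) + (if p2 o then P o else 0) + (if p3 o then P o else 0)) := by
        rw [Finset.sum_filter]
        refine Finset.sum_le_sum fun o _ => ?_
        have h0 := hP.nonneg o
        by_cases hz : P o = 0
        · simp [hz]
        by_cases c1 : p1 o
        · simp only [c1, if_true]; split_ifs <;> linarith
        by_cases c2 : p2 o
        · simp only [c2, if_true]; split_ifs <;> linarith
        by_cases c3 : p3 o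
        · simp only [c3, if_true]; split_ifs <;> linarith
        have hB : PhaseBound t n ε a b o := by
          refine phaseBound_of_lt ht0 hP hz (not_le.1 c1).le ?_ (hp3 o hz c3)
          have := not_le.1 c2
          rw [hneg, Finset.sum_neg_distrib] at this
          unfold Nwt
          linarith
        simp [hB, c1, c2, c3]
    _ = ∑ o with p1 o, P o + ∑ o with p2 o, P o + ∑ o with p3 o, P o := by
        rw [Finset.sum_add_distrib, Finset.sum_add_distrib, Finset.sum_filter, Finset.sum_filter,
          Finset.sum_filter]
    _ ≤ ε * ∑ o, P o + ε * ∑ o, P o + ε * ∑ o, P o := add_le_add (add_le_add T1 T2) T3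
    _ = _ := by ring

end Concentration

/-! ### The operator inequality between phase errors and bit errors -/

section Operators

open Matrix ComplexConjugate

open scoped ComplexOrder

/-- The system of a detected round: Alice's three qubits and Bob's three-level system. -/
abbrev DetIdx := (Fin 3 → Fin 2) × Fin 3

/-- Diagonal matrices with real entries. -/
def rdiag {X : Type*} [DecidableEq X] (g : X → ℝ) : Matrix X X ℂ := diagonal fun x => (g x : ℂ)

section rdiag

variable {X : Type*} [DecidableEq X]

theorem rdiag_add (g h : X → ℝ) : rdiag g + rdiag h = rdiag (g + h) := by
  simp [rdiag, diagonal_add]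

theorem rdiag_sub (g h : X → ℝ) : rdiag g - rdiag h = rdiag (g - h) := by
  simp [rdiag, diagonal_sub]

theorem rdiag_smul (c : ℝ) (g : X → ℝ) : c • rdiag g = rdiag (c • g) := by
  ext x y
  by_cases h : x = y <;> simp [rdiag, h]

theorem rdiag_one : rdiag (1 : X → ℝ) = 1 := by simp [rdiag]

theorem rdiag_mul [Fintype X] (g h : X → ℝ) : rdiag g * rdiag h = rdiag (g * h) := by
  simp [rdiag]

theorem rdiag_posSemidef {g : X → ℝ} (hg : ∀ x, 0 ≤ g x) : (rdiag g).PosSemidef :=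
  PosSemidef.diagonal fun x => by simpa using hg x

end rdiag

/-- Flips the bits `j` and `j + 1`. -/
def flip (j : Fin 2) (z : Fin 3 → Fin 2) : Fin 3 → Fin 2 :=
  fun u => if u = j.castSucc ∨ u = j.succ then z u + 1 else z u

theorem flip_flip (j : Fin 2) (z : Fin 3 → Fin 2) : flip j (flip j z) = z := by
  funext u
  unfold flip
  split_ifs
  · rw [add_assoc, show (1 + 1 : Fin 2) = 0 from rfl, add_zero]
  · rfl

def flipEquiv (j : Fin 2) : (Fin 3 → Fin 2) ≃ (Fin 3 → Fin 2) :=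
  ⟨flip j, flip j, flip_flip j, flip_flip j⟩

/-- The matrix of the flip of the bits `j` and `j + 1`, that is, of `X_j X_{j+1}`. -/
def flipMat (j : Fin 2) : Matrix (Fin 3 → Fin 2) (Fin 3 → Fin 2) ℂ :=
  of fun z z' => if z' = flip j z then 1 else 0

/-- The matrix of the transition between the basis states `j` and `j + 1` of Bob's system. -/
def hopMat (j : Fin 2) : Matrix (Fin 3) (Fin 3) ℂ :=
  single j.castSucc j.succ 1 + single j.succ j.castSucc 1

/-- The off-diagonal part of the bit-error operator, up to a factor. -/
def hop : Matrix DetIdx DetIdx ℂ := flipMat 0 ⊗ₖ hopMat 0 + flipMat 1 ⊗ₖ hopMat 1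

theorem flipMat_mulVec (j : Fin 2) (v : (Fin 3 → Fin 2) → ℂ) (z : Fin 3 → Fin 2) :
    (flipMat j *ᵥ v) z = v (flip j z) := by
  simp [flipMat, mulVec, dotProduct]

theorem kronecker_mulVec (A : Matrix (Fin 3 → Fin 2) (Fin 3 → Fin 2) ℂ) (B : Matrix (Fin 3) (Fin 3) ℂ)
    (v : DetIdx → ℂ) (z : Fin 3 → Fin 2) (k : Fin 3) :
    ((A ⊗ₖ B) *ᵥ v) (z, k) = ∑ l, B k l * (A *ᵥ fun z' => v (z', l)) z := by
  simp only [mulVec, dotProduct, Fintype.sum_prod_type, kroneckerMap_apply, Finset.mul_sum]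
  rw [Finset.sum_comm]
  exact Finset.sum_congr rfl fun _ _ => Finset.sum_congr rfl fun _ _ => by ring

/-- As a graph on the product basis, `hop` is a disjoint union of stars, one for each `z`: the
centre `(z, 1)` is joined to the leaves `(flip 0 z, 0)` and `(flip 1 z, 2)`. The sum is indexed by
the centres. -/
theorem dotProduct_hop (v : DetIdx → ℂ) :
    star v ⬝ᵥ (hop *ᵥ v) = ∑ z, (conj (v (z, 1)) * v (flip 0 z, 0) + conj (v (flip 0 z, 0)) * v (z, 1)
      + conj (v (z, 1)) * v (flip 1 z, 2) + conj (v (flip 1 z, 2)) * v (z, 1)) := by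
  have h0 : ∑ z, conj (v (flip 0 z, 0)) * v (z, 1) = ∑ z, conj (v (z, 0)) * v (flip 0 z, 1) :=
    Fintype.sum_equiv (flipEquiv 0) _ _ fun z => by simp [flipEquiv, flip_flip]
  have h1 : ∑ z, conj (v (flip 1 z, 2)) * v (z, 1) = ∑ z, conj (v (z, 2)) * v (flip 1 z, 1) :=
    Fintype.sum_equiv (flipEquiv 1) _ _ fun z => by simp [flipEquiv, flip_flip]
  rw [Finset.sum_add_distrib, Finset.sum_add_distrib, Finset.sum_add_distrib, h0, h1,
    ← Finset.sum_add_distrib, ← Finset.sum_add_distrib, ← Finset.sum_add_distrib]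
  simp only [dotProduct, Fintype.sum_prod_type, hop, add_mulVec, Pi.add_apply, kronecker_mulVec,
    flipMat_mulVec, Fin.sum_univ_three]
  refine Finset.sum_congr rfl fun z _ => ?_
  simp [hopMat]
  ring

theorem dotProduct_rdiag (g : DetIdx → ℝ) (v : DetIdx → ℂ) :
    star v ⬝ᵥ (rdiag g *ᵥ v) = ∑ z, ((g (z, 1) * ‖v (z, 1)‖ ^ 2
      + g (flip 0 z, 0) * ‖v (flip 0 z, 0)‖ ^ 2 + g (flip 1 z, 2) * ‖v (flip 1 z, 2)‖ ^ 2 : ℝ) : ℂ) := by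
  have h0 : ∑ z, g (flip 0 z, 0) * ‖v (flip 0 z, 0)‖ ^ 2 = ∑ z, g (z, 0) * ‖v (z, 0)‖ ^ 2 :=
    Fintype.sum_equiv (flipEquiv 0) _ _ fun z => by simp [flipEquiv]
  have h1 : ∑ z, g (flip 1 z, 2) * ‖v (flip 1 z, 2)‖ ^ 2 = ∑ z, g (z, 2) * ‖v (z, 2)‖ ^ 2 :=
    Fintype.sum_equiv (flipEquiv 1) _ _ fun z => by simp [flipEquiv]
  rw [← Complex.ofReal_sum, Finset.sum_add_distrib, Finset.sum_add_distrib, h0, h1,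
    ← Finset.sum_add_distrib, ← Finset.sum_add_distrib, Complex.ofReal_sum]
  simp only [dotProduct, rdiag, mulVec_diagonal, Fintype.sum_prod_type, Fin.sum_univ_three]
  refine Finset.sum_congr rfl fun z _ => ?_
  have e : ∀ (x : ℝ) (c : ℂ), star c * (x * c) = ((x * ‖c‖ ^ 2 : ℝ) : ℂ) := fun x c => by
    push_cast
    rw [mul_left_comm, ← Complex.conj_mul']
    rfl
  simp only [Pi.star_apply, e]
  push_cast
  ring

theorem flipMat_isHermitian (j : Fin 2) : (flipMat j).IsHermitian := by
  ext z z'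
  have : z = flip j z' ↔ z' = flip j z :=
    ⟨fun h => by rw [h, flip_flip], fun h => by rw [h, flip_flip]⟩
  simp only [conjTranspose_apply, flipMat, of_apply, this]
  split_ifs <;> simp

theorem hopMat_isHermitian (j : Fin 2) : (hopMat j).IsHermitian := by
  unfold IsHermitian hopMat
  rw [conjTranspose_add, conjTranspose_single, conjTranspose_single, add_comm]
  simp

theorem hop_isHermitian : hop.IsHermitian := by
  have h : ∀ j, (flipMat j ⊗ₖ hopMat j).IsHermitian := fun j => by
    unfold IsHermitian
    rw [conjTranspose_kronecker, flipMat_isHermitian, hopMat_isHermitian]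
  exact (h 0).add (h 1)

theorem re_conj_mul_le {x y κ : ℝ} (hx : 0 < x) (hxy : κ ^ 2 ≤ x * y) (c l : ℂ) :
    0 ≤ x * ‖c‖ ^ 2 + y * ‖l‖ ^ 2 + 2 * κ * (conj c * l).re := by
  have h1 : (conj c * l).re ^ 2 ≤ (‖c‖ * ‖l‖) ^ 2 := by
    rw [← sq_abs]
    refine pow_le_pow_left₀ (abs_nonneg _) ((Complex.abs_re_le_norm _).trans (le_of_eq ?_)) 2
    rw [norm_mul, RCLike.norm_conj]
  refine (mul_nonneg_iff_of_pos_left hx).1 ?_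
  generalize (conj c * l).re = w at *
  have h2 : |κ * w| ≤ |κ| * (‖c‖ * ‖l‖) := by
    rw [abs_mul]
    exact mul_le_mul_of_nonneg_left (abs_le_of_sq_le_sq h1 (by positivity)) (abs_nonneg _)
  have h3 := (abs_le.1 h2).1
  nlinarith [mul_le_mul_of_nonneg_right hxy (sq_nonneg ‖l‖), sq_nonneg (x * ‖c‖ - |κ| * ‖l‖),
    sq_abs κ, mul_le_mul_of_nonneg_left h3 hx.le]

/-- In each star the diagonal weight of the centre is shared as `x + y` between the two edges, and
each edge is a positive two-by-two form. -/
theorem hop_posSemidef {g : DetIdx → ℝ} {κ : ℝ}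
    (h : ∀ z, ∃ x y, 0 < x ∧ 0 < y ∧ x + y ≤ g (z, 1) ∧ κ ^ 2 ≤ x * g (flip 0 z, 0) ∧
      κ ^ 2 ≤ y * g (flip 1 z, 2)) : (rdiag g + κ • hop).PosSemidef := by
  refine PosSemidef.of_dotProduct_mulVec_nonneg ?_ fun v => ?_
  · refine IsHermitian.add ?_ ?_
    · exact isHermitian_diagonal_of_self_adjoint _ (by ext; simp)
    · unfold IsHermitian
      rw [conjTranspose_smul, hop_isHermitian]
      simp
  · rw [add_mulVec, smul_mulVec, dotProduct_add, dotProduct_smul, dotProduct_rdiag, dotProduct_hop,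
      Finset.smul_sum, ← Finset.sum_add_distrib]
    refine Finset.sum_nonneg fun z _ => ?_
    obtain ⟨x, y, hx, hy, hxy, h0, h1⟩ := h z
    have e : ∀ c l : ℂ, conj c * l + conj l * c = ((2 * (conj c * l).re : ℝ) : ℂ) := fun c l => by
      have : conj l * c = conj (conj c * l) := by simp [mul_comm]
      rw [this, Complex.add_conj]
    rw [e, add_assoc (Complex.ofReal _) (_ * _), e, ← Complex.ofReal_add, Complex.real_smul, ← Complex.ofReal_mul,
      ← Complex.ofReal_add]
    refine Complex.zero_le_real.2 ?_
    have p0 := re_conj_mul_le hx h0 (v (z, 1)) (v (flip 0 z, 0))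
    have p1 := re_conj_mul_le hy h1 (v (z, 1)) (v (flip 1 z, 2))
    have := mul_le_mul_of_nonneg_right hxy (sq_nonneg ‖v (z, 1)‖)
    linarith

end Operators

/-! ### Bit and phase errors in the product basis -/

section Errors

open Matrix ComplexConjugate

open scoped ComplexOrder

theorem sqrt_two_mul_self : (Real.sqrt 2 : ℂ) * (Real.sqrt 2 : ℂ) = 2 := by
  rw [← Complex.ofReal_mul, Real.mul_self_sqrt (by norm_num)]; simp

theorem xProj_apply (x a b : Fin 2) :
    xProj x a b = if x = 0 ∨ a = b then 1 / 2 else -1 / 2 := by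
  have h := sqrt_two_mul_self
  have h0 : (Real.sqrt 2 : ℂ) ≠ 0 := by simp
  fin_cases x <;> fin_cases a <;> fin_cases b <;>
    simp [xProj, proj, hadamard, vecMulVec_apply] <;> field_simp <;> rw [pow_two, h]

theorem eq_flip_iff (j : Fin 2) (z z' : Fin 3 → Fin 2) : z' = flip j z ↔
    ∀ u, if u = j.castSucc ∨ u = j.succ then z u ≠ z' u else z u = z' u := by
  have h : ∀ a b : Fin 2, b = a + 1 ↔ a ≠ b := by decide
  rw [funext_iff]
  refine forall_congr' fun u => ?_
  unfold flip
  split_ifs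
  · exact h _ _
  · exact eq_comm

theorem xxProj_add (j : Fin 2) :
    (xxProj j 0 0 + xxProj j 1 1) + (xxProj j 0 1 + xxProj j 1 0) = 1 := by
  ext z z'
  simp only [xxProj, qubitTensor, Matrix.add_apply, of_apply, Fin.prod_univ_three, one_apply,
    funext_iff, Fin.forall_fin_succ]
  fin_cases j <;> simp [Function.update, one_apply, xProj_apply] <;>
    by_cases h0 : z 0 = z' 0 <;> by_cases h1 : z 1 = z' 1 <;> by_cases h2 : z 2 = z' 2 <;>
      simp [h0, h1, h2] <;> norm_num

theorem xxProj_sub (j : Fin 2) :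
    (xxProj j 0 0 + xxProj j 1 1) - (xxProj j 0 1 + xxProj j 1 0) = flipMat j := by
  ext z z'
  simp only [xxProj, qubitTensor, Matrix.add_apply, Matrix.sub_apply, of_apply, Fin.prod_univ_three,
    flipMat, eq_flip_iff, Fin.forall_fin_succ]
  fin_cases j <;> simp [Function.update, one_apply, xProj_apply] <;>
    by_cases h0 : z 0 = z' 0 <;> by_cases h1 : z 1 = z' 1 <;> by_cases h2 : z 2 = z' 2 <;>
      simp [h0, h1, h2] <;> norm_num

theorem inv_sqrt_two_mul_self : (Real.sqrt 2 : ℂ)⁻¹ * (Real.sqrt 2 : ℂ)⁻¹ = 1 / 2 := by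
  rw [← mul_inv, sqrt_two_mul_self, one_div]

theorem bobKet_zero (d : Fin 2) :
    bobKet 0 d = ![(Real.sqrt 2 : ℂ)⁻¹, (-1) ^ (d : ℕ) * (1 / 2), 0] := by
  have h := inv_sqrt_two_mul_self
  ext k
  fin_cases k
  · simp [bobKet, w]
  · simp [bobKet, w]
    linear_combination (-1 : ℂ) ^ (d : ℕ) * h
  · simp [bobKet, w]

theorem bobKet_one (d : Fin 2) :
    bobKet 1 d = ![0, 1 / 2, (-1) ^ (d : ℕ) * (Real.sqrt 2 : ℂ)⁻¹] := by
  have h := inv_sqrt_two_mul_self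
  ext k
  fin_cases k
  · simp [bobKet, w]
  · simp [bobKet, w]
    linear_combination h
  · simp [bobKet, w]
    ring

theorem bobPOVM_sub (j : Fin 2) :
    bobPOVM j 0 - bobPOVM j 1 = (((Real.sqrt 2)⁻¹ : ℝ) : ℂ) • hopMat j := by
  ext k l
  simp only [Matrix.sub_apply, bobPOVM, proj, vecMulVec_apply, Pi.star_apply, Matrix.smul_apply, hopMat,
    Matrix.add_apply, single_apply]
  fin_cases j <;> fin_cases k <;> fin_cases l <;>
    simp [bobKet_zero, bobKet_one] <;> ring

theorem bobPOVM_add : ∑ j, (bobPOVM j 0 + bobPOVM j 1) = 1 := by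
  have h := inv_sqrt_two_mul_self
  rw [Fin.sum_univ_two]
  ext k l
  simp only [bobPOVM, proj, vecMulVec_apply, Pi.star_apply, Matrix.add_apply, one_apply]
  fin_cases k <;> fin_cases l <;>
    simp [bobKet_zero, bobKet_one, h] <;> norm_num

/-- For each `j`, `A ⊗ B₁ + A' ⊗ B₀ = ½ (A + A') ⊗ (B₀ + B₁) - ½ (A - A') ⊗ (B₀ - B₁)`. The sums are
the identity (for Bob after adding both slots, as the middle state has weight `1/2` in each), and
the differences are `X_j X_{j+1}` and a multiple of the transition matrix. -/
theorem bitError_eq : bitError = rdiag (fun _ => 1 / 2) + (-(2 * Real.sqrt 2)⁻¹ : ℝ) • hop := by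
  have h : ∀ j, (xxProj j 0 0 + xxProj j 1 1) ⊗ₖ bobPOVM j 1
      + (xxProj j 0 1 + xxProj j 1 0) ⊗ₖ bobPOVM j 0
      = (1 / 2 : ℂ) • ((1 : Matrix (Fin 3 → Fin 2) (Fin 3 → Fin 2) ℂ) ⊗ₖ (bobPOVM j 0 + bobPOVM j 1))
        + (-(2 * Real.sqrt 2)⁻¹ : ℝ) • (flipMat j ⊗ₖ hopMat j) := fun j => by
    have e : (-(2 * Real.sqrt 2)⁻¹ : ℝ) • (flipMat j ⊗ₖ hopMat j)
        = (-(1 / 2) : ℂ) • (flipMat j ⊗ₖ (bobPOVM j 0 - bobPOVM j 1)) := by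
      rw [bobPOVM_sub]
      ext x y
      simp
      ring
    rw [e, ← xxProj_add j, ← xxProj_sub j]
    ext x y
    simp only [Matrix.add_apply, kroneckerMap_apply, Matrix.smul_apply, Matrix.sub_apply, smul_eq_mul]
    ring
  unfold bitError
  rw [Finset.sum_congr rfl fun j _ => h j, Finset.sum_add_distrib, ← Finset.smul_sum,
    ← Finset.smul_sum]
  have h1 : ∑ j, (1 : Matrix (Fin 3 → Fin 2) (Fin 3 → Fin 2) ℂ) ⊗ₖ (bobPOVM j 0 + bobPOVM j 1)
      = 1 := by
    rw [Fin.sum_univ_two, ← kronecker_add, ← Fin.sum_univ_two (f := fun j => bobPOVM j 0 + bobPOVM j 1), bobPOVM_add,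
      one_kronecker_one]
  rw [h1, Fin.sum_univ_two]
  congr 1
  ext x y
  by_cases hxy : x = y <;> simp [rdiag, hxy]

/-- The phase-error operator in the product basis. -/
def phaseDiag (x : DetIdx) : ℝ :=
  ![if x.1 1 = 1 then 1 else 0, ((if x.1 0 = 1 then 1 else 0) + if x.1 2 = 1 then 1 else 0) / 2,
    if x.1 1 = 1 then 1 else 0] x.2

def wtDiag (a : ℕ) (x : DetIdx) : ℝ := if wt x.1 = a then 1 else 0

theorem proj_single {n : Type*} [DecidableEq n] (k : n) :
    proj (Pi.single k (1 : ℂ)) = rdiag (Pi.single k 1) := by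
  ext x y
  by_cases h : x = y <;> by_cases hx : x = k <;> by_cases hy : y = k <;>
    simp_all [proj, rdiag, vecMulVec_apply, Pi.single_apply]

theorem sum_proj_kronecker_apply (B : (Fin 3 → Fin 2) → Matrix (Fin 3) (Fin 3) ℂ)
    (z z' : Fin 3 → Fin 2) (k l : Fin 3) :
    (∑ y, proj (Pi.single y 1) ⊗ₖ B y) (z, k) (z', l) = if z = z' then B z k l else 0 := by
  rw [Matrix.sum_apply, Finset.sum_eq_single z]
  · by_cases h : z = z' <;> simp [proj_single, rdiag, h]
  · intro y _ hy
    by_cases h : z = z' <;> simp [proj_single, rdiag, h]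
    subst h
    exact Or.inl (Pi.single_eq_of_ne (Ne.symm hy) _)
  · simp

theorem weightProj_eq (a : ℕ) : weightProj a = rdiag (wtDiag a) := by
  have h : weightProj a = ∑ z, proj (Pi.single z 1) ⊗ₖ
      (if wt z = a then (1 : Matrix (Fin 3) (Fin 3) ℂ) else 0) := by
    ext x y
    simp only [weightProj, kroneckerMap_apply, Matrix.sum_apply, Finset.sum_mul]
    refine Finset.sum_congr rfl fun z _ => ?_
    split_ifs <;> simp
  rw [h]
  ext ⟨z, k⟩ ⟨z', l⟩
  rw [sum_proj_kronecker_apply]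
  by_cases hz : z = z' <;> by_cases hk : k = l <;> by_cases hw : wt z = a <;>
    simp_all [rdiag, wtDiag, one_apply]

theorem phaseError_eq : phaseError = rdiag phaseDiag := by
  ext ⟨z, k⟩ ⟨z', l⟩
  rw [phaseError, Matrix.sum_apply, Fin.sum_univ_two, sum_proj_kronecker_apply,
    sum_proj_kronecker_apply]
  simp only [proj_single, rdiag, Matrix.add_apply, Matrix.smul_apply, diagonal_apply, Prod.mk.injEq,
    smul_eq_mul, Pi.single_apply]
  by_cases hz : z = z'
  · subst hz
    fin_cases k <;> fin_cases l <;> simp [phaseDiag, w] <;> split_ifs <;> norm_num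
  · simp [hz]

end Errors

/-! ### Positivity of the error operators and the phase-error inequality -/

section OperatorInequality

open Matrix

open scoped ComplexOrder

theorem inv_two_sqrt_two_sq : (-(2 * Real.sqrt 2)⁻¹) ^ 2 = 1 / 8 := by
  rw [neg_sq, inv_pow, mul_pow, Real.sq_sqrt (by norm_num)]; norm_num

theorem bitError_posSemidef : bitError.PosSemidef := by
  rw [bitError_eq]
  exact hop_posSemidef fun z => ⟨1 / 4, 1 / 4, by norm_num, by norm_num, by norm_num,
    by rw [inv_two_sqrt_two_sq]; norm_num, by rw [inv_two_sqrt_two_sq]; norm_num⟩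

theorem one_sub_bitError_posSemidef : (1 - bitError).PosSemidef := by
  have h : 1 - bitError = rdiag (fun _ => 1 / 2) + ((2 * Real.sqrt 2)⁻¹ : ℝ) • hop := by
    rw [bitError_eq, ← rdiag_one, sub_add_eq_sub_sub, rdiag_sub, neg_smul, sub_neg_eq_add]
    congr 2
    funext x
    simp only [Pi.sub_apply, Pi.one_apply]
    norm_num
  have e := inv_two_sqrt_two_sq
  rw [neg_sq] at e
  rw [h]
  exact hop_posSemidef fun z => ⟨1 / 4, 1 / 4, by norm_num, by norm_num, by norm_num,
    by rw [e]; norm_num, by rw [e]; norm_num⟩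

/-- The phase-error operator is bounded by the bit-error operator and the weights. -/
theorem phaseError_le {s : ℝ} (hs : 0 < s) :
    (lam • bitError + rdiag (wtDiag 2) + rdiag (fun x => lam / 2 * (s * wtDiag 1 x + wtDiag 3 x / s))
      - phaseError).PosSemidef := by
  obtain ⟨p, hp⟩ : ∃ p, p = lam / 2 := ⟨_, rfl⟩
  have hlam : lam = 2 * p := by rw [hp]; ring
  have h5 : √5 ^ 2 = 5 := Real.sq_sqrt (by norm_num)
  have h50 : 2 < √5 := by rw [Real.lt_sqrt (by norm_num)]; norm_num
  -- This quadratic equation fixes `lam = 2 * p`: it says `(p - 1/2)(p - 1) = p² / 2`, which is what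
  -- the stars centred at weight one and joined to weight three need as `s` tends to 0.
  have hp2 : p ^ 2 = 3 * p - 1 := by rw [hp, lam]; nlinarith
  have hp0 : 5 / 2 < p := by rw [hp, lam]; linarith
  rw [hlam]
  have e : (2 * p) • bitError + rdiag (wtDiag 2)
      + rdiag (fun x => 2 * p / 2 * (s * wtDiag 1 x + wtDiag 3 x / s)) - phaseError
      = rdiag (fun x => p + wtDiag 2 x + p * (s * wtDiag 1 x + wtDiag 3 x / s) - phaseDiag x)
        + (2 * p * -(2 * Real.sqrt 2)⁻¹) • hop := by
    have h : rdiag (fun x => p + wtDiag 2 x + p * (s * wtDiag 1 x + wtDiag 3 x / s) - phaseDiag x)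
        = rdiag ((2 * p) • fun _ => 1 / 2) + rdiag (wtDiag 2)
          + rdiag (fun x => 2 * p / 2 * (s * wtDiag 1 x + wtDiag 3 x / s)) - rdiag phaseDiag := by
      rw [rdiag_add, rdiag_add, rdiag_sub]
      congr 1
      funext x
      simp only [Pi.sub_apply, Pi.add_apply, Pi.smul_apply, smul_eq_mul]
      ring
    rw [h, bitError_eq, phaseError_eq, smul_add, smul_smul, rdiag_smul]
    abel
  rw [e]
  have hκ : (2 * p * -(2 * Real.sqrt 2)⁻¹) ^ 2 = p ^ 2 / 2 := by
    rw [mul_pow, inv_two_sqrt_two_sq]; ring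
  -- Flipping two bits preserves parity, so a star has only even or only odd weights. In an even
  -- star all diagonal entries are at least `p`: there is no phase error at weight 0, and at weight
  -- 2 the added projector pays for it. Even splitting then suffices, as it does for the odd star
  -- centred at `010`, which has no phase errors.
  refine hop_posSemidef fun z => ?_
  rw [hκ]
  have h01 : ∀ a : Fin 2, a = 0 ∨ a = 1 := by decide
  have h11 : (1 + 1 : Fin 2) = 0 := rfl
  have v0 : ∀ a b c : ℝ, ![a, b, c] 0 = a := fun _ _ _ => rfl
  have v1 : ∀ a b c : ℝ, ![a, b, c] 1 = b := fun _ _ _ => rfl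
  have v2 : ∀ a b c : ℝ, ![a, b, c] 2 = c := fun _ _ _ => rfl
  have hps : 0 < p * s := by positivity
  have hps' : p * s * (p / s) = p ^ 2 := by field_simp
  have even : ∀ a b c : ℝ, p ≤ a → p ≤ b → p ≤ c →
      ∃ x, 0 < x ∧ ∃ y, 0 < y ∧ x + y ≤ a ∧ p ^ 2 / 2 ≤ x * b ∧ p ^ 2 / 2 ≤ y * c :=
    fun a b c ha hb hc => ⟨p / 2, by linarith, p / 2, by linarith, by linarith, by nlinarith,
      by nlinarith⟩
  have f00 : flip 0 z 0 = z 0 + 1 := rfl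
  have f01 : flip 0 z 1 = z 1 + 1 := rfl
  have f02 : flip 0 z 2 = z 2 := rfl
  have f10 : flip 1 z 0 = z 0 := rfl
  have f11 : flip 1 z 1 = z 1 + 1 := rfl
  have f12 : flip 1 z 2 = z 2 + 1 := rfl
  rcases h01 (z 0) with h0 | h0 <;> rcases h01 (z 1) with h1 | h1 <;>
    rcases h01 (z 2) with h2 | h2 <;>
    simp only [phaseDiag, wtDiag, wt, Fin.sum_univ_three, f00, f01, f02, f10, f11, f12, h0, h1, h2,
      h11, zero_add, v0, v1, v2] <;> norm_num
  · exact even _ _ _ (by linarith) (by linarith) (by linarith)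
  -- The centre is `001`. Its edge to `111` gets `p s / 2`, because `(p s / 2)(p / s) = p² / 2`; the
  -- edge to `010` gets `p - 1/2` and is tight up to the `s` term by the equation for `p`. The
  -- centre `100` is the mirror image.
  · refine ⟨p * s / 2, by linarith, p - 1 / 2, by linarith, by linarith, ?_, ?_⟩
    · rw [← div_eq_mul_inv]
      nlinarith
    · nlinarith
  · exact even _ _ _ (by linarith) (by linarith) (by linarith)
  · exact even _ _ _ (by linarith) (by linarith) (by linarith)
  · refine ⟨p - 1 / 2, by linarith, p * s / 2, by linarith, by linarith, ?_, ?_⟩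
    · nlinarith
    · rw [← div_eq_mul_inv]
      nlinarith
  · exact even _ _ _ (by linarith) (by linarith) (by linarith)
  · exact even _ _ _ (by linarith) (by linarith) (by linarith)
  -- The centre is `111`: both leaves have weight one, no phase error and diagonal entry `p (1 +
  -- s)`, which determines the two equal shares.
  · have hx : p / (2 * (1 + s)) * (p + p * s) = p ^ 2 / 2 := by field_simp
    have h2 : p / (2 * (1 + s)) + p / (2 * (1 + s)) ≤ p / s := by
      rw [← add_div, div_le_div_iff₀ (by positivity) hs]
      nlinarith
    refine ⟨p / (2 * (1 + s)), by positivity, p / (2 * (1 + s)), by positivity, ?_, ?_, ?_⟩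
    · rw [← div_eq_mul_inv]
      linarith
    · linarith
    · linarith

/-- The phase-error probability of a detected round, for an unnormalised state. -/
theorem phaseError_le_sqrt (φ : Matrix DetIdx DetIdx ℂ →ₗ[ℝ] ℝ)
    (hφ : ∀ M : Matrix DetIdx DetIdx ℂ, M.PosSemidef → 0 ≤ φ M) :
    φ phaseError ≤ lam * φ bitError + φ (rdiag (wtDiag 2))
      + lam * √(φ (rdiag (wtDiag 1)) * φ (rdiag (wtDiag 3))) := by
  have hw : ∀ a, 0 ≤ φ (rdiag (wtDiag a)) := fun a =>
    hφ _ (rdiag_posSemidef fun x => by unfold wtDiag; split_ifs <;> norm_num)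
  have key : ∀ s : ℝ, 0 < s → φ phaseError ≤ lam * φ bitError + φ (rdiag (wtDiag 2))
      + lam / 2 * (s * φ (rdiag (wtDiag 1)) + φ (rdiag (wtDiag 3)) / s) := fun s hs => by
    have h := hφ _ (phaseError_le hs)
    have e : rdiag (fun x => lam / 2 * (s * wtDiag 1 x + wtDiag 3 x / s))
        = (lam / 2 * s) • rdiag (wtDiag 1) + (lam / 2 / s) • rdiag (wtDiag 3) := by
      rw [rdiag_smul, rdiag_smul, rdiag_add]
      congr 1
      funext x
      simp only [Pi.add_apply, Pi.smul_apply, smul_eq_mul]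
      ring
    rw [map_sub, map_add, map_add, e, map_add, map_smul, map_smul, map_smul, smul_eq_mul,
      smul_eq_mul, smul_eq_mul] at h
    have : lam / 2 * (s * φ (rdiag (wtDiag 1)) + φ (rdiag (wtDiag 3)) / s)
        = lam / 2 * s * φ (rdiag (wtDiag 1)) + lam / 2 / s * φ (rdiag (wtDiag 3)) := by ring
    linarith
  have hl := lam_pos
  have hA := hw 1
  have hB := hw 3
  generalize φ (rdiag (wtDiag 1)) = A at *
  generalize φ (rdiag (wtDiag 3)) = B at *
  generalize lam * φ bitError + φ (rdiag (wtDiag 2)) = K at *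
  -- If `A` or `B` vanishes, the infimum over `s` is reached only in the limit `s → ∞` or `s → 0`,
  -- so an arbitrary loss `δ` is allowed.
  rcases hA.eq_or_lt with rfl | hA
  · rw [zero_mul, Real.sqrt_zero, mul_zero, add_zero]
    refine le_of_forall_pos_le_add fun δ hδ => ?_
    have hs : 0 < (lam / 2 * B + 1) / δ := by positivity
    refine (key _ hs).trans (add_le_add_right ?_ K)
    rw [mul_zero, zero_add, mul_div_assoc', div_le_iff₀ hs, mul_div_cancel₀ _ hδ.ne']
    linarith
  rcases hB.eq_or_lt with rfl | hB
  · rw [mul_zero, Real.sqrt_zero, mul_zero, add_zero]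
    refine le_of_forall_pos_le_add fun δ hδ => ?_
    have hs : 0 < δ / (lam / 2 * A + 1) := by positivity
    refine (key _ hs).trans (add_le_add_right ?_ K)
    have e : lam / 2 * (δ / (lam / 2 * A + 1) * A + 0 / (δ / (lam / 2 * A + 1)))
        = δ * (lam / 2 * A) / (lam / 2 * A + 1) := by ring
    rw [e, div_le_iff₀ (by positivity)]
    linarith
  refine (key (√B / √A) (by positivity)).trans (le_of_eq ?_)
  congr 1
  have h1 : √B / √A * A = √A * √B := by
    nth_rw 2 [← Real.mul_self_sqrt hA.le]
    field_simp
  have h2 : B / (√B / √A) = √A * √B := by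
    nth_rw 1 [← Real.mul_self_sqrt hB.le]
    field_simp
  rw [h1, h2, Real.sqrt_mul hA.le]
  ring

end OperatorInequality

/-! ### One-round measurements and their conditional laws -/

section Rounds

open Matrix

open scoped ComplexOrder

/-- The system of a round. -/
abbrev RoundIdx := (Fin 3 → Fin 2) × Option (Fin 3)

/-- Extends an operator on the system of a detected round by zero. -/
def embed : Matrix DetIdx DetIdx ℂ →ₗ[ℝ] Matrix RoundIdx RoundIdx ℂ where
  toFun M := of fun x y =>
    match x.2, y.2 with
    | some k, some l => M (x.1, k) (y.1, l)
    | _, _ => 0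
  map_add' M M' := by
    ext ⟨z, k⟩ ⟨z', l⟩
    cases k <;> cases l <;> simp
  map_smul' c M := by
    ext ⟨z, k⟩ ⟨z', l⟩
    cases k <;> cases l <;> simp

theorem embed_posSemidef {M : Matrix DetIdx DetIdx ℂ} (hM : M.PosSemidef) :
    (embed M).PosSemidef := by
  refine PosSemidef.of_dotProduct_mulVec_nonneg ?_ fun v => ?_
  · ext ⟨z, k⟩ ⟨z', l⟩
    cases k <;> cases l <;> simp [embed]
    exact hM.1.apply _ _
  · have h := hM.dotProduct_mulVec_nonneg fun x => v (x.1, some x.2)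
    have e : star v ⬝ᵥ (embed M *ᵥ v) = star (fun x : DetIdx => v (x.1, some x.2)) ⬝ᵥ
        (M *ᵥ fun x : DetIdx => v (x.1, some x.2)) := by
      simp [dotProduct, mulVec, Fintype.sum_prod_type, Fintype.sum_option, embed]
    rwa [e]

theorem roundOp_detected {t : ℝ} {ω : Outcome} (h : ω ≠ .undetected) :
    roundOp t ω = embed (detectedOp t ω) := by
  ext ⟨z, k⟩ ⟨z', l⟩
  cases k <;> cases l <;> simp [roundOp, embed, h]

theorem roundOp_undetected (t : ℝ) :
    roundOp t .undetected = rdiag fun x : RoundIdx => if x.2 = none then 1 else 0 := by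
  ext ⟨z, k⟩ ⟨z', l⟩
  cases k <;> cases l <;> simp [roundOp, rdiag, detectedOp, diagonal_apply]

theorem sum_outcome {M : Type*} [AddCommMonoid M] (F : Outcome → M) :
    ∑ ω, F ω = F .undetected + (∑ a, F (.code true a) + ∑ a, F (.code false a))
      + (F (.sample true) + F (.sample false)) := by
  have h : (Finset.univ : Finset Outcome) = {.undetected} ∪
      (Finset.univ.image (Outcome.code true) ∪ Finset.univ.image (Outcome.code false))
      ∪ {.sample true, .sample false} := by decide
  rw [h, Finset.sum_union (by decide), Finset.sum_union (by decide), Finset.sum_union (by decide),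
    Finset.sum_singleton, Finset.sum_image fun _ _ _ _ h => by simpa using h,
    Finset.sum_image fun _ _ _ _ h => by simpa using h,
    Finset.sum_pair (by simp)]

theorem wtDiag_nonneg (a : ℕ) (x : DetIdx) : 0 ≤ wtDiag a x := by
  unfold wtDiag; split_ifs <;> norm_num

theorem phaseDiag_mem (x : DetIdx) : 0 ≤ phaseDiag x ∧ phaseDiag x ≤ 1 := by
  obtain ⟨z, k⟩ := x
  fin_cases k <;> simp [phaseDiag] <;> split_ifs <;> norm_num

theorem sum_wtDiag (x : DetIdx) : ∑ a : Fin 4, wtDiag a x = 1 := by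
  have h : ∀ z : Fin 3 → Fin 2, wt z < 4 := fun z => by
    unfold wt
    rw [Fin.sum_univ_three]
    omega
  rw [Finset.sum_eq_single (⟨wt x.1, h x.1⟩ : Fin 4)]
  · simp [wtDiag]
  · intro a _ ha
    unfold wtDiag
    rw [if_neg]
    intro hw
    exact ha (Fin.ext hw.symm)
  · simp

theorem detectedOp_code_true (t : ℝ) (a : Fin 4) :
    detectedOp t (.code true a) = t • rdiag (wtDiag a * phaseDiag) := by
  simp only [detectedOp, weightProj_eq, phaseError_eq, rdiag_mul, Complex.coe_smul]

theorem detectedOp_code_false (t : ℝ) (a : Fin 4) :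
    detectedOp t (.code false a) = t • rdiag (wtDiag a * (1 - phaseDiag)) := by
  simp only [detectedOp, weightProj_eq, phaseError_eq, ← rdiag_one, rdiag_sub, rdiag_mul,
    Complex.coe_smul]

theorem detectedOp_posSemidef {t : ℝ} (ht0 : 0 ≤ t) (ht1 : t ≤ 1) (ω : Outcome) :
    (detectedOp t ω).PosSemidef := by
  have h1 : 0 ≤ 1 - t := by linarith
  rcases ω with _ | ⟨ph, a⟩ | b
  · exact PosSemidef.zero
  · cases ph
    · rw [detectedOp_code_false]
      exact (rdiag_posSemidef fun x => mul_nonneg (wtDiag_nonneg _ x)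
        (sub_nonneg.2 (phaseDiag_mem x).2)).smul ht0
    · rw [detectedOp_code_true]
      exact (rdiag_posSemidef fun x => mul_nonneg (wtDiag_nonneg _ x) (phaseDiag_mem x).1).smul ht0
  · cases b <;> simp only [detectedOp, Complex.coe_smul]
    · exact one_sub_bitError_posSemidef.smul h1
    · exact bitError_posSemidef.smul h1

theorem roundOp_posSemidef {t : ℝ} (ht0 : 0 ≤ t) (ht1 : t ≤ 1) (ω : Outcome) :
    (roundOp t ω).PosSemidef := by
  by_cases h : ω = .undetected
  · rw [h, roundOp_undetected]
    exact rdiag_posSemidef fun x => by split_ifs <;> norm_num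
  · rw [roundOp_detected h]
    exact embed_posSemidef (detectedOp_posSemidef ht0 ht1 ω)

/-- The operator of an outcome, restricted to a round that is, or is not, detected. -/
def stepOp (t : ℝ) (d : Bool) (ω : Outcome) : Matrix RoundIdx RoundIdx ℂ :=
  if decide (ω ≠ .undetected) = d then roundOp t ω else 0

theorem stepOp_posSemidef {t : ℝ} (ht0 : 0 ≤ t) (ht1 : t ≤ 1) (d : Bool) (ω : Outcome) :
    (stepOp t d ω).PosSemidef := by
  unfold stepOp
  split_ifs
  · exact roundOp_posSemidef ht0 ht1 ω
  · exact PosSemidef.zero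

/-- The weights `1 / t` and `lam / (1 - t)` in `excess` cancel the probabilities of code and sample
rounds, so its total is the value of `φ` at `phaseError - P₂ - lam • bitError`. The inequality is
then `phaseError_le_sqrt` for `φ` restricted to detected rounds; the factor `1 / t` in front of the
root appears because `codeWt` counts code rounds only. -/
theorem isStepLaw_stepOp {t : ℝ} (ht0 : 0 < t) (ht1 : t < 1)
    (φ : Matrix RoundIdx RoundIdx ℂ →ₗ[ℝ] ℝ)
    (hφ : ∀ M : Matrix RoundIdx RoundIdx ℂ, M.PosSemidef → 0 ≤ φ M) (d : Bool) :
    IsStepLaw t fun ω => φ (stepOp t d ω) := by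
  have h1t : 1 - t ≠ 0 := by linarith
  have hl := lam_pos
  refine ⟨fun ω => hφ _ (stepOp_posSemidef ht0.le ht1.le d ω), ?_, ?_⟩
  · cases d
    · exact Or.inl fun ω hω => by simp [stepOp, hω]
    · exact Or.inr (by simp [stepOp])
  · cases d
    · have h0 : ∀ ω, φ (stepOp t false ω) * excess t ω = 0 := fun ω => by
        by_cases hω : ω = .undetected
        · simp [hω, excess]
        · simp [stepOp, hω]
      rw [Finset.sum_eq_zero fun ω _ => h0 ω]
      positivity
    · let φ' := φ.comp embed
      have hφ' : ∀ M : Matrix DetIdx DetIdx ℂ, M.PosSemidef → 0 ≤ φ' M := fun M hM =>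
        hφ _ (embed_posSemidef hM)
      have hstep : ∀ ω, ω ≠ .undetected → φ (stepOp t true ω) = φ' (detectedOp t ω) := fun ω hω => by
        simp [stepOp, hω, φ', roundOp_detected hω]
      have hW : ∀ a : Fin 4, φ' (rdiag (wtDiag a * phaseDiag))
          + φ' (rdiag (wtDiag a * (1 - phaseDiag))) = φ' (rdiag (wtDiag a)) := fun a => by
        rw [← map_add, rdiag_add, ← mul_add, add_sub_cancel, mul_one]
      have hE : ∑ a : Fin 4, φ' (rdiag (wtDiag a * phaseDiag)) = φ' phaseError := by
        rw [← map_sum, phaseError_eq]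
        congr 1
        have hs : ∀ s : Finset (Fin 4), ∑ a ∈ s, rdiag (wtDiag a * phaseDiag)
            = rdiag (∑ a ∈ s, wtDiag a * phaseDiag) := fun s => by
          ext x y
          by_cases hxy : x = y <;> simp [Matrix.sum_apply, rdiag, hxy]
        rw [hs, ← Finset.sum_mul]
        congr 1
        funext x
        simp [sum_wtDiag]
      have key := phaseError_le_sqrt φ' hφ'
      have hk : ∀ k : Fin 4, ∑ ω, φ (stepOp t true ω) * codeWt k ω = t * φ' (rdiag (wtDiag k)) :=
        fun k => by
          rw [sum_outcome]
          simp only [codeWt, mul_zero, add_zero, mul_ite, mul_one, Finset.sum_ite_eq',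
            Finset.mem_univ, if_true, zero_add]
          rw [hstep _ (by simp), hstep _ (by simp), detectedOp_code_true, detectedOp_code_false,
            map_smul, map_smul, smul_eq_mul, smul_eq_mul, ← mul_add, hW]
      have hx : ∑ ω, φ (stepOp t true ω) * excess t ω
          = φ' phaseError - φ' (rdiag (wtDiag 2)) - lam * φ' bitError := by
        rw [sum_outcome, hstep (.sample true) (by simp)]
        have e1 : ∀ a, φ (stepOp t true (.code true a)) * excess t (.code true a)
            = φ' (rdiag (wtDiag a * phaseDiag))
              - if a = 2 then φ' (rdiag (wtDiag a * phaseDiag)) else 0 := fun a => by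
          rw [hstep _ (by simp), detectedOp_code_true, map_smul, smul_eq_mul]
          simp only [excess, if_true]
          split_ifs <;> field_simp <;> ring
        have e2 : ∀ a, φ (stepOp t true (.code false a)) * excess t (.code false a)
            = - if a = 2 then φ' (rdiag (wtDiag a * (1 - phaseDiag))) else 0 := fun a => by
          rw [hstep _ (by simp), detectedOp_code_false, map_smul, smul_eq_mul]
          simp only [excess]
          split_ifs <;> first | contradiction | (field_simp; ring)
        simp only [e1, e2, Finset.sum_sub_distrib, Finset.sum_neg_distrib, Finset.sum_ite_eq',
          Finset.mem_univ, if_true]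
        rw [hE]
        have h2 := hW 2
        have hb : φ' (detectedOp t (.sample true)) = (1 - t) * φ' bitError := by
          simp only [detectedOp, Complex.coe_smul]
          rw [map_smul, smul_eq_mul]
        rw [hb]
        simp only [excess, if_true]
        have h3 : (1 - t) * φ' bitError * -(lam / (1 - t)) = -(lam * φ' bitError) := by
          field_simp
        rw [h3]
        simp only [Fin.val_two] at h2 ⊢
        simp
        linarith
      rw [hx, hk, hk]
      have e : t * φ' (rdiag (wtDiag ((1 : Fin 4) : ℕ))) * (t * φ' (rdiag (wtDiag ((3 : Fin 4) : ℕ))))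
          = t ^ 2 * (φ' (rdiag (wtDiag 1)) * φ' (rdiag (wtDiag 3))) := by
        have h3 : ((3 : Fin 4) : ℕ) = 3 := rfl
        rw [h3, Fin.val_one]
        ring
      rw [e, Real.sqrt_mul (by positivity), Real.sqrt_sq ht0.le, ← mul_assoc, div_mul_cancel₀ _ ht0.ne']
      linarith

/-! ### Sequential structure of the joint measurement -/

variable {N : ℕ} {S : Type*}

/-- Tensor product of operators on the rounds. -/
def tensorOp (B : Fin N → Matrix S S ℂ) : Matrix (Fin N → S) (Fin N → S) ℂ :=
  of fun x y => ∏ i, B i (x i) (y i)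

/-- Tensor product of an operator on the first round and one on the other rounds. -/
def consOp (M : Matrix S S ℂ) (M' : Matrix (Fin N → S) (Fin N → S) ℂ) :
    Matrix (Fin (N + 1) → S) (Fin (N + 1) → S) ℂ :=
  of fun x y => M (x 0) (y 0) * M' (Fin.tail x) (Fin.tail y)

theorem tensorOp_cons (B : Fin (N + 1) → Matrix S S ℂ) :
    tensorOp B = consOp (B 0) (tensorOp (Fin.tail B)) := by
  ext x y
  simp [tensorOp, consOp, Fin.prod_univ_succ, Fin.tail]

theorem consOp_posSemidef [Finite S] {M : Matrix S S ℂ} {M' : Matrix (Fin N → S) (Fin N → S) ℂ}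
    (hM : M.PosSemidef) (hM' : M'.PosSemidef) : (consOp M M').PosSemidef := by
  have e : consOp M M' = (M ⊗ₖ M').submatrix (fun x => (x 0, Fin.tail x))
      fun x => (x 0, Fin.tail x) := by
    ext x y; simp [consOp]
  rw [e]
  exact (hM.kronecker hM').submatrix _

theorem tensorOp_posSemidef [Finite S] :
    ∀ {N : ℕ} {B : Fin N → Matrix S S ℂ}, (∀ i, (B i).PosSemidef) → (tensorOp B).PosSemidef
  | 0, B, _ => by
    have : tensorOp B = 1 := by
      ext x y
      have : x = y := Subsingleton.elim _ _
      simp [tensorOp, this, one_apply]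
    rw [this]
    exact PosSemidef.one
  | N + 1, B, h => by
    rw [tensorOp_cons]
    exact consOp_posSemidef (h 0) (tensorOp_posSemidef fun i => h i.succ)

/-- `M ↦ M ⊗ M'`. -/
def consOpLeft (M' : Matrix (Fin N → S) (Fin N → S) ℂ) :
    Matrix S S ℂ →ₗ[ℝ] Matrix (Fin (N + 1) → S) (Fin (N + 1) → S) ℂ where
  toFun M := consOp M M'
  map_add' M M₂ := by ext; simp [consOp, add_mul]
  map_smul' c M := by ext; simp [consOp, mul_assoc]

/-- `M' ↦ M ⊗ M'`. -/
def consOpRight (M : Matrix S S ℂ) :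
    Matrix (Fin N → S) (Fin N → S) ℂ →ₗ[ℝ] Matrix (Fin (N + 1) → S) (Fin (N + 1) → S) ℂ where
  toFun M' := consOp M M'
  map_add' M M₂ := by ext; simp [consOp, mul_add]
  map_smul' c M := by ext; simp [consOp, mul_left_comm]

/-- Tensor products of positive operators are positive. So with the past outcomes fixed and the
later ones summed, the law of a round is a positive functional of its own operators, and a property
of all positive functionals passes to every conditional law. The joint functional `Φ` need not
factorise. -/
theorem allSteps_tensorOp {Ω : Type*} [Fintype Ω] [Finite S] {C : (Ω → ℝ) → Prop} :
    ∀ {N : ℕ} {A : Fin N → Ω → Matrix S S ℂ} (_ : ∀ i ω, (A i ω).PosSemidef)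
      (_ : ∀ (i : Fin N) (φ : Matrix S S ℂ →ₗ[ℝ] ℝ),
        (∀ M : Matrix S S ℂ, M.PosSemidef → 0 ≤ φ M) → C fun ω => φ (A i ω))
      (Φ : Matrix (Fin N → S) (Fin N → S) ℂ →ₗ[ℝ] ℝ)
      (_ : ∀ M : Matrix (Fin N → S) (Fin N → S) ℂ, M.PosSemidef → 0 ≤ Φ M),
      AllSteps C N fun o => Φ (tensorOp fun i => A i (o i))
  | 0, _, hA, _, Φ, hΦ => fun o => hΦ _ (tensorOp_posSemidef fun i => hA i (o i))
  | N + 1, A, hA, hC, Φ, hΦ => by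
    have hcons : ∀ ω (o : Fin N → Ω), (tensorOp fun i => A i ((Fin.cons ω o : Fin (N + 1) → Ω) i))
        = consOp (A 0 ω) (tensorOp fun i => A i.succ (o i)) := fun ω o => by
      rw [tensorOp_cons]
      rfl
    refine ⟨?_, fun ω => ?_⟩
    · have hB : (∑ o : Fin N → Ω, tensorOp fun i => A i.succ (o i)).PosSemidef :=
        Finset.sum_induction _ PosSemidef (fun _ _ h h' => h.add h') PosSemidef.zero
          fun o _ => tensorOp_posSemidef fun i => hA i.succ (o i)
      have h := hC 0 (Φ.comp (consOpLeft (∑ o : Fin N → Ω, tensorOp fun i => A i.succ (o i))))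
        fun M hM => hΦ _ (consOp_posSemidef hM hB)
      convert h using 2 with ω
      simp only [lawHead, hcons]
      rw [← map_sum]
      simp only [LinearMap.comp_apply]
      congr 1
      exact (map_sum (consOpRight (A 0 ω)) (fun o : Fin N → Ω => tensorOp fun i => A i.succ (o i))
        Finset.univ).symm
    · have h := allSteps_tensorOp (C := C) (A := fun i => A i.succ) (fun i => hA i.succ)
        (fun i => hC i.succ) (Φ.comp (consOpRight (A 0 ω)))
        fun M hM => hΦ _ (consOp_posSemidef (hA 0 ω) hM)
      convert h using 2 with o
      simp only [lawTail, hcons]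
      rfl

end Rounds

/-! ### Squared norms as extended nonnegative reals -/

section Norms

open ENNReal

variable {α β : Type*}

theorem tsum_pi_prod : ∀ {n : ℕ} (f : Fin n → α → ℝ≥0∞),
    ∑' x : Fin n → α, ∏ i, f i (x i) = ∏ i, ∑' a, f i a
  | 0, f => by simp
  | n + 1, f => by
    rw [← (Fin.consEquiv fun _ : Fin (n + 1) => α).tsum_eq, ENNReal.tsum_prod', Fin.prod_univ_succ,
      ← tsum_pi_prod fun i => f i.succ, ← ENNReal.tsum_mul_right]
    simp only [Fin.consEquiv, Equiv.coe_fn_mk, Fin.prod_univ_succ, Fin.cons_zero, Fin.cons_succ,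
      ENNReal.tsum_mul_left]

theorem enorm_sq_eq_ofReal {E : Type*} [SeminormedAddCommGroup E] (x : E) :
    ‖x‖ₑ ^ 2 = ENNReal.ofReal (‖x‖ ^ 2) := by
  rw [ENNReal.ofReal_pow (norm_nonneg _), ofReal_norm]

theorem hasSum_norm_sq (f : ℓ²(α, ℂ)) : HasSum (fun x => ‖f x‖ ^ 2) (‖f‖ ^ 2) := by
  have h := lp.hasSum_norm (p := 2) (by norm_num) f
  simpa using h

theorem tsum_enorm_sq (f : ℓ²(α, ℂ)) : ∑' x, ‖f x‖ₑ ^ 2 = ‖f‖ₑ ^ 2 := by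
  simp only [enorm_sq_eq_ofReal]
  rw [← ENNReal.ofReal_tsum_of_nonneg (fun _ => by positivity) (summable_norm_sq f),
    (hasSum_norm_sq f).tsum_eq]

theorem enorm_sq_tensorVec {n : ℕ} (f : Fin n → ℓ²(α, ℂ)) :
    ‖tensorVec f‖ₑ ^ 2 = ∏ i, ‖f i‖ₑ ^ 2 := by
  simp only [← tsum_enorm_sq, ← tsum_pi_prod]
  refine tsum_congr fun x => ?_
  change ‖∏ i, f i (x i)‖ₑ ^ 2 = _
  simp only [enorm_sq_eq_ofReal, norm_prod, ← Finset.prod_pow]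
  rw [ENNReal.ofReal_prod_of_nonneg fun _ _ => by positivity]

end Norms

/-! ### The joint state after the attack -/

section State

open ENNReal

variable {K R E : Type*} {src : Source K} {N : ℕ} (P : Purification src R) (V : Attack K N E)

/-- Probability that the `Z`-basis value of Alice's `u`-th qubit is `z`. -/
def Purification.zProb (u : Fin 3) (z : Fin 2) : ℝ≥0∞ := ∑' r, ‖P.pulse u z r‖ₑ ^ 2

theorem tsum_enorm_sq_emitted (z : Fin N → Fin 3 → Fin 2) :
    ∑' r, ‖P.emitted z r‖ₑ ^ 2 = ∏ i, ∏ u, P.zProb u (z i u) := by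
  unfold Purification.emitted Purification.zProb
  simp only [enorm_sq_tensorVec]
  rw [tsum_pi_prod fun i (r : Fin 3 → R) => ∏ u, ‖P.pulse u (z i u) (r u)‖ₑ ^ 2]
  refine Finset.prod_congr rfl fun i _ => ?_
  rw [tsum_pi_prod fun u r => ‖P.pulse u (z i u) r‖ₑ ^ 2]

theorem sum_tsum_enorm_sq_attack (v : ℓ²(Fin N → Fin 3 → (K →₀ ℕ), ℂ)) :
    ∑' e, ∑ b, ‖V v (b, e)‖ₑ ^ 2 = ‖v‖ₑ ^ 2 := by
  have h : ‖v‖ₑ = ‖V v‖ₑ := by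
    rw [← ofReal_norm, ← ofReal_norm, V.norm_map]
  rw [h, ← tsum_enorm_sq, ENNReal.tsum_prod', ENNReal.tsum_comm]
  exact tsum_congr fun e => (tsum_fintype _).symm

/-- The weight depends only on Alice's bits, on which the attack does not act, and an isometry
preserves the norm of each emitted component. What remains is a product over the blocks. -/
theorem tsum_sum_attackedVec (c : (Fin 3 → Fin 2) → ℝ≥0∞) :
    ∑' re : (Fin N → Fin 3 → R) × E, ∑ x : (Fin N → Fin 3 → Fin 2) × (Fin N → Option (Fin 3)),
        (∏ i, c (x.1 i)) * ‖attackedVec P V re.1 re.2 x‖ₑ ^ 2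
      = (∑ z, c z * ∏ u, P.zProb u (z u)) ^ N := by
  have h1 : ∀ (r : Fin N → Fin 3 → R), ∑' e, ∑ x : (Fin N → Fin 3 → Fin 2) × (Fin N → Option (Fin 3)),
      (∏ i, c (x.1 i)) * ‖attackedVec P V r e x‖ₑ ^ 2
      = ∑ z : Fin N → Fin 3 → Fin 2, (∏ i, c (z i)) * ‖P.emitted z r‖ₑ ^ 2 := fun r => by
    simp only [Fintype.sum_prod_type, ← Finset.mul_sum]
    rw [Summable.tsum_finsetSum fun _ _ => ENNReal.summable]
    refine Finset.sum_congr rfl fun z _ => ?_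
    rw [ENNReal.tsum_mul_left, ← sum_tsum_enorm_sq_attack V (P.emitted z r)]
    rfl
  rw [ENNReal.tsum_prod']
  simp only [h1]
  rw [Summable.tsum_finsetSum fun _ _ => ENNReal.summable]
  simp only [ENNReal.tsum_mul_left, tsum_enorm_sq_emitted, ← Finset.prod_mul_distrib]
  have h2 := Finset.prod_univ_sum (fun _ : Fin N => (Finset.univ : Finset (Fin 3 → Fin 2)))
    (fun _ z => c z * ∏ u, P.zProb u (z u))
  rw [Finset.prod_const, Finset.card_univ, Fintype.card_fin, Fintype.piFinset_univ] at h2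
  exact h2.symm

end State

/-! ### Photon statistics of the emitted pulses -/

section Photons

open ENNReal

variable {K R : Type*} {src : Source K} (P : Purification src R)

/-- Joint probability of the `Z`-basis value `z` of Alice's `u`-th qubit and the occupation numbers
`s` of the `u`-th pulse. -/
def Purification.zsProb (u : Fin 3) (z : Fin 2) (s : K →₀ ℕ) : ℝ≥0∞ := ∑' r, ‖P.pulse u z r s‖ₑ ^ 2

/-- Probability of the occupation numbers `s` in the state `ρ u b`. -/
def Source.sProb (src : Source K) (u : Fin 3) (b : Fin 2) (s : K →₀ ℕ) : ℝ≥0∞ :=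
  ENNReal.ofReal (matEl (src.ρ u b) s s).re

theorem zProb_eq_tsum (u : Fin 3) (z : Fin 2) : P.zProb u z = ∑' s, P.zsProb u z s := by
  unfold Purification.zProb Purification.zsProb
  rw [ENNReal.tsum_comm]
  exact tsum_congr fun r => (tsum_enorm_sq _).symm

theorem hasSum_purification (u : Fin 3) (b : Fin 2) (s : K →₀ ℕ) :
    HasSum (fun r => ‖P.ψ u b (s, r)‖ ^ 2) (matEl (src.ρ u b) s s).re := by
  have h := Complex.hasSum_re (P.purifies u b s s)
  convert h using 2 with r
  rw [Complex.star_def, Complex.mul_conj, Complex.ofReal_re, Complex.normSq_eq_norm_sq]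

theorem matEl_self_re_nonneg (P : Purification src R) (u : Fin 3) (b : Fin 2)
    (s : K →₀ ℕ) :
    0 ≤ (matEl (src.ρ u b) s s).re :=
  (hasSum_purification P u b s).nonneg fun _ => by positivity

theorem tsum_enorm_sq_purification (u : Fin 3) (b : Fin 2) (s : K →₀ ℕ) :
    ∑' r, ‖P.ψ u b (s, r)‖ₑ ^ 2 = src.sProb u b s := by
  have h := hasSum_purification P u b s
  simp only [enorm_sq_eq_ofReal]
  rw [← ENNReal.ofReal_tsum_of_nonneg (fun _ => by positivity) h.summable, h.tsum_eq, Source.sProb]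

theorem pulse_apply (u : Fin 3) (z : Fin 2) (r : R) (s : K →₀ ℕ) :
    P.pulse u z r s = (P.ψ u 0 (s, r) + (-1) ^ (z : ℕ) * P.ψ u 1 (s, r)) / 2 := by
  have h2 : ((Real.sqrt 2 : ℝ) : ℂ) ^ 2 = 2 := by
    rw [← Complex.ofReal_pow, Real.sq_sqrt (by norm_num)]; norm_num
  have h0 : ((Real.sqrt 2 : ℝ) : ℂ) ≠ 0 := by
    intro h; rw [h] at h2; norm_num at h2
  have e : P.pulse u z r s = ((Real.sqrt 2 : ℝ) : ℂ)⁻¹ *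
      (hadamard z 0 * P.ψ u 0 (s, r) + hadamard z 1 * P.ψ u 1 (s, r)) := by
    rw [Purification.pulse, Fin.sum_univ_two]
    rfl
  rw [e, ← h2]
  simp only [hadamard, Matrix.of_apply]
  field_simp
  simp [mul_comm]

theorem sum_enorm_sq_pulse (u : Fin 3) (r : R) (s : K →₀ ℕ) :
    ∑ z, ‖P.pulse u z r s‖ₑ ^ 2 = ∑ b, 2⁻¹ * ‖P.ψ u b (s, r)‖ₑ ^ 2 := by
  have h2 : (2⁻¹ : ℝ≥0∞) = ENNReal.ofReal 2⁻¹ := by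
    rw [ENNReal.ofReal_inv_of_pos (by norm_num)]; norm_num
  simp only [enorm_sq_eq_ofReal, Fin.sum_univ_two, pulse_apply, h2]
  rw [← ENNReal.ofReal_add (by positivity) (by positivity), ← ENNReal.ofReal_mul (by norm_num),
    ← ENNReal.ofReal_mul (by norm_num), ← ENNReal.ofReal_add (by positivity) (by positivity)]
  congr 1
  have h := parallelogram_law_with_norm ℝ (P.ψ u 0 (s, r)) (P.ψ u 1 (s, r))
  simp only [norm_div, div_pow]
  norm_num [← sub_eq_add_neg]
  linarith

theorem sum_zsProb (u : Fin 3) (s : K →₀ ℕ) :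
    ∑ z, P.zsProb u z s = ∑ b, 2⁻¹ * src.sProb u b s := by
  unfold Purification.zsProb
  simp only [← tsum_enorm_sq_purification P, ← ENNReal.tsum_mul_left]
  rw [← Summable.tsum_finsetSum fun _ _ => ENNReal.summable,
    ← Summable.tsum_finsetSum fun _ _ => ENNReal.summable]
  exact tsum_congr fun r => sum_enorm_sq_pulse P u r s

/-- The component at `z = 1` is half the difference of the two purifications, whose vacuum parts
agree. -/
theorem zsProb_one_vacuum (u : Fin 3) : P.zsProb u 1 0 = 0 := by
  unfold Purification.zsProb
  simp [pulse_apply, P.vacuum u]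

theorem tsum_sProb (P : Purification src R) (u : Fin 3) (b : Fin 2) : ∑' s, src.sProb u b s = 1 := by
  have h := Complex.hasSum_re (src.density u b).2
  unfold Source.sProb
  rw [← ENNReal.ofReal_tsum_of_nonneg (fun s => matEl_self_re_nonneg P u b s) h.summable, h.tsum_eq]
  simp

theorem sum_zProb (u : Fin 3) : ∑ z, P.zProb u z = 1 := by
  simp only [zProb_eq_tsum]
  rw [← Summable.tsum_finsetSum fun _ _ => ENNReal.summable]
  simp only [sum_zsProb]
  rw [Summable.tsum_finsetSum fun _ _ => ENNReal.summable]
  simp only [ENNReal.tsum_mul_left, tsum_sProb P]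
  simp [ENNReal.mul_inv_cancel]

theorem photonTail_eq (P : Purification src R) (b : Fin 3 → Fin 2) (k : ℕ) :
    ∑' s : Fin 3 → (K →₀ ℕ), (if k ≤ ∑ u, (s u).degree then ∏ u, src.sProb u (b u) (s u) else 0)
        = ENNReal.ofReal (src.photonTail b k)
      ∧ 0 ≤ src.photonTail b k := by
  obtain ⟨f, hf⟩ : ∃ f : (Fin 3 → (K →₀ ℕ)) → ℝ≥0∞,
    f = fun s => if k ≤ ∑ u, (s u).degree then ∏ u, src.sProb u (b u) (s u) else 0 := ⟨_, rfl⟩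
  have hle : ∑' s, f s ≤ 1 := by
    calc ∑' s, f s ≤ ∑' s : Fin 3 → (K →₀ ℕ), ∏ u, src.sProb u (b u) (s u) :=
          ENNReal.tsum_le_tsum fun s => by
            rw [hf]
            dsimp only
            split_ifs
            · exact le_rfl
            · exact zero_le
      _ = 1 := by simp [tsum_pi_prod, tsum_sProb P]
  have htop : ∑' s, f s ≠ ∞ := (hle.trans_lt ENNReal.one_lt_top).ne
  have e : src.photonTail b k = (∑' s, f s).toReal := by
    rw [ENNReal.tsum_toReal_eq fun s => ENNReal.ne_top_of_tsum_ne_top htop s]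
    refine tsum_congr fun s => ?_
    rw [hf]
    dsimp only
    split_ifs
    · rw [ENNReal.toReal_prod]
      exact Finset.prod_congr rfl fun u _ => (ENNReal.toReal_ofReal (matEl_self_re_nonneg P _ _ _)).symm
    · simp
  refine ⟨?_, e ▸ ENNReal.toReal_nonneg⟩
  rw [e, ENNReal.ofReal_toReal htop, hf]

/-- With fewer photons than ones, some pulse whose qubit is 1 must be in the vacuum. -/
theorem prod_zsProb_eq_zero {z : Fin 3 → Fin 2} {s : Fin 3 → (K →₀ ℕ)}
    (h : ∑ u, (s u).degree < wt z) : ∏ u, P.zsProb u (z u) (s u) = 0 := by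
  obtain ⟨u, -, hu⟩ := Finset.exists_lt_of_sum_lt h
  have hz : z u = 1 := by omega
  have hs : s u = 0 := by
    rw [← Finsupp.degree_eq_zero_iff]
    omega
  exact Finset.prod_eq_zero (Finset.mem_univ u) (by rw [hz, hs, zsProb_one_vacuum])

/-- Alice's qubits have weight `k` with probability at most that of `k` or more photons. -/
theorem sum_wt_zProb_le {q : ℕ → ℝ} (hq : src.PhotonBound q) {k : ℕ} (hk : k ∈ ({1, 2, 3} : Set ℕ)) :
    ∑ z, (if wt z = k then 1 else 0) * ∏ u, P.zProb u (z u) ≤ ENNReal.ofReal (q k) := by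
  have h1 : ∀ z, (if wt z = k then 1 else 0) * ∏ u, P.zProb u (z u)
      ≤ ∑' s : Fin 3 → (K →₀ ℕ),
        if k ≤ ∑ u, (s u).degree then ∏ u, P.zsProb u (z u) (s u) else 0 := fun z => by
    split_ifs with hz
    · simp only [zProb_eq_tsum, one_mul]
      rw [← tsum_pi_prod fun u s => P.zsProb u (z u) s]
      refine ENNReal.tsum_le_tsum fun s => ?_
      split_ifs with hs
      · exact le_rfl
      · rw [prod_zsProb_eq_zero P (by omega)]
    · simp
  -- Summed over all `Z` values, the photon statistics are those of uniformly random encoded bits.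
  have h2 : ∀ s : Fin 3 → (K →₀ ℕ), ∑ z : Fin 3 → Fin 2, ∏ u, P.zsProb u (z u) (s u)
      = ∑ b : Fin 3 → Fin 2, 8⁻¹ * ∏ u, src.sProb u (b u) (s u) := fun s => by
    have e1 := Finset.prod_univ_sum (fun _ : Fin 3 => (Finset.univ : Finset (Fin 2)))
      (fun u z => P.zsProb u z (s u))
    have e2 := Finset.prod_univ_sum (fun _ : Fin 3 => (Finset.univ : Finset (Fin 2)))
      (fun u b => 2⁻¹ * src.sProb u b (s u))
    simp only [sum_zsProb] at e1
    rw [Fintype.piFinset_univ] at e1 e2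
    rw [← e1, e2]
    refine Finset.sum_congr rfl fun b _ => ?_
    rw [Finset.prod_mul_distrib, Finset.prod_const, Finset.card_univ, Fintype.card_fin,
      ← ENNReal.inv_pow]
    norm_num
  calc ∑ z, (if wt z = k then 1 else 0) * ∏ u, P.zProb u (z u)
      ≤ ∑ z : Fin 3 → Fin 2, ∑' s : Fin 3 → (K →₀ ℕ),
        if k ≤ ∑ u, (s u).degree then ∏ u, P.zsProb u (z u) (s u) else 0 :=
        Finset.sum_le_sum fun z _ => h1 z
    _ = ∑ b : Fin 3 → Fin 2, 8⁻¹ * ∑' s : Fin 3 → (K →₀ ℕ),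
        if k ≤ ∑ u, (s u).degree then ∏ u, src.sProb u (b u) (s u) else 0 := by
        simp only [← ENNReal.tsum_mul_left]
        rw [← Summable.tsum_finsetSum fun _ _ => ENNReal.summable,
          ← Summable.tsum_finsetSum fun _ _ => ENNReal.summable]
        refine tsum_congr fun s => ?_
        split_ifs
        · exact h2 s
        · simp
    _ ≤ ∑ b : Fin 3 → Fin 2, 8⁻¹ * ENNReal.ofReal (q k) := by
        refine Finset.sum_le_sum fun b _ => ?_
        rw [(photonTail_eq P b k).1]
        gcongr
        exact hq b k hk
    _ = ENNReal.ofReal (q k) := by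
        rw [Finset.sum_const, Finset.card_univ]
        simp only [Fintype.card_fun, Fintype.card_fin, nsmul_eq_mul]
        rw [← mul_assoc]
        norm_num
        rw [ENNReal.mul_inv_cancel (by norm_num) (by norm_num), one_mul]

theorem photonBound_nonneg (P : Purification src R) {q : ℕ → ℝ} (hq : src.PhotonBound q) {k : ℕ}
    (hk : k ∈ ({1, 2, 3} : Set ℕ)) : 0 ≤ q k :=
  (photonTail_eq P 0 k).2.trans (hq 0 k hk)

end Photons

/-! ### Expectation values in the state after the attack -/

section Expectation

open Matrix

open scoped ComplexOrder ENNReal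

variable {K R E : Type*} {src : Source K} {N : ℕ} (P : Purification src R) (V : Attack K N E)

theorem star_mul_ofReal_mul (x : ℝ) (c : ℂ) : star c * (x * c) = ((x * ‖c‖ ^ 2 : ℝ) : ℂ) := by
  push_cast
  rw [mul_left_comm, ← Complex.conj_mul']
  rfl

/-- The vector `attackedVec`, as a function of the states of the rounds. -/
def roundsVec (re : (Fin N → Fin 3 → R) × E) (x : Fin N → RoundIdx) : ℂ :=
  attackedVec P V re.1 re.2 (fun i => (x i).1, fun i => (x i).2)

theorem tsum_sum_roundsVec (c : (Fin 3 → Fin 2) → ℝ≥0∞) :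
    ∑' re, ∑ x, (∏ i, c (x i).1) * ‖roundsVec P V re x‖ₑ ^ 2
      = (∑ z, c z * ∏ u, P.zProb u (z u)) ^ N := by
  rw [← tsum_sum_attackedVec P V c]
  exact tsum_congr fun re => Fintype.sum_equiv
    (Equiv.arrowProdEquivProdArrow (Fin N) (fun _ => Fin 3 → Fin 2) fun _ => Option (Fin 3)) _ _
      fun x => rfl

theorem sum_prod_zProb : ∑ z : Fin 3 → Fin 2, ∏ u, P.zProb u (z u) = 1 := by
  have h := Finset.prod_univ_sum (fun _ : Fin 3 => (Finset.univ : Finset (Fin 2)))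
    (fun u z => P.zProb u z)
  rw [Fintype.piFinset_univ] at h
  rw [← h]
  simp only [sum_zProb, Finset.prod_const_one]

theorem summable_roundsVec (x : Fin N → RoundIdx) : Summable fun re => ‖roundsVec P V re x‖ ^ 2 := by
  have h := tsum_sum_roundsVec P V 1
  simp only [Pi.one_apply, Finset.prod_const_one, one_mul, sum_prod_zProb, one_pow] at h
  have h1 : ∑' re, ‖roundsVec P V re x‖ₑ ^ 2 ≠ ∞ := by
    refine (lt_of_le_of_lt ?_ ENNReal.one_lt_top).ne
    rw [← h]
    exact ENNReal.tsum_le_tsum fun re =>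
      Finset.single_le_sum (f := fun x => ‖roundsVec P V re x‖ₑ ^ 2) (fun _ _ => zero_le)
        (Finset.mem_univ x)
  simpa using ENNReal.summable_toReal h1

theorem summable_quadraticForm (M : Matrix (Fin N → RoundIdx) (Fin N → RoundIdx) ℂ) :
    Summable fun re => (star (roundsVec P V re) ⬝ᵥ M *ᵥ roundsVec P V re).re := by
  have e : ∀ re, star (roundsVec P V re) ⬝ᵥ M *ᵥ roundsVec P V re
      = ∑ x, ∑ y, star (roundsVec P V re x) * (M x y * roundsVec P V re y) := fun re => by
    simp only [dotProduct, mulVec, Finset.mul_sum, Pi.star_apply]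
  simp only [e, Complex.re_sum]
  refine summable_sum fun x _ => summable_sum fun y _ => ?_
  refine Summable.of_norm_bounded (g := fun re =>
    ‖M x y‖ * (‖roundsVec P V re x‖ ^ 2 + ‖roundsVec P V re y‖ ^ 2)) ?_ fun re => ?_
  · exact ((summable_roundsVec P V x).add (summable_roundsVec P V y)).mul_left _
  · refine (Complex.abs_re_le_norm _).trans ?_
    rw [norm_mul, norm_mul, norm_star, mul_left_comm]
    gcongr
    nlinarith [sq_nonneg (‖roundsVec P V re x‖ - ‖roundsVec P V re y‖),
      sq_nonneg (‖roundsVec P V re x‖), sq_nonneg (‖roundsVec P V re y‖)]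

/-- Expectation values of operators on Alice's qubits and Bob's systems. -/
def expect : Matrix (Fin N → RoundIdx) (Fin N → RoundIdx) ℂ →ₗ[ℝ] ℝ where
  toFun M := ∑' re, (star (roundsVec P V re) ⬝ᵥ M *ᵥ roundsVec P V re).re
  map_add' M M' := by
    rw [← (summable_quadraticForm P V M).tsum_add (summable_quadraticForm P V M')]
    simp only [add_mulVec, dotProduct_add, Complex.add_re]
  map_smul' c M := by
    simp only [smul_mulVec, dotProduct_smul, Complex.real_smul, Complex.re_ofReal_mul, tsum_mul_left,
      RingHom.id_apply, smul_eq_mul]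

theorem expect_nonneg {M : Matrix (Fin N → RoundIdx) (Fin N → RoundIdx) ℂ} (hM : M.PosSemidef) :
    0 ≤ expect P V M :=
  tsum_nonneg fun re => (Complex.le_def.1 (hM.dotProduct_mulVec_nonneg (roundsVec P V re))).1

theorem prob_eq_expect (t : ℝ) (o : Fin N → Outcome) :
    prob t P V o = expect P V (tensorOp fun i => roundOp t (o i)) := by
  refine tsum_congr fun re => ?_
  congr 1
  simp only [dotProduct, mulVec]
  refine (Fintype.sum_equiv (Equiv.arrowProdEquivProdArrow (Fin N) (fun _ => Fin 3 → Fin 2)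
    fun _ => Option (Fin 3)) _ _ fun x => ?_).symm
  congr 1
  exact Fintype.sum_equiv (Equiv.arrowProdEquivProdArrow (Fin N) (fun _ => Fin 3 → Fin 2)
    fun _ => Option (Fin 3)) _ _ fun y => rfl

theorem expect_rdiag (g : (Fin N → RoundIdx) → ℝ) :
    expect P V (rdiag g) = ∑' re, ∑ x, g x * ‖roundsVec P V re x‖ ^ 2 := by
  refine tsum_congr fun re => ?_
  simp only [dotProduct, rdiag, mulVec_diagonal, Pi.star_apply, star_mul_ofReal_mul]
  rw [← Complex.ofReal_sum, Complex.ofReal_re]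

/-- Dominating `F` by a function of Alice's bits removes the dependence on Bob's system, and with it
the attack. -/
theorem expect_tensorOp_rdiag_le {F : RoundIdx → ℝ} {G : (Fin 3 → Fin 2) → ℝ} (hF : ∀ x, 0 ≤ F x)
    (hFG : ∀ x, F x ≤ G x.1) :
    ENNReal.ofReal (expect P V (tensorOp fun _ => rdiag F))
      ≤ (∑ z, ENNReal.ofReal (G z) * ∏ u, P.zProb u (z u)) ^ N := by
  have e : (tensorOp fun _ => rdiag F) = rdiag fun x : Fin N → RoundIdx => ∏ i, F (x i) := by
    ext x y
    by_cases hxy : x = y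
    · simp [tensorOp, rdiag, hxy]
    · obtain ⟨i, hi⟩ := Function.ne_iff.1 hxy
      refine Eq.trans ?_ (diagonal_apply_ne _ hxy).symm
      exact Finset.prod_eq_zero (Finset.mem_univ i) (diagonal_apply_ne _ hi)
  have hs : Summable fun re => ∑ x, (∏ i, F (x i)) * ‖roundsVec P V re x‖ ^ 2 :=
    summable_sum fun x _ => (summable_roundsVec P V x).mul_left _
  have h0 : ∀ re x, 0 ≤ (∏ i, F (x i)) * ‖roundsVec P V re x‖ ^ 2 := fun re x =>
    mul_nonneg (Finset.prod_nonneg fun i _ => hF _) (by positivity)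
  rw [e, expect_rdiag, ← tsum_sum_roundsVec P V,
    ENNReal.ofReal_tsum_of_nonneg (fun re => Finset.sum_nonneg fun x _ => h0 re x) hs]
  refine ENNReal.tsum_le_tsum fun re => ?_
  rw [ENNReal.ofReal_sum_of_nonneg fun x _ => h0 re x]
  refine Finset.sum_le_sum fun x _ => ?_
  rw [ENNReal.ofReal_mul (Finset.prod_nonneg fun i _ => hF _), enorm_sq_eq_ofReal,
    ENNReal.ofReal_prod_of_nonneg fun i _ => hF _]
  gcongr
  exact hFG _

/-- Weight of a round in the moment generating function of the number of code rounds of weight `k`. -/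
def mgfDiag (t c : ℝ) (k : Fin 4) (x : RoundIdx) : ℝ :=
  if x.2 = none then 1 else 1 + t * c * if wt x.1 = k then 1 else 0

theorem sum_smul_roundOp (t c : ℝ) (k : Fin 4) :
    ∑ ω, (1 + c * codeWt k ω) • roundOp t ω = rdiag (mgfDiag t c k) := by
  have hcode : ∀ a : Fin 4, (roundOp t (.code true a) + roundOp t (.code false a))
      = embed (t • rdiag (wtDiag a)) := fun a => by
    rw [roundOp_detected (by simp), roundOp_detected (by simp), ← map_add, detectedOp_code_true,
      detectedOp_code_false, ← smul_add, rdiag_add, ← mul_add, add_sub_cancel, mul_one]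
  have hsamp : roundOp t (.sample true) + roundOp t (.sample false) = embed ((1 - t) • 1) := by
    rw [roundOp_detected (by simp), roundOp_detected (by simp), ← map_add]
    simp only [detectedOp, Complex.coe_smul]
    rw [← smul_add, add_sub_cancel]
  rw [sum_outcome, ← Finset.sum_add_distrib]
  have h1 : ∀ a : Fin 4, (1 + c * codeWt k (.code true a)) • roundOp t (.code true a)
      + (1 + c * codeWt k (.code false a)) • roundOp t (.code false a)
      = embed ((1 + c * if a = k then 1 else 0) • t • rdiag (wtDiag a)) := fun a => by
    rw [map_smul, ← hcode, smul_add]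
    simp only [codeWt]
  simp only [h1]
  simp only [codeWt, mul_zero, add_zero, one_smul, hsamp, roundOp_undetected]
  have h2 : ∑ a : Fin 4, (1 + c * if a = k then 1 else 0) • t • rdiag (wtDiag a)
      = t • (1 : Matrix DetIdx DetIdx ℂ) + (c * t) • rdiag (wtDiag k) := by
    have h3 : ∑ a : Fin 4, rdiag (wtDiag a) = (1 : Matrix DetIdx DetIdx ℂ) := by
      ext x y
      by_cases hxy : x = y
      · have := sum_wtDiag x
        subst hxy
        simp only [Matrix.sum_apply, rdiag, diagonal_apply_eq, one_apply_eq]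
        exact_mod_cast this
      · simp [Matrix.sum_apply, rdiag, hxy]
    simp only [add_smul, one_smul, Finset.sum_add_distrib, ← Finset.smul_sum, h3]
    simp [smul_smul]
  rw [← map_sum, h2, add_assoc, ← map_add]
  have h4 : t • (1 : Matrix DetIdx DetIdx ℂ) + (c * t) • rdiag (wtDiag k) + (1 - t) • 1
      = rdiag fun x => 1 + t * c * if wt x.1 = k then 1 else 0 := by
    rw [← rdiag_one, rdiag_smul, rdiag_smul, rdiag_smul, rdiag_add, rdiag_add]
    congr 1
    funext x
    simp only [Pi.add_apply, Pi.smul_apply, Pi.one_apply, smul_eq_mul, wtDiag]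
    ring
  rw [h4]
  ext ⟨z, m⟩ ⟨z', m'⟩
  by_cases hz : z = z' <;> cases m <;> cases m' <;>
    simp [rdiag, embed, mgfDiag, diagonal_apply, hz]

theorem sum_prob_mul_prod (t : ℝ) (f : Outcome → ℝ) :
    ∑ o, prob t P V o * ∏ i, f (o i) = expect P V (tensorOp fun _ => ∑ ω, f ω • roundOp t ω) := by
  have e : (tensorOp fun _ : Fin N => ∑ ω, f ω • roundOp t ω)
      = ∑ o : Fin N → Outcome, (∏ i, f (o i)) • tensorOp fun i => roundOp t (o i) := by
    ext x y
    simp only [tensorOp, of_apply, Matrix.sum_apply, Matrix.smul_apply]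
    rw [Finset.prod_univ_sum, Fintype.piFinset_univ]
    refine Finset.sum_congr rfl fun o _ => ?_
    simp only [Complex.real_smul, Finset.prod_mul_distrib, Complex.ofReal_prod]
  rw [e, map_sum]
  refine Finset.sum_congr rfl fun o _ => ?_
  rw [map_smul, smul_eq_mul, prob_eq_expect, mul_comm]

theorem prob_nonneg {t : ℝ} (ht0 : 0 ≤ t) (ht1 : t ≤ 1) (o : Fin N → Outcome) :
    0 ≤ prob t P V o := by
  rw [prob_eq_expect]
  exact expect_nonneg P V (tensorOp_posSemidef fun i => roundOp_posSemidef ht0 ht1 _)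

/-- An undetected round contributes the factor 1, which is at most that of a detected one. So every
round may be treated as detected, and the blocks are then independent. -/
theorem sum_prob_mul_prod_codeWt_le {q : ℕ → ℝ} (hq : src.PhotonBound q) {k : Fin 4}
    (hk : (k : ℕ) ∈ ({1, 2, 3} : Set ℕ)) {t c : ℝ} (ht : 0 ≤ t) (hc : 0 ≤ c) :
    ∑ o, prob t P V o * ∏ i, (1 + c * codeWt k (o i)) ≤ (1 + t * c * q k) ^ N := by
  have hqk := photonBound_nonneg P hq hk
  rw [sum_prob_mul_prod P V t fun ω => 1 + c * codeWt k ω, sum_smul_roundOp]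
  have h0 : ∀ z : Fin 3 → Fin 2, 0 ≤ t * c * if wt z = k then (1 : ℝ) else 0 := fun z => by
    split_ifs <;> simp [mul_nonneg ht hc]
  have h := expect_tensorOp_rdiag_le P V (F := mgfDiag t c k)
    (G := fun z => 1 + t * c * if wt z = k then 1 else 0)
    (fun x => by have := h0 x.1; unfold mgfDiag; split_ifs at this ⊢ <;> linarith)
    (fun x => by have := h0 x.1; unfold mgfDiag; split_ifs at this ⊢ <;> linarith)
  have h1 : ∑ z : Fin 3 → Fin 2, ENNReal.ofReal (1 + t * c * if wt z = k then 1 else 0)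
      * ∏ u, P.zProb u (z u) ≤ ENNReal.ofReal (1 + t * c * q k) := by
    have e : ∀ z : Fin 3 → Fin 2, ENNReal.ofReal (1 + t * c * if wt z = k then 1 else 0)
        * ∏ u, P.zProb u (z u) = ∏ u, P.zProb u (z u)
          + ENNReal.ofReal (t * c) * ((if wt z = k then 1 else 0) * ∏ u, P.zProb u (z u)) := fun z => by
      rw [ENNReal.ofReal_add zero_le_one (h0 z), ENNReal.ofReal_mul (mul_nonneg ht hc),
        ENNReal.ofReal_one, add_mul, one_mul, mul_assoc]
      split_ifs <;> simp
    simp only [e, Finset.sum_add_distrib, sum_prod_zProb, ← Finset.mul_sum]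
    rw [ENNReal.ofReal_add zero_le_one (mul_nonneg (mul_nonneg ht hc) hqk), ENNReal.ofReal_one,
      ENNReal.ofReal_mul (mul_nonneg ht hc)]
    gcongr
    exact sum_wt_zProb_le P hq hk
  have h2 : 0 ≤ 1 + t * c * q k := by positivity
  rw [← ENNReal.ofReal_le_ofReal_iff (by positivity), ENNReal.ofReal_pow h2]
  exact h.trans (by gcongr)

theorem sum_prob_le_one (t : ℝ) : ∑ o, prob t P V o ≤ 1 := by
  have e := sum_prob_mul_prod P V t fun ω => 1 + 0 * codeWt 1 ω
  simp only [zero_mul, add_zero, Finset.prod_const_one, mul_one] at e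
  have e2 := sum_smul_roundOp t 0 1
  simp only [zero_mul, add_zero] at e2
  rw [e, e2]
  have h := expect_tensorOp_rdiag_le P V (F := mgfDiag t 0 1) (G := 1)
    (fun x => by unfold mgfDiag; split_ifs <;> simp)
    (fun x => by unfold mgfDiag; split_ifs <;> simp)
  simpa [sum_prod_zProb] using h

end Expectation

/-! ### The Chernoff bound -/

section Chernoff

/-- `Gam` is the larger root of `G² = L (2μ + G)` with `L = -log ε`; this equates the Chernoff
exponent `G² / (2μ + G)` with `L`. -/
theorem Gam_sq {μ ε : ℝ} (hμ : 0 ≤ μ) (hε : 0 < ε) (hε1 : ε ≤ 1) :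
    -Real.log ε ≤ Gam μ ε ∧ Gam μ ε ^ 2 = -Real.log ε * (2 * μ + Gam μ ε) := by
  have hL : 0 ≤ -Real.log ε := by simpa using Real.log_nonpos hε.le hε1
  have h0 : 0 ≤ Real.log ε ^ 2 - 8 * μ * Real.log ε := by nlinarith [mul_nonneg hμ hL]
  have hs := Real.sq_sqrt h0
  have hs0 : -Real.log ε ≤ √(Real.log ε ^ 2 - 8 * μ * Real.log ε) :=
    Real.le_sqrt_of_sq_le (by nlinarith [mul_nonneg hμ hL])
  unfold Gam
  generalize √(Real.log ε ^ 2 - 8 * μ * Real.log ε) = s at hs hs0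
  exact ⟨by linarith, by nlinarith⟩

/-- Markov's inequality at `c = G / μ`, where `log (1 + x) ≥ 2x / (x + 2)` turns the exponent into
at most `-G² / (2μ + G)`. -/
theorem sum_tail_le {ι : Type*} [Fintype ι] {p W : ι → ℝ} (hp : ∀ o, 0 ≤ p o) {μ ε : ℝ}
    (hμ : 0 ≤ μ) (hε : 0 < ε) (hε1 : ε ≤ 1)
    (h : ∀ c, 0 ≤ c → ∑ o, p o * Real.exp (Real.log (1 + c) * W o) ≤ Real.exp (c * μ)) :
    ∑ o with μ + Gam μ ε < W o, p o ≤ ε := by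
  obtain ⟨hLG, hG⟩ := Gam_sq hμ hε hε1
  generalize Gam μ ε = G at hLG hG
  have hL : 0 ≤ -Real.log ε := by simpa using Real.log_nonpos hε.le hε1
  have hG0 : 0 ≤ G := hL.trans hLG
  have markov : ∀ c, 0 ≤ c →
      (∑ o with μ + G < W o, p o) ≤ Real.exp (c * μ - Real.log (1 + c) * (μ + G)) := fun c hc => by
    have hlog : 0 ≤ Real.log (1 + c) := Real.log_nonneg (by linarith)
    rw [Real.exp_sub, le_div_iff₀ (Real.exp_pos _)]
    refine le_trans ?_ (h c hc)
    rw [Finset.sum_mul, Finset.sum_filter]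
    refine Finset.sum_le_sum fun o _ => ?_
    split_ifs with ho
    · have := hp o
      gcongr
    · exact mul_nonneg (hp o) (Real.exp_pos _).le
  rw [← Real.exp_log hε]
  rcases hμ.eq_or_lt with rfl | hμ
  -- For mean 0 the ratio `G / μ` is meaningless; `c = e - 1` gives `exp (-G)`, and `G ≥ -log ε`.
  · refine (markov (Real.exp 1 - 1) (by have := Real.add_one_le_exp 1; linarith)).trans
      (Real.exp_le_exp.2 ?_)
    rw [add_sub_cancel, Real.log_exp]
    linarith
  · refine (markov (G / μ) (by positivity)).trans (Real.exp_le_exp.2 ?_)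
    have h1 := Real.le_log_one_add_of_nonneg (x := G / μ) (by positivity)
    have e1 : 2 * (G / μ) / (G / μ + 2) = 2 * G / (G + 2 * μ) := by field_simp
    have h2 : 2 * G / (G + 2 * μ) * (μ + G) ≤ Real.log (1 + G / μ) * (μ + G) := by
      rw [← e1]; gcongr
    have h3 : 2 * G / (G + 2 * μ) * (μ + G) = G - Real.log ε := by
      rw [div_mul_eq_mul_div, div_eq_iff (by positivity)]
      linarith
    rw [div_mul_cancel₀ _ hμ.ne']
    linarith

variable {K R E : Type*} {src : Source K} {N : ℕ} (P : Purification src R) (V : Attack K N E)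

theorem prod_codeWt {c : ℝ} (hc : 0 ≤ c) (k : Fin 4) (o : Fin N → Outcome) :
    ∏ i, (1 + c * codeWt k (o i)) = Real.exp (Real.log (1 + c) * Nwt k o) := by
  rw [Nwt, Finset.mul_sum, Real.exp_sum]
  refine Finset.prod_congr rfl fun i _ => ?_
  have h : codeWt k (o i) = 0 ∨ codeWt k (o i) = 1 := by
    cases o i <;> simp only [codeWt, true_or]
    split_ifs <;> simp
  rcases h with h | h <;> rw [h]
  · simp
  · rw [mul_one, mul_one, Real.exp_log (by linarith)]

theorem sum_prob_Nwt_tail_le {q : ℕ → ℝ} (hq : src.PhotonBound q) {k : Fin 4}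
    (hk : (k : ℕ) ∈ ({1, 2, 3} : Set ℕ)) {t ε : ℝ} (ht0 : 0 ≤ t) (ht1 : t ≤ 1) (hε : 0 < ε)
    (hε1 : ε ≤ 1) :
    ∑ o with t * q k * N + Gam (t * q k * N) ε < Nwt k o, prob t P V o ≤ ε := by
  have hqk := photonBound_nonneg P hq hk
  refine sum_tail_le (prob_nonneg P V ht0 ht1) (by positivity) hε hε1 fun c hc => ?_
  simp only [← prod_codeWt hc]
  refine (sum_prob_mul_prod_codeWt_le P V hq hk ht0 hc).trans ?_
  rw [show c * (t * q k * N) = N * (t * c * q k) by ring, Real.exp_nat_mul]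
  gcongr
  linarith [Real.add_one_le_exp (t * c * q k)]

end Chernoff

/-! ### The phase errors -/

section Final

variable {N : ℕ}

theorem ebit_mul_Nsamp (o : Fin N → Outcome) : ebit o * Nsamp o = Nbit o := by
  unfold ebit
  refine div_mul_cancel_of_imp fun h => ?_
  have : Nbit o ≤ Nsamp o := Finset.card_le_card fun i hi => by
    simp only [Finset.mem_filter, Finset.mem_univ, true_and] at hi ⊢
    exact ⟨_, hi⟩
  have h' : Nsamp o = 0 := by exact_mod_cast h
  have : Nbit o = 0 := by omega
  exact_mod_cast this

theorem Nph_le_Ndet (o : Fin N → Outcome) : Nph o ≤ Ndet o :=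
  Finset.card_le_card fun i hi => by
    simp only [Finset.mem_filter, Finset.mem_univ, true_and] at hi ⊢
    obtain ⟨a, ha⟩ := hi
    simp [ha]

/-- The polynomial multiplying `log ε` under the root is the square of `4a + 3√n`. This identity,
`bStar ≥ 0` and `aStar ≥ -√n / 2` are all that the proof uses of `aStar` and `bStar`; the explicit
fraction and `N3Star` only affect tightness. -/
theorem bStar_sq {n m ε : ℝ} (hn : 0 < n) (hε : 0 < ε) (hε1 : ε ≤ 1) :
    bStar n m ε ^ 2 =
      aStar n m ε ^ 2 - Real.log ε / 2 * (1 + 4 * aStar n m ε / (3 * √n)) ^ 2 := by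
  unfold bStar
  generalize aStar n m ε = a
  have hL : Real.log ε ≤ 0 := Real.log_nonpos hε.le hε1
  obtain ⟨s, hs, rfl⟩ : ∃ s, 0 < s ∧ n = s ^ 2 := ⟨√n, Real.sqrt_pos.2 hn, (Real.sq_sqrt hn.le).symm⟩
  have h0 : 0 ≤ 18 * a ^ 2 * s ^ 2 - (16 * a ^ 2 + 24 * a * s + 9 * s ^ 2) * Real.log ε := by
    nlinarith [mul_nonneg (neg_nonneg.2 hL) (sq_nonneg (4 * a + 3 * s)), sq_nonneg (a * s)]
  rw [Real.sqrt_sq hs.le, div_pow, Real.sq_sqrt h0, mul_pow, Real.sq_sqrt (by positivity)]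
  field_simp
  ring

theorem le_NphU {t : ℝ} {q : ℕ → ℝ} {ε₁ ε₂ : ℝ} (ht0 : 0 < t) (ht1 : t < 1) {o : Fin N → Outcome}
    (hM : ∀ k : Fin 4, (k : ℕ) ∈ ({1, 2, 3} : Set ℕ) →
      Nwt k o ≤ t * q k * N + Gam (t * q k * N) ε₂)
    (hB : 1 ≤ Ndet o →
      PhaseBound t (Ndet o) ε₁ (aStar (Ndet o) (N3Star (Ndet o) (t * q 3 * N + Gam (t * q 3 * N) ε₂)) ε₁)
        (bStar (Ndet o) (N3Star (Ndet o) (t * q 3 * N + Gam (t * q 3 * N) ε₂)) ε₁) o) :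
    Nph o ≤ NphU t q ε₁ ε₂ N (Ndet o) (Nsamp o) (ebit o) := by
  have h1 := hM 1 (by simp)
  have h2 := hM 2 (by simp)
  have h3 := hM 3 (by simp)
  simp only [Fin.val_one, Fin.val_two, show ((3 : Fin 4) : ℕ) = 3 from rfl] at h1 h2 h3
  have hl := lam_pos
  have ht : 0 < 1 - t := by linarith
  unfold NphU
  rw [mul_assoc (lam * t) (ebit o), ebit_mul_Nsamp]
  dsimp only
  rcases Nat.eq_zero_or_pos (Ndet o) with h0 | hpos
  -- Without detected rounds there are no phase errors, and every term of the bound is nonnegative.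
  · have e : (Nph o : ℝ) = 0 := by
      have := Nph_le_Ndet o
      have : Nph o = 0 := by omega
      exact_mod_cast this
    rw [e]
    have := (Nwt_nonneg 2 o).trans h2
    have hD : 0 ≤ Delta (Ndet o) (Dmax t ^ 2) ε₁ := Real.sqrt_nonneg _
    positivity
  · have hB := hB hpos
    have ha := le_max_left (-(√(Ndet o : ℝ) / 2)) _ |>.trans_eq
      (show _ = aStar (Ndet o) (N3Star (Ndet o) (t * q 3 * N + Gam (t * q 3 * N) ε₂)) ε₁ from rfl)
    unfold PhaseBound at hB
    generalize aStar (Ndet o) (N3Star (Ndet o) (t * q 3 * N + Gam (t * q 3 * N) ε₂)) ε₁ = a at ha hB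
    generalize bStar (Ndet o) (N3Star (Ndet o) (t * q 3 * N + Gam (t * q 3 * N) ε₂)) ε₁ = b at hB
    refine hB.trans ?_
    have hs : 0 < √(Ndet o : ℝ) := Real.sqrt_pos.2 (by exact_mod_cast hpos)
    have hD : 0 ≤ Delta (Ndet o) 1 ε₁ := Real.sqrt_nonneg _
    have hfac : 0 ≤ 1 + 2 * a / √(Ndet o : ℝ) := by
      have : -1 ≤ 2 * a / √(Ndet o : ℝ) := by
        rw [le_div_iff₀ hs]; linarith
      linarith
    have hy := add_le_add_left (mul_le_mul_of_nonneg_right h3 hfac) ((b - a) * √(Ndet o : ℝ))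
    have hx := add_le_add_left h1 (Delta (Ndet o) 1 ε₁)
    have hx0 : 0 ≤ Nwt 1 o + Delta (Ndet o) 1 ε₁ := add_nonneg (Nwt_nonneg 1 o) hD
    have hsq : √((Nwt 1 o + Delta (Ndet o) 1 ε₁)
          * (Nwt 3 o * (1 + 2 * a / √(Ndet o : ℝ)) + (b - a) * √(Ndet o : ℝ)))
        ≤ √((t * q 1 * N + Gam (t * q 1 * N) ε₂ + Delta (Ndet o) 1 ε₁)
          * ((t * q 3 * N + Gam (t * q 3 * N) ε₂) * (1 + 2 * a / √(Ndet o : ℝ))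
            + (b - a) * √(Ndet o : ℝ))) := by
      -- The factor coming from Kato's inequality may be negative; the root of the product is then 0
      -- by convention.
      rcases le_total 0 (Nwt 3 o * (1 + 2 * a / √(Ndet o : ℝ)) + (b - a) * √(Ndet o : ℝ)) with h | h
      · exact Real.sqrt_le_sqrt (mul_le_mul hx hy h (hx0.trans hx))
      · rw [Real.sqrt_eq_zero'.2 (mul_nonpos_of_nonneg_of_nonpos hx0 h)]
        exact Real.sqrt_nonneg _
    gcongr

open Classical in
theorem sum_not_phaseBound_star_le {t ε : ℝ} (ht0 : 0 < t) (ht1 : t < 1) (hε : 0 < ε) (hε1 : ε ≤ 1)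
    (M : ℝ) {Q : (Fin N → Outcome) → ℝ} (hQ : AllSteps (IsStepLaw t) N Q) {n : ℕ}
    (hn : ∀ o, Q o ≠ 0 → Ndet o = n) :
    ∑ o with 1 ≤ Ndet o ∧ ¬ PhaseBound t (Ndet o) ε (aStar (Ndet o) (N3Star (Ndet o) M) ε)
        (bStar (Ndet o) (N3Star (Ndet o) M) ε) o, Q o ≤ 3 * ε * ∑ o, Q o := by
  have h0 := hQ.nonneg
  rcases Nat.eq_zero_or_pos n with hz | hpos
  · rw [Finset.sum_eq_zero]
    · exact mul_nonneg (by positivity) (Finset.sum_nonneg fun o _ => h0 o)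
    · intro o ho
      by_contra hne
      have := hn o hne
      have := (Finset.mem_filter.1 ho).2.1
      omega
  · have hn0 : (0 : ℝ) < n := by exact_mod_cast hpos
    refine le_trans ?_ (sum_not_phaseBound_le ht0 ht1 hQ hn hpos hε hε1
      (a := aStar n (N3Star n M) ε) (b := bStar n (N3Star n M) ε) (le_max_left _ _)
      (div_nonneg (Real.sqrt_nonneg _) (by positivity)) (bStar_sq hn0 hε hε1))
    rw [Finset.sum_filter, Finset.sum_filter]
    refine Finset.sum_le_sum fun o _ => ?_
    by_cases hne : Q o = 0
    · simp [hne]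
    · rw [hn o hne]
      have := h0 o
      by_cases hB : PhaseBound t n ε (aStar n (N3Star n M) ε) (bStar n (N3Star n M) ε) o
      · simp [hB]
      · simp only [hB, not_false_eq_true, and_true, if_true]
        split_ifs <;> linarith

variable {K R E : Type*} {src : Source K} (P : Purification src R) (V : Attack K N E)

/-- The detected rounds. -/
def pattern (o : Fin N → Outcome) (i : Fin N) : Bool := decide (o i ≠ .undetected)

theorem expect_stepOp (t : ℝ) (d : Fin N → Bool) (o : Fin N → Outcome) :
    expect P V (tensorOp fun i => stepOp t (d i) (o i))
      = if pattern o = d then prob t P V o else 0 := by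
  split_ifs with h
  · rw [prob_eq_expect]
    congr 2
    funext i
    exact if_pos (congrFun h i)
  · obtain ⟨i, hi⟩ := Function.ne_iff.1 h
    have e : (tensorOp fun i => stepOp t (d i) (o i)) = 0 := by
      ext x y
      refine Finset.prod_eq_zero (Finset.mem_univ i) ?_
      have : stepOp t (d i) (o i) = 0 := if_neg hi
      simp only [this, Matrix.zero_apply]
    rw [e, map_zero]

theorem Ndet_eq_of_pattern {o : Fin N → Outcome} {d : Fin N → Bool} (h : pattern o = d) :
    Ndet o = (Finset.univ.filter fun i => d i = true).card := by
  rw [← h, Ndet]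
  congr 1
  ext i
  simp [pattern]

-- The probability is split over the patterns of detected rounds. For each pattern the number of
-- detected rounds is constant and the bound is proportional to the mass of the pattern, so the
-- bounds add up.
open Classical in
theorem sum_prob_not_phaseBound_le {t ε : ℝ} (ht0 : 0 < t) (ht1 : t < 1) (hε : 0 < ε) (hε1 : ε ≤ 1)
    (M : ℝ) :
    ∑ o with 1 ≤ Ndet o ∧ ¬ PhaseBound t (Ndet o) ε (aStar (Ndet o) (N3Star (Ndet o) M) ε)
        (bStar (Ndet o) (N3Star (Ndet o) M) ε) o, prob t P V o ≤ 3 * ε := by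
  have hsplit : ∀ o, prob t P V o
      = ∑ d : Fin N → Bool, expect P V (tensorOp fun i => stepOp t (d i) (o i)) := fun o => by
    simp only [expect_stepOp, Finset.sum_ite_eq, Finset.mem_univ, if_true]
  have hsteps : ∀ d : Fin N → Bool, AllSteps (IsStepLaw t) N
      fun o => expect P V (tensorOp fun i => stepOp t (d i) (o i)) := fun d => by
    exact allSteps_tensorOp (A := fun (i : Fin N) => stepOp t (d i))
      (fun i ω => stepOp_posSemidef ht0.le ht1.le (d i) ω)
      (fun i φ hφ => isStepLaw_stepOp ht0 ht1 φ hφ (d i)) _ fun M hM => expect_nonneg P V hM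
  have hd : ∀ d : Fin N → Bool, ∑ o with 1 ≤ Ndet o ∧ ¬ PhaseBound t (Ndet o) ε
        (aStar (Ndet o) (N3Star (Ndet o) M) ε) (bStar (Ndet o) (N3Star (Ndet o) M) ε) o,
        expect P V (tensorOp fun i => stepOp t (d i) (o i))
      ≤ 3 * ε * ∑ o : Fin N → Outcome, expect P V (tensorOp fun i => stepOp t (d i) (o i)) :=
      fun d => by
    refine sum_not_phaseBound_star_le ht0 ht1 hε hε1 M (hsteps d)
      (n := (Finset.univ.filter fun i => d i = true).card) fun o ho => ?_
    rw [expect_stepOp] at ho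
    exact Ndet_eq_of_pattern (of_not_not fun h => ho (if_neg h))
  calc _ = ∑ d : Fin N → Bool, ∑ o with 1 ≤ Ndet o ∧ ¬ PhaseBound t (Ndet o) ε
        (aStar (Ndet o) (N3Star (Ndet o) M) ε) (bStar (Ndet o) (N3Star (Ndet o) M) ε) o,
        expect P V (tensorOp fun i => stepOp t (d i) (o i)) := by
        rw [Finset.sum_comm]
        exact Finset.sum_congr rfl fun o _ => hsplit o
    _ ≤ ∑ d : Fin N → Bool, 3 * ε *
          ∑ o : Fin N → Outcome, expect P V (tensorOp fun i => stepOp t (d i) (o i)) :=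
        Finset.sum_le_sum fun d _ => hd d
    _ = 3 * ε * ∑ o, prob t P V o := by
        rw [← Finset.mul_sum, Finset.sum_comm]
        simp only [← hsplit]
    _ ≤ 3 * ε := mul_le_of_le_one_right (by positivity) (sum_prob_le_one P V t)

theorem Pr_NphU_lt_le {q : ℕ → ℝ} (hq : src.PhotonBound q) {t ε₁ ε₂ : ℝ} (ht0 : 0 < t) (ht1 : t < 1)
    (hε₁ : 0 < ε₁) (hε₁' : ε₁ ≤ 1) (hε₂ : 0 < ε₂) (hε₂' : ε₂ ≤ 1) :
    Pr t P V (fun o => NphU t q ε₁ ε₂ N (Ndet o) (Nsamp o) (ebit o) < Nph o)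
      ≤ 3 * ε₁ + 3 * ε₂ := by
  classical
  have hp := prob_nonneg P V ht0.le ht1.le
  have h1 := sum_prob_Nwt_tail_le P V hq (k := 1) (by simp) ht0.le ht1.le hε₂ hε₂'
  have h2 := sum_prob_Nwt_tail_le P V hq (k := 2) (by simp) ht0.le ht1.le hε₂ hε₂'
  have h3 := sum_prob_Nwt_tail_le P V hq (k := 3) (by simp) ht0.le ht1.le hε₂ hε₂'
  have h4 := sum_prob_not_phaseBound_le P V ht0 ht1 hε₁ hε₁'
    (t * q 3 * N + Gam (t * q 3 * N) ε₂)
  refine le_trans ?_ ((add_le_add (add_le_add (add_le_add h1 h2) h3) h4).trans (by linarith))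
  unfold Pr
  simp only [Finset.sum_filter]
  rw [← Finset.sum_add_distrib, ← Finset.sum_add_distrib, ← Finset.sum_add_distrib]
  refine Finset.sum_le_sum fun o _ => ?_
  have h0 := hp o
  have key := le_NphU (q := q) (ε₁ := ε₁) (ε₂ := ε₂) ht0 ht1 (o := o)
  by_contra hcon
  rw [not_le] at hcon
  have c1 : ¬ (t * q (1 : Fin 4) * N + Gam (t * q (1 : Fin 4) * N) ε₂ < Nwt 1 o) := fun h => by
    simp only [h, if_true] at hcon
    split_ifs at hcon <;> linarith
  have c2 : ¬ (t * q (2 : Fin 4) * N + Gam (t * q (2 : Fin 4) * N) ε₂ < Nwt 2 o) := fun h => by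
    simp only [h, if_true] at hcon
    split_ifs at hcon <;> linarith
  have c3 : ¬ (t * q (3 : Fin 4) * N + Gam (t * q (3 : Fin 4) * N) ε₂ < Nwt 3 o) := fun h => by
    simp only [h, if_true] at hcon
    split_ifs at hcon <;> linarith
  have c4 : ¬ (NphU t q ε₁ ε₂ N (Ndet o) (Nsamp o) (ebit o) < Nph o) → False := fun h => by
    simp only [h, if_false] at hcon
    split_ifs at hcon <;> linarith
  refine c4 (not_lt.2 (key (fun k hk => ?_) fun hn => ?_))
  · fin_cases k
    · simp at hk
    · exact not_lt.1 c1
    · exact not_lt.1 c2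
    · exact not_lt.1 c3
  · by_contra hB
    simp only [hn, hB, not_false_eq_true, and_self, if_true] at hcon
    split_ifs at hcon <;> linarith

end Final

/-! ### Existence of purifications with equal vacuum components -/

section Existence

open scoped ComplexConjugate InnerProductSpace

/-- A linear isometry maps any vector to any other of the same norm. -/
theorem exists_linearIsometry_apply_eq {H : Type*} [NormedAddCommGroup H] [InnerProductSpace ℂ H]
    {v w : H} (h : ‖v‖ = ‖w‖) : ∃ U : H →ₗᵢ[ℂ] H, U v = w := by
  -- A phase makes the inner product with `w` real. Then `x - w` and `x + w` are orthogonal, and the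
  -- reflection in the complement of `x - w` sends `x` to `w`.
  obtain ⟨c, hc, hreal⟩ : ∃ c : ℂ, ‖c‖ = 1 ∧ ⟪c • v, w⟫_ℂ = ⟪w, c • v⟫_ℂ := by
    by_cases h0 : ⟪v, w⟫_ℂ = 0
    · have h1 : ⟪w, v⟫_ℂ = 0 := by rw [← inner_conj_symm, h0, map_zero]
      exact ⟨1, norm_one, by rw [one_smul, h0, h1]⟩
    · have hn : (‖⟪v, w⟫_ℂ‖ : ℂ) ≠ 0 := by simpa using h0
      refine ⟨⟪v, w⟫_ℂ / ‖⟪v, w⟫_ℂ‖, ?_, ?_⟩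
      · rw [norm_div, Complex.norm_real, norm_norm, div_self (by simpa using h0)]
      · rw [inner_smul_left, inner_smul_right, ← inner_conj_symm w v, map_div₀, Complex.conj_ofReal]
        ring
  obtain ⟨x, hx⟩ : ∃ x, x = c • v := ⟨_, rfl⟩
  have hxn : ‖x‖ = ‖w‖ := by rw [hx, norm_smul, hc, one_mul, h]
  rw [← hx] at hreal
  let S := (ℂ ∙ (x - w))ᗮ.reflection
  have hS : S x = w := by
    have h1 : S (x - w) = -(x - w) := Submodule.reflection_orthogonalComplement_singleton_eq_neg _
    have h2 : S (x + w) = x + w := by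
      refine Submodule.reflection_mem_subspace_eq_self ?_
      rw [Submodule.mem_orthogonal_singleton_iff_inner_right, inner_add_right, inner_sub_left,
        inner_sub_left, inner_self_eq_norm_sq_to_K, inner_self_eq_norm_sq_to_K, hxn, hreal]
      ring
    rw [map_sub] at h1
    rw [map_add] at h2
    have h3 : (2 : ℂ) • S x = (2 : ℂ) • w := by
      rw [two_smul, two_smul]
      calc S x + S x = (S x - S w) + (S x + S w) := by abel
        _ = w + w := by rw [h1, h2]; abel
    exact smul_right_injective H two_ne_zero h3
  refine ⟨⟨c • S.toLinearEquiv.toLinearMap, fun y => ?_⟩, ?_⟩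
  · change ‖c • S y‖ = ‖y‖
    rw [norm_smul, hc, one_mul, S.norm_map]
  · change c • S v = w
    rw [← map_smul, ← hx, hS]

theorem exists_inner_eq_inner_apply {H : Type*} [NormedAddCommGroup H] [InnerProductSpace ℂ H]
    [CompleteSpace H] {T : H →L[ℂ] H} (hT : T.IsPositive) :
    ∃ A : H →L[ℂ] H, ∀ x y, ⟪A x, A y⟫_ℂ = ⟪x, T y⟫_ℂ := by
  have hA := (ContinuousLinearMap.nonneg_iff_isPositive _).1 (CFC.sqrt_nonneg T)
  have hsq := CFC.sqrt_mul_sqrt_self T ((ContinuousLinearMap.nonneg_iff_isPositive T).2 hT)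
  refine ⟨CFC.sqrt T, fun x y => ?_⟩
  conv_rhs => rw [← hsq]
  exact hA.isSymmetric _ _

variable {α : Type*}

/-- The vectors are the images of the basis vectors under the square root of `ρ`. -/
theorem exists_inner_eq_matEl {ρ : ℓ²(α, ℂ) →L[ℂ] ℓ²(α, ℂ)} (hρ : ρ.IsPositive) :
    ∃ v : α → ℓ²(α, ℂ), ∀ s s', ⟪v s, v s'⟫_ℂ = matEl ρ s s' := by
  classical
  obtain ⟨A, hA⟩ := exists_inner_eq_inner_apply hρ
  refine ⟨fun s => A (lp.single 2 s (1 : ℂ)), fun s s' => ?_⟩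
  rw [hA, lp.inner_single_left, matEl, RCLike.inner_apply, map_one, mul_one]

theorem hasSum_conj_mul {ρ : ℓ²(α, ℂ) →L[ℂ] ℓ²(α, ℂ)} {v : α → ℓ²(α, ℂ)}
    (hv : ∀ s s', ⟪v s, v s'⟫_ℂ = matEl ρ s s') (s s' : α) :
    HasSum (fun r => conj (v s r) * v s' r) (matEl ρ s s') := by
  rw [← hv]
  have h := lp.hasSum_inner (𝕜 := ℂ) (v s) (v s')
  simpa only [RCLike.inner_apply, mul_comm] using h

/-- Square summability is the finiteness of the trace. The conjugate compensates the antilinearity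
of the inner product in its first argument. -/
theorem exists_purification {ρ : ℓ²(α, ℂ) →L[ℂ] ℓ²(α, ℂ)} (hρ : IsDensity ρ) {v : α → ℓ²(α, ℂ)}
    (hv : ∀ s s', ⟪v s, v s'⟫_ℂ = matEl ρ s s') :
    ∃ ψ : ℓ²(α × α, ℂ), ∀ s r, ψ (s, r) = conj (v s r) := by
  refine ⟨⟨fun x => conj (v x.1 x.2), memℓp_two_of_summable ?_⟩, fun _ _ => rfl⟩
  have h : ∀ s, HasSum (fun r => ‖conj (v s r)‖ ^ 2) (matEl ρ s s).re := fun s => by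
    have h := Complex.hasSum_re (hasSum_conj_mul hv s s)
    simp only [Complex.conj_mul'] at h
    simpa only [RCLike.norm_conj, ← Complex.ofReal_pow, Complex.ofReal_re] using h
  refine (summable_prod_of_nonneg fun _ => by positivity).2 ⟨fun s => (h s).summable, ?_⟩
  simp only [(h _).tsum_eq]
  exact (Complex.hasSum_re hρ.2).summable

/-- An isometry of the purifying system leaves all inner products, hence the purified state,
unchanged. Equal vacuum probabilities mean that the two vacuum vectors have the same norm, so an
isometry can carry one to the other. -/
theorem Source.VacuumIndependent.nonempty_purification {K : Type*} {src : Source K}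
    (h : src.VacuumIndependent) : Nonempty (Purification src (K →₀ ℕ)) := by
  choose v hv using fun u b => exists_inner_eq_matEl (src.density u b).1
  have hU : ∀ u, ∃ U : ℓ²(K →₀ ℕ, ℂ) →ₗᵢ[ℂ] ℓ²(K →₀ ℕ, ℂ), U (v u 1 0) = v u 0 0 := fun u => by
    refine exists_linearIsometry_apply_eq ?_
    have e := h u
    rw [← hv, ← hv, inner_self_eq_norm_sq_to_K, inner_self_eq_norm_sq_to_K] at e
    have e' : ‖v u 0 0‖ ^ 2 = ‖v u 1 0‖ ^ 2 := by exact_mod_cast e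
    exact ((sq_eq_sq₀ (norm_nonneg _) (norm_nonneg _)).1 e').symm
  choose U hU using hU
  obtain ⟨v', hv'⟩ : ∃ v' : Fin 3 → Fin 2 → (K →₀ ℕ) → ℓ²(K →₀ ℕ, ℂ),
      v' = fun u b s => if b = 0 then v u b s else U u (v u b s) := ⟨_, rfl⟩
  have hinner : ∀ u b s s', ⟪v' u b s, v' u b s'⟫_ℂ = matEl (src.ρ u b) s s' := fun u b s s' => by
    rw [hv', ← hv]
    dsimp only
    split_ifs
    · rfl
    · exact (U u).inner_map_map _ _
  choose ψ hψ using fun u b => exists_purification (src.density u b) (hinner u b)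
  refine ⟨ψ, fun u b s s' => ?_, fun u r => ?_⟩
  · simpa only [hψ, Complex.star_def, Complex.conj_conj] using hasSum_conj_mul (hinner u b) s s'
  · rw [hψ, hψ, hv']
    simp [hU]

end Existence

end DPS

end

theorem theorem3 {K : Type*} (src : DPS.Source K) (hvac : src.VacuumIndependent)
    (q : ℕ → ℝ) (hq : src.PhotonBound q)
    (t : ℝ) (ht0 : 0 < t) (ht1 : t < 1)
    (ε₁ ε₂ : ℝ) (hε₁ : 0 < ε₁) (hε₁' : ε₁ ≤ 1) (hε₂ : 0 < ε₂) (hε₂' : ε₂ ≤ 1) :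
    Nonempty (DPS.Purification src (K →₀ ℕ)) ∧
    ∀ (R : Type*) (P : DPS.Purification src R) (Nem : ℕ) (E : Type*) (V : DPS.Attack K Nem E),
      DPS.Pr t P V (fun o =>
          DPS.NphU t q ε₁ ε₂ Nem (DPS.Ndet o) (DPS.Nsamp o) (DPS.ebit o) < DPS.Nph o)
        ≤ 3 * ε₁ + 3 * ε₂ :=
  ⟨hvac.nonempty_purification, fun _ P _ _ V =>
    DPS.Pr_NphU_lt_le P V hq ht0 ht1 hε₁ hε₁' hε₂ hε₂'⟩
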